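/- Let $0<r<\infty$ and let $h\colon[0,r]\to[0,\infty)$ be continuous with $h(0)=0$, differentiable on $(0,r)$ with $h'(t)\neq0$ there, and such that $$s_h:=\sup_{0<t<r}\frac{h(t)}{t\,h'(t)}<+\infty .$$ Then $h$ is strictly increasing on $[0,r]$. Moreover, let $m\colon[0,r]\to\mathbb R$ be any increasing (i.e. non-decreasing) function, put $M:=m(r)-m(0)$, and suppose that its modulus of continuity $$\omega_m(t):=\sup\{m(x)-m(x') : x-x'\le t,\ 0\le x'\le x\le r\}$$ satisfies $\omega_m(t)\le h(t)$ for all $t\in[0,r]$. Then there is exactly one point $h^{-1}(M)\in[0,r]$ at which $h$ takes the value $M$, and the following holds for every $R\in(r,\infty)$ and every $\delta$-subharmonic function $U\not\equiv\pm\infty$ in a neighbourhood of the closed disc $\overline D(R)=\{z\in\mathbb C:|z|\le R\}$. Here $U=u-v$, where $u,v\not\equiv-\infty$ are subharmonic functions on a connected open set containing $\overline D(R)$ (at the points where $u=v=-\infty$ the value of $U$ may be any element of $[-\infty,+\infty]$). Let $\Delta_u,\Delta_v$ be the Riesz measures of $u,v$, that is, $\frac1{2\pi}$ times their distributional Laplacians,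 let $\Delta_U^-:=\sup\{\Delta_v,\Delta_u\}-\Delta_u$ be the lower variation of the Riesz charge $\Delta_u-\Delta_v$ of $U$, let $\mathsf M_U(t):=\sup_{0\le\theta<2\pi}U(te^{i\theta})$, and let $$\boldsymbol T_U(r_0,R):=\frac1{2\pi}\int_0^{2\pi}U^+(Re^{i\theta})\,d\theta+\int_{r_0}^R\frac{\Delta_U^-(\overline D(t))}{t}\,dt\in[0,+\infty],\qquad 0\le r_0<R,$$ where $x^+:=\max\{x,0\}$. Then the Lebesgue–Stieltjes integral $\int_0^r\mathsf M_U^+(t)\,dm(t)$ exists and is finite, and $$\int_0^r \mathsf M_U^+(t)\,dm(t)\le\frac{6R}{R-r}\,\boldsymbol T_U(r,R)\,M\ln\frac{4e^{s_h}R}{h^{-1}(M)},$$ where the first argument $r$ of $\boldsymbol T_U(r,R)$ may be replaced by any $r_0\in[0,r]$. (If $M=0$, the right-hand side is understood to be $0$.) -/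

import Mathlib

open MeasureTheory Set
open scoped ENNReal ContDiff

namespace DeltaSubharmonic

noncomputable section

/-- `(1/2π) ∫₀^{2π} f⁺(c + ρ e^{iθ}) dθ ∈ [0, ∞]`, the circular mean of the positive part of `f`
(`EReal.toENNReal` sends negative values to `0`). -/
def circleMeanPos (f : ℂ → EReal) (c : ℂ) (ρ : ℝ) : ℝ≥0∞ :=
  (∫⁻ θ in Ioc 0 (2 * Real.pi), (f (circleMap c ρ θ)).toENNReal) / ENNReal.ofReal (2 * Real.pi)

/-- `(1/2π) ∫₀^{2π} f(c + ρ e^{iθ}) dθ` as an extended real number. It is used only for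
functions that are bounded above on the circle, so that the first term is finite. -/
def circleMean (f : ℂ → EReal) (c : ℂ) (ρ : ℝ) : EReal :=
  (circleMeanPos f c ρ : EReal) - (circleMeanPos (fun z => -f z) c ρ : EReal)

/-- Subharmonic functions on `Ω` with values in `[-∞, ∞)`; the function `≡ -∞` is allowed. -/
structure IsSubharmonicOn (u : ℂ → EReal) (Ω : Set ℂ) : Prop where
  usc : UpperSemicontinuousOn u Ω
  lt_top : ∀ z ∈ Ω, u z < ⊤
  submean : ∀ z ∈ Ω, ∀ ρ : ℝ, 0 < ρ → Metric.closedBall z ρ ⊆ Ω → u z ≤ circleMean u z ρ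

/-- `μ` is the measure `(1/2π) Δu` on `Ω` in the sense of distributions. -/
structure IsRieszMeasure (u : ℂ → EReal) (Ω : Set ℂ) (μ : Measure ℂ) : Prop where
  compl_eq_zero : μ Ωᶜ = 0
  finite_on_compacts : ∀ K ⊆ Ω, IsCompact K → μ K < ⊤
  integral_eq : ∀ φ : ℂ → ℝ, ContDiff ℝ ∞ φ → HasCompactSupport φ → tsupport φ ⊆ Ω →
    ∫ z, φ z ∂μ = (2 * Real.pi)⁻¹ * ∫ z, (u z).toReal * Laplacian.laplacian φ z

open Classical in
/-- The Riesz measure of `u` on `Ω`. -/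
def rieszMeasure (u : ℂ → EReal) (Ω : Set ℂ) : Measure ℂ :=
  if h : ∃ μ, IsRieszMeasure u Ω μ then h.choose else 0

/-- `U = u - v` is a δ-subharmonic function, `≢ ±∞`, on the domain `Ω`, represented by the
subharmonic functions `u, v ≢ -∞`. At the points with `u = v = -∞`, where the difference is not
defined, the value of `U` is arbitrary. -/
structure IsDeltaSubharmonicOn (U u v : ℂ → EReal) (Ω : Set ℂ) : Prop where
  isOpen : IsOpen Ω
  isPreconnected : IsPreconnected Ω
  subharmonic_left : IsSubharmonicOn u Ω
  subharmonic_right : IsSubharmonicOn v Ω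
  left_ne_bot : ∃ z ∈ Ω, u z ≠ ⊥
  right_ne_bot : ∃ z ∈ Ω, v z ≠ ⊥
  eq_sub : ∀ z ∈ Ω, (u z ≠ ⊥ ∨ v z ≠ ⊥) → U z = u z - v z

/-- The lower variation `sup {Δ_v, Δ_u} - Δ_u` of the Riesz charge `Δ_u - Δ_v` of `u - v`. -/
def rieszLowerVariation (u v : ℂ → EReal) (Ω : Set ℂ) : Measure ℂ :=
  (rieszMeasure v Ω ⊔ rieszMeasure u Ω) - rieszMeasure u Ω

/-- `N_μ(r, R) = ∫_r^R μ(D̄(t)) / t dt`. -/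
def countingN (μ : Measure ℂ) (r R : ℝ) : ℝ≥0∞ :=
  ∫⁻ t in Ioc r R, μ (Metric.closedBall 0 t) / ENNReal.ofReal t

/-- The difference Nevanlinna characteristic `T_U(r, R) = C_{U⁺}(R) + N_{Δ_U⁻}(r, R)` of
`U = u - v`. -/
def nevanlinnaT (U u v : ℂ → EReal) (Ω : Set ℂ) (r R : ℝ) : ℝ≥0∞ :=
  circleMeanPos U 0 R + countingN (rieszLowerVariation u v Ω) r R

/-- `M_U(t) = sup {U(t e^{iθ}) | θ ∈ [0, 2π)}`. -/
def maxChar (U : ℂ → EReal) (t : ℝ) : EReal :=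
  ⨆ θ ∈ Ico (0 : ℝ) (2 * Real.pi), U (circleMap 0 t θ)

/-- The modulus of continuity of an increasing function `m` on `[0, r]`. -/
def modulus (m : ℝ → ℝ) (r t : ℝ) : ℝ :=
  sSup {y | ∃ x x' : ℝ, x - x' ≤ t ∧ 0 ≤ x' ∧ x' ≤ x ∧ x ≤ r ∧ y = m x - m x'}

/-- The Lebesgue–Stieltjes measure `dm` on `[0, r]` of an increasing function `m` on `[0, r]`
(extended by constants to the left of `0` and to the right of `r`). -/
def stieltjesMeasure (m : ℝ → ℝ) {r : ℝ} (hr : 0 ≤ r) (hm : MonotoneOn m (Icc 0 r)) : Measure ℝ :=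
  ((monotoneOn_iff_monotone.1 hm).IccExtend hr).stieltjesFunction.measure.restrict (Icc 0 r)

/-- `s_h = sup_{0 < t < r} h(t) / (t h'(t))`. -/
def sConst (h : ℝ → ℝ) (r : ℝ) : ℝ :=
  sSup ((fun t => h t / (t * deriv h t)) '' Ioo 0 r)

end

end DeltaSubharmonic

namespace DeltaSubharmonic

noncomputable section

/-! ### The majorant of the modulus of continuity -/

section Majorant

variable {r : ℝ} {h : ℝ → ℝ}

theorem deriv_pos_of_deriv_ne_zero (hr : 0 < r) (h_nonneg : ∀ t ∈ Icc 0 r, 0 ≤ h t)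
    (h_cont : ContinuousOn h (Icc 0 r)) (h_zero : h 0 = 0)
    (h_diff : DifferentiableOn ℝ h (Ioo 0 r)) (h_deriv : ∀ t ∈ Ioo 0 r, deriv h t ≠ 0) :
    ∀ t ∈ Ioo 0 r, 0 < deriv h t := by
  have hd : ∀ x ∈ Ioo 0 r, HasDerivWithinAt h (deriv h x) (Ioo 0 r) x := fun x hx =>
    ((h_diff x hx).differentiableAt (isOpen_Ioo.mem_nhds hx)).hasDerivAt.hasDerivWithinAt
  rcases hasDerivWithinAt_forall_lt_or_forall_gt_of_forall_ne (convex_Ioo 0 r) hd h_deriv with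
    hneg | hpos
  · exfalso
    have hanti : StrictAntiOn h (Icc 0 r) :=
      strictAntiOn_of_deriv_neg (convex_Icc 0 r) h_cont (by simpa using hneg)
    have h1 := hanti (left_mem_Icc.2 hr.le) (right_mem_Icc.2 hr.le) hr
    have h2 := h_nonneg r (right_mem_Icc.2 hr.le)
    linarith
  · exact hpos

theorem strictMonoOn_of_deriv_ne_zero (hr : 0 < r) (h_nonneg : ∀ t ∈ Icc 0 r, 0 ≤ h t)
    (h_cont : ContinuousOn h (Icc 0 r)) (h_zero : h 0 = 0)
    (h_diff : DifferentiableOn ℝ h (Ioo 0 r)) (h_deriv : ∀ t ∈ Ioo 0 r, deriv h t ≠ 0) :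
    StrictMonoOn h (Icc 0 r) :=
  strictMonoOn_of_deriv_pos (convex_Icc 0 r) h_cont (by
    simpa using deriv_pos_of_deriv_ne_zero hr h_nonneg h_cont h_zero h_diff h_deriv)

theorem sConst_nonneg (hr : 0 < r) (h_nonneg : ∀ t ∈ Icc 0 r, 0 ≤ h t)
    (hpos : ∀ t ∈ Ioo 0 r, 0 < deriv h t)
    (h_bdd : BddAbove ((fun t => h t / (t * deriv h t)) '' Ioo 0 r)) : 0 ≤ sConst h r := by
  have hm : r / 2 ∈ Ioo 0 r := ⟨by linarith, by linarith⟩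
  have h1 : 0 ≤ h (r / 2) / (r / 2 * deriv h (r / 2)) :=
    div_nonneg (h_nonneg _ (Ioo_subset_Icc_self hm)) (mul_nonneg hm.1.le (hpos _ hm).le)
  exact h1.trans (le_csSup h_bdd ⟨_, hm, rfl⟩)

theorem div_le_sConst_mul_deriv (hpos : ∀ t ∈ Ioo 0 r, 0 < deriv h t)
    (h_bdd : BddAbove ((fun t => h t / (t * deriv h t)) '' Ioo 0 r)) {t : ℝ} (ht : t ∈ Ioo 0 r) :
    h t / t ≤ sConst h r * deriv h t := by
  have h1 : h t / (t * deriv h t) ≤ sConst h r := le_csSup h_bdd ⟨t, ht, rfl⟩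
  have h2 := hpos t ht
  have h3 := ht.1
  rw [div_le_iff₀ (by positivity)] at h1
  rw [div_le_iff₀ h3]
  linarith

/-- `∫₀ᵃ h(x)/x dx ≤ s_h h(a)`. -/
theorem lintegral_div_le (h_cont : ContinuousOn h (Icc 0 r)) (h_zero : h 0 = 0)
    (h_diff : DifferentiableOn ℝ h (Ioo 0 r)) (hpos : ∀ t ∈ Ioo 0 r, 0 < deriv h t)
    (hs : 0 ≤ sConst h r)
    (h_bdd : BddAbove ((fun t => h t / (t * deriv h t)) '' Ioo 0 r)) {a : ℝ} (ha : a ∈ Icc 0 r) :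
    ∫⁻ x in Ioo 0 a, ENNReal.ofReal (h x / x) ≤ ENNReal.ofReal (sConst h r * h a) := by
  have hsub : Ioo 0 a ⊆ Ioo 0 r := Ioo_subset_Ioo_right ha.2
  have hc : ContinuousOn h (Icc 0 a) := h_cont.mono (Icc_subset_Icc_right ha.2)
  have hd : ∀ x ∈ Ioo 0 a, HasDerivAt h (deriv h x) x := fun x hx =>
    ((h_diff x (hsub hx)).differentiableAt (isOpen_Ioo.mem_nhds (hsub hx))).hasDerivAt
  have hint : IntegrableOn (deriv h) (Ioc 0 a) :=
    intervalIntegral.integrableOn_deriv_of_nonneg hc hd fun x hx => (hpos x (hsub hx)).le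
  have hint' : IntegrableOn (deriv h) (Ioo 0 a) := hint.mono_set Ioo_subset_Ioc_self
  calc ∫⁻ x in Ioo 0 a, ENNReal.ofReal (h x / x)
      ≤ ∫⁻ x in Ioo 0 a, ENNReal.ofReal (sConst h r * deriv h x) :=
        setLIntegral_mono' measurableSet_Ioo fun x hx =>
          ENNReal.ofReal_le_ofReal (div_le_sConst_mul_deriv hpos h_bdd (hsub hx))
    _ = ENNReal.ofReal (∫ x in Ioo 0 a, sConst h r * deriv h x) := by
        rw [ofReal_integral_eq_lintegral_ofReal (hint'.const_mul _)]
        filter_upwards [ae_restrict_mem measurableSet_Ioo] with x hx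
        exact mul_nonneg hs (hpos x (hsub hx)).le
    _ = ENNReal.ofReal (sConst h r * h a) := by
        rw [integral_const_mul, ← integral_Ioc_eq_integral_Ioo,
          ← intervalIntegral.integral_of_le ha.1,
          intervalIntegral.integral_eq_sub_of_hasDerivAt_of_le ha.1 hc hd
            ((intervalIntegrable_iff_integrableOn_Ioc_of_le ha.1).2 hint), h_zero, sub_zero]

end Majorant

/-! ### The Stieltjes measure -/

section Stieltjes

variable {r : ℝ} {h m : ℝ → ℝ}

theorem sub_le_modulus (hm : MonotoneOn m (Icc 0 r)) {x x' t : ℝ} (ht : x - x' ≤ t) (h0 : 0 ≤ x')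
    (hx : x' ≤ x) (hr : x ≤ r) : m x - m x' ≤ modulus m r t := by
  refine le_csSup ⟨m r - m 0, ?_⟩ ⟨x, x', ht, h0, hx, hr, rfl⟩
  rintro y ⟨x, x', -, h1, h2, h3, rfl⟩
  have hr : 0 ≤ r := by linarith
  have := hm (left_mem_Icc.2 hr) ⟨h1, h2.trans h3⟩ h1
  have := hm ⟨h1.trans h2, h3⟩ (right_mem_Icc.2 hr) h3
  linarith

theorem sub_le_of_modulus_le (hm : MonotoneOn m (Icc 0 r))
    (hmod : ∀ t ∈ Icc 0 r, modulus m r t ≤ h t) {x x' : ℝ} (h0 : 0 ≤ x')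
    (hx : x' ≤ x) (hr : x ≤ r) : m x - m x' ≤ h (x - x') :=
  (sub_le_modulus hm le_rfl h0 hx hr).trans (hmod _ ⟨by linarith, by linarith⟩)

theorem exists_majorant_eq (hr : 0 < r) (h_cont : ContinuousOn h (Icc 0 r)) (h_zero : h 0 = 0)
    (hm : MonotoneOn m (Icc 0 r)) (hmod : ∀ t ∈ Icc 0 r, modulus m r t ≤ h t) :
    ∃ a ∈ Icc 0 r, h a = m r - m 0 := by
  have h1 : m r - m 0 ≤ h r := by
    simpa using sub_le_of_modulus_le hm hmod le_rfl hr.le le_rfl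
  have h2 : m 0 ≤ m r := hm (left_mem_Icc.2 hr.le) (right_mem_Icc.2 hr.le) hr.le
  exact intermediate_value_Icc hr.le h_cont ⟨by linarith, h1⟩

theorem iccExtend_eq (hr : 0 ≤ r) (x : ℝ) :
    IccExtend hr (fun x : Icc 0 r => m x) x = m (max 0 (min r x)) := rfl

theorem iccExtend_sub_le (hr : 0 ≤ r) (hm : MonotoneOn m (Icc 0 r))
    (hmod : ∀ t ∈ Icc 0 r, modulus m r t ≤ h t) (hmono : MonotoneOn h (Icc 0 r))
    {x x' : ℝ} (hx : x' ≤ x) (hxr : x - x' ≤ r) :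
    IccExtend hr (fun x : Icc 0 r => m x) x - IccExtend hr (fun x : Icc 0 r => m x) x' ≤
      h (x - x') := by
  rw [iccExtend_eq, iccExtend_eq]
  have h1 : max 0 (min r x') ≤ max 0 (min r x) := by gcongr
  have h2 : max 0 (min r x) ≤ r := max_le hr (min_le_left _ _)
  refine (sub_le_of_modulus_le hm hmod (le_max_left _ _) h1 h2).trans (hmono ?_ ?_ ?_)
  · constructor
    · linarith
    · have : 0 ≤ max 0 (min r x') := le_max_left _ _
      linarith
  · exact ⟨by linarith, hxr⟩
  · rcases max_cases 0 (min r x) with ⟨h3, h4⟩ | ⟨h3, h4⟩ <;>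
    rcases max_cases 0 (min r x') with ⟨h5, h6⟩ | ⟨h5, h6⟩ <;>
    rcases min_cases r x with ⟨h7, h8⟩ | ⟨h7, h8⟩ <;>
    rcases min_cases r x' with ⟨h9, h10⟩ | ⟨h9, h10⟩ <;> linarith

theorem continuous_iccExtend (hr : 0 ≤ r) (hm : MonotoneOn m (Icc 0 r))
    (h_cont : ContinuousOn h (Icc 0 r)) (h_zero : h 0 = 0)
    (hmod : ∀ t ∈ Icc 0 r, modulus m r t ≤ h t) :
    Continuous (IccExtend hr (fun x : Icc 0 r => m x)) := by
  refine Continuous.Icc_extend' ?_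
  change Continuous ((Icc 0 r).domRestrict m)
  rw [← continuousOn_iff_continuous_domRestrict, Metric.continuousOn_iff]
  intro x hx ε hε
  have h0 : ContinuousWithinAt h (Icc 0 r) 0 := h_cont 0 (left_mem_Icc.2 hr)
  obtain ⟨δ, hδ, H⟩ := Metric.continuousWithinAt_iff.1 h0 ε hε
  refine ⟨δ, hδ, fun y hy hyx => ?_⟩
  have key : ∀ x ∈ Icc 0 r, ∀ y ∈ Icc 0 r, x ≤ y → dist y x < δ → |m y - m x| < ε := by
    intro x hx y hy hxy hd
    have h1 : m y - m x ≤ h (y - x) := sub_le_of_modulus_le hm hmod hx.1 hxy hy.2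
    have h2 : m x ≤ m y := hm hx hy hxy
    have h3 := H (x := y - x) ⟨by linarith, by linarith [hx.1, hy.2]⟩
      (by simpa [Real.dist_eq] using hd)
    rw [h_zero, Real.dist_eq, sub_zero] at h3
    rw [abs_of_nonneg (by linarith)]
    linarith [le_abs_self (h (y - x))]
  rw [Real.dist_eq]
  rcases le_total x y with hxy | hxy
  · exact key x hx y hy hxy hyx
  · rw [abs_sub_comm]
    exact key y hy x hx hxy (by rwa [dist_comm])

theorem stieltjesFunction_apply_of_continuous {f : ℝ → ℝ} (hf : Monotone f) (hc : Continuous f)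
    (x : ℝ) : hf.stieltjesFunction x = f x := by
  rw [hf.stieltjesFunction_eq]
  exact rightLim_eq_of_tendsto (hc.tendsto x |>.mono_left nhdsWithin_le_nhds)

theorem stieltjesFunction_measure_Icc {f : ℝ → ℝ} (hf : Monotone f) (hc : Continuous f)
    (c d : ℝ) : hf.stieltjesFunction.measure (Icc c d) = ENNReal.ofReal (f d - f c) := by
  have h1 : (hf.stieltjesFunction : ℝ → ℝ) = f :=
    funext (stieltjesFunction_apply_of_continuous hf hc)
  rw [StieltjesFunction.measure_Icc, h1, leftLim_eq_of_tendsto 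
    (hc.tendsto c |>.mono_left nhdsWithin_le_nhds)]

theorem stieltjesMeasure_univ (hr : 0 ≤ r) (hm : MonotoneOn m (Icc 0 r))
    (h_cont : ContinuousOn h (Icc 0 r)) (h_zero : h 0 = 0)
    (hmod : ∀ t ∈ Icc 0 r, modulus m r t ≤ h t) :
    stieltjesMeasure m hr hm univ = ENNReal.ofReal (m r - m 0) := by
  rw [stieltjesMeasure, Measure.restrict_apply_univ, stieltjesFunction_measure_Icc _
    (continuous_iccExtend hr hm h_cont h_zero hmod), iccExtend_eq, iccExtend_eq]
  simp [hr]

theorem stieltjesMeasure_Icc_le (hr : 0 ≤ r) (hm : MonotoneOn m (Icc 0 r))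
    (h_cont : ContinuousOn h (Icc 0 r)) (h_zero : h 0 = 0)
    (hmod : ∀ t ∈ Icc 0 r, modulus m r t ≤ h t) (hmono : MonotoneOn h (Icc 0 r))
    {c d : ℝ} (hcd : c ≤ d) (hd : d - c ≤ r) :
    stieltjesMeasure m hr hm (Icc c d) ≤ ENNReal.ofReal (h (d - c)) := by
  refine (Measure.restrict_apply_le _ _).trans ?_
  rw [stieltjesFunction_measure_Icc _ (continuous_iccExtend hr hm h_cont h_zero hmod)]
  exact ENNReal.ofReal_le_ofReal (iccExtend_sub_le hr hm hmod hmono hcd hd)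

end Stieltjes

end

end DeltaSubharmonic

namespace DeltaSubharmonic

noncomputable section

/-! ### Logarithmic kernels on the line -/

theorem lintegral_inv_Ioc {c d : ℝ} (hc : 0 < c) (hcd : c ≤ d) :
    ∫⁻ x in Ioc c d, ENNReal.ofReal x⁻¹ = ENNReal.ofReal (Real.log (d / c)) := by
  have hint : IntegrableOn (fun x : ℝ => x⁻¹) (Ioc c d) := by
    rw [← intervalIntegrable_iff_integrableOn_Ioc_of_le hcd]
    exact intervalIntegral.intervalIntegrable_inv (fun x hx => by
      rw [uIcc_of_le hcd] at hx; linarith [hx.1]) continuousOn_id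
  rw [← ofReal_integral_eq_lintegral_ofReal hint, ← intervalIntegral.integral_of_le hcd,
    integral_inv_of_pos hc (hc.trans_le hcd)]
  filter_upwards [ae_restrict_mem measurableSet_Ioc] with x hx
  exact inv_nonneg.2 (hc.trans hx.1).le

theorem lintegral_inv_Ioc_zero {d : ℝ} (hd : 0 < d) :
    ∫⁻ x in Ioc 0 d, ENNReal.ofReal x⁻¹ = ⊤ := by
  refine ENNReal.eq_top_of_forall_nnreal_le fun n => ?_
  have hc : 0 < d * Real.exp (-n) := by positivity
  have hcd : d * Real.exp (-n) ≤ d :=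
    mul_le_of_le_one_right hd.le (Real.exp_le_one_iff.2 (by simp))
  calc (n : ℝ≥0∞) = ENNReal.ofReal (Real.log (d / (d * Real.exp (-n)))) := by
        rw [← div_div, div_self hd.ne', one_div, Real.log_inv, Real.log_exp, neg_neg,
          ENNReal.ofReal_coe_nnreal]
    _ = ∫⁻ x in Ioc (d * Real.exp (-n)) d, ENNReal.ofReal x⁻¹ := (lintegral_inv_Ioc hc hcd).symm
    _ ≤ _ := lintegral_mono_set (Ioc_subset_Ioc_left hc.le)

/-- `ln (R / |t - s|)`, written as an integral. -/
def logKernel (R t s : ℝ) : ℝ≥0∞ := ∫⁻ x in Ioc (2 * |t - s|) (2 * R), ENNReal.ofReal x⁻¹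

/-- `ln ((R² - t s) / (R |t - s|))`, the largest value of the Green function of the disc of
radius `R` for pairs of points with moduli `t` and `s`. -/
def greenKernel (R t s : ℝ) : ℝ≥0∞ :=
  if t = s then ⊤ else ENNReal.ofReal (Real.log ((R ^ 2 - t * s) / (R * |t - s|)))

theorem measurable_greenKernel (R : ℝ) :
    Measurable (fun p : ℝ × ℝ => greenKernel R p.1 p.2) := by
  refine Measurable.ite (measurableSet_eq_fun measurable_fst measurable_snd) measurable_const ?_
  fun_prop

theorem greenKernel_le_logKernel {R t s : ℝ} (hR : 0 < R) (ht : t ∈ Icc 0 R) (hs : s ∈ Icc 0 R) :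
    greenKernel R t s ≤ logKernel R t s := by
  unfold greenKernel logKernel
  split_ifs with h
  · simp [h, lintegral_inv_Ioc_zero (by positivity : 0 < 2 * R)]
  · have h1 : 0 < |t - s| := abs_pos.2 (sub_ne_zero.2 h)
    have h2 : |t - s| ≤ R := abs_le.2 ⟨by linarith [ht.1, hs.2], by linarith [ht.2, hs.1]⟩
    rw [lintegral_inv_Ioc (by linarith) (by linarith)]
    refine ENNReal.ofReal_le_ofReal ?_
    have h3 : t * s < R ^ 2 := by
      rcases lt_or_gt_of_ne h with h' | h'
      · nlinarith [ht.1, ht.2, hs.1, hs.2]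
      · nlinarith [ht.1, ht.2, hs.1, hs.2]
    refine Real.log_le_log (div_pos (by linarith) (by positivity)) ?_
    rw [mul_div_mul_left _ _ two_ne_zero, div_le_div_iff₀ (by positivity) h1]
    nlinarith [mul_nonneg ht.1 hs.1]

theorem lintegral_logKernel_le {ν : Measure ℝ} [SFinite ν] {h : ℝ → ℝ} {S R a M s : ℝ}
    (ha : 0 < a) (haR : a ≤ R) (hM : 0 ≤ M) (hS : 0 ≤ S)
    (hν : ∀ c d, c ≤ d → d - c ≤ a → ν (Icc c d) ≤ ENNReal.ofReal (h (d - c)))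
    (hν' : ν univ ≤ ENNReal.ofReal M)
    (hint : ∫⁻ x in Ioo 0 a, ENNReal.ofReal (h x / x) ≤ ENNReal.ofReal (S * M)) :
    ∫⁻ t, logKernel R t s ∂ν ≤ ENNReal.ofReal (M * Real.log (2 * Real.exp S * R / a)) := by
  have hR : 0 < R := ha.trans_le haR
  have hker : ∀ t, logKernel R t s =
      ∫⁻ x in Ioc 0 (2 * R), {p : ℝ × ℝ | 2 * |p.1 - s| < p.2}.indicator
        (fun p => ENNReal.ofReal p.2⁻¹) (t, x) := by
    intro t
    have h1 : ∀ x, {p : ℝ × ℝ | 2 * |p.1 - s| < p.2}.indicator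
        (fun p => ENNReal.ofReal p.2⁻¹) (t, x) =
        (Ioi (2 * |t - s|)).indicator (fun x => ENNReal.ofReal x⁻¹) x := by
      intro x; simp [indicator]
    simp_rw [h1]
    rw [lintegral_indicator measurableSet_Ioi, Measure.restrict_restrict measurableSet_Ioi,
      inter_comm, Ioc_inter_Ioi, sup_of_le_right (by positivity), logKernel]
  have hmeas : Measurable ({p : ℝ × ℝ | 2 * |p.1 - s| < p.2}.indicator
        (fun p => ENNReal.ofReal p.2⁻¹)) := by
    refine Measurable.indicator (by fun_prop) (measurableSet_lt ?_ measurable_snd)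
    exact (continuous_const.mul (continuous_fst.sub continuous_const).abs).measurable
  simp_rw [hker]
  rw [lintegral_lintegral_swap (f := fun t x => {p : ℝ × ℝ | 2 * |p.1 - s| < p.2}.indicator
        (fun p => ENNReal.ofReal p.2⁻¹) (t, x)) hmeas.aemeasurable]
  have hin : ∀ x, ∫⁻ t, {p : ℝ × ℝ | 2 * |p.1 - s| < p.2}.indicator
      (fun p => ENNReal.ofReal p.2⁻¹) (t, x) ∂ν =
      ENNReal.ofReal x⁻¹ * ν {t | 2 * |t - s| < x} := by
    intro x
    have h1 : ∀ t, {p : ℝ × ℝ | 2 * |p.1 - s| < p.2}.indicator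
        (fun p => ENNReal.ofReal p.2⁻¹) (t, x) =
        {t | 2 * |t - s| < x}.indicator (fun _ => ENNReal.ofReal x⁻¹) t := by
      intro t; simp [indicator]
    simp_rw [h1]
    rw [lintegral_indicator_const]
    exact measurableSet_lt (by fun_prop) measurable_const
  simp_rw [hin]
  rw [← Ioc_union_Ioc_eq_Ioc ha.le (by linarith : a ≤ 2 * R)]
  refine (lintegral_union_le _ _ _).trans ?_
  have hlog : M * Real.log (2 * Real.exp S * R / a) = S * M + M * Real.log (2 * R / a) := by
    rw [show 2 * Real.exp S * R / a = Real.exp S * (2 * R / a) by ring,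
      Real.log_mul (by positivity) (by positivity), Real.log_exp]
    ring
  have hlog0 : 0 ≤ Real.log (2 * R / a) := Real.log_nonneg (by rw [le_div_iff₀ ha]; linarith)
  rw [hlog, ENNReal.ofReal_add (by positivity) (by positivity)]
  gcongr
  · refine le_trans ?_ hint
    rw [setLIntegral_congr Ioo_ae_eq_Ioc]
    refine setLIntegral_mono' measurableSet_Ioc fun x hx => ?_
    have hle : ν {t | 2 * |t - s| < x} ≤ ENNReal.ofReal (h x) := by
      refine (measure_mono ?_).trans
        ((hν (s - x / 2) (s + x / 2) (by linarith [hx.1]) (by linarith [hx.2])).trans_eq ?_)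
      · intro t ht
        have := abs_lt.1 (show |t - s| < x / 2 by linarith [show 2 * |t - s| < x from ht])
        exact ⟨by linarith, by linarith⟩
      · congr 2; ring
    calc _ ≤ ENNReal.ofReal x⁻¹ * ENNReal.ofReal (h x) := by gcongr
      _ = _ := by
        rw [← ENNReal.ofReal_mul (inv_nonneg.2 hx.1.le)]
        congr 1; ring
  · calc _ ≤ ∫⁻ x in Ioc a (2 * R), ENNReal.ofReal x⁻¹ * ENNReal.ofReal M := by
          refine lintegral_mono fun x => ?_
          gcongr
          exact (measure_mono (subset_univ _)).trans hν'
      _ = _ := by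
        rw [lintegral_mul_const _ (by fun_prop), lintegral_inv_Ioc ha (by linarith),
          ← ENNReal.ofReal_mul hlog0, mul_comm]

theorem greenKernel_le_of_le {R r t s : ℝ} (hrR : r < R) (ht : t ∈ Icc 0 r)
    (hs : (R + r) / 2 ≤ s) (hsR : s ≤ R) :
    greenKernel R t s ≤ ENNReal.ofReal (4 * (R - s) / (R - r)) := by
  have h1 := ht.1
  have h2 := ht.2
  have hts : t < s := by linarith
  have hR : 0 < R := by linarith
  rw [greenKernel, if_neg hts.ne]
  refine ENNReal.ofReal_le_ofReal ?_
  rw [abs_of_neg (by linarith), neg_sub]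
  have h3 : 0 < s - t := by linarith
  have h4 : 0 < R - r := by linarith
  have h6 : 0 < R ^ 2 - t * s := by nlinarith
  refine (Real.log_le_sub_one_of_pos (div_pos h6 (by positivity))).trans ?_
  have h5 : (R ^ 2 - t * s) / (R * (s - t)) - 1 = (R - s) * (R + t) / (R * (s - t)) := by
    field_simp
    ring
  rw [h5, div_le_div_iff₀ (by positivity) h4]
  have h7 : (R + t) * (R - r) ≤ 4 * (R * (s - t)) := by nlinarith
  nlinarith [mul_le_mul_of_nonneg_left h7 (sub_nonneg.2 hsR)]

/-- The integral of the Green kernel against a measure on `[0, r]` of total mass at most `M`. -/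
theorem lintegral_greenKernel_le {ν : Measure ℝ} [SFinite ν] {h : ℝ → ℝ} {S R r a M s : ℝ}
    (ha : 0 < a) (har : a ≤ r) (hrR : r < R) (hM : 0 ≤ M) (hS : 0 ≤ S)
    (hν : ∀ c d, c ≤ d → d - c ≤ a → ν (Icc c d) ≤ ENNReal.ofReal (h (d - c)))
    (hν' : ν univ ≤ ENNReal.ofReal M) (hsupp : ∀ᵐ t ∂ν, t ∈ Icc 0 r)
    (hint : ∫⁻ x in Ioo 0 a, ENNReal.ofReal (h x / x) ≤ ENNReal.ofReal (S * M))
    (hs : s ∈ Icc 0 R) :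
    ∫⁻ t, greenKernel R t s ∂ν ≤ ENNReal.ofReal (6 * R / (R - r)) *
      ENNReal.ofReal (M * Real.log (4 * Real.exp S * R / a)) *
      ENNReal.ofReal (Real.log (R / max s r)) := by
  have hr : 0 < r := ha.trans_le har
  have hR : 0 < R := hr.trans hrR
  have hRr : 0 < R - r := by linarith
  have hmax : 0 < max s r := lt_max_of_lt_right hr
  have hlog1 : ∀ x, 0 < x → (R - x) / R ≤ Real.log (R / x) := by
    intro x hx
    have := Real.one_sub_inv_le_log_of_pos (div_pos hR hx)
    rwa [inv_div, one_sub_div hR.ne'] at this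
  have hbig : 4 ≤ 4 * Real.exp S * R / a := by
    rw [le_div_iff₀ ha]
    nlinarith [Real.one_le_exp hS]
  have hL : 1 ≤ Real.log (4 * Real.exp S * R / a) := by
    rw [Real.le_log_iff_exp_le (by positivity)]
    linarith [Real.exp_one_lt_d9]
  rw [← ENNReal.ofReal_mul (by positivity), ← ENNReal.ofReal_mul (by positivity)]
  rcases le_total s ((R + r) / 2) with hle | hle
  · calc ∫⁻ t, greenKernel R t s ∂ν ≤ ∫⁻ t, logKernel R t s ∂ν := by
          refine lintegral_mono_ae ?_
          filter_upwards [hsupp] with t ht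
          exact greenKernel_le_logKernel hR ⟨ht.1, ht.2.trans hrR.le⟩ hs
      _ ≤ ENNReal.ofReal (M * Real.log (2 * Real.exp S * R / a)) :=
          lintegral_logKernel_le ha (har.trans hrR.le) hM hS hν hν' hint
      _ ≤ _ := by
          refine ENNReal.ofReal_le_ofReal ?_
          have h1 : Real.log (2 * Real.exp S * R / a) ≤ Real.log (4 * Real.exp S * R / a) := by
            refine Real.log_le_log (by positivity) ?_
            gcongr
            norm_num
          have h2 : (R - r) / (2 * R) ≤ Real.log (R / max s r) := by
            refine le_trans ?_ (hlog1 _ hmax)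
            rw [div_le_div_iff₀ (by positivity) hR]
            have : max s r ≤ (R + r) / 2 := max_le hle (by linarith)
            nlinarith
          have h3 : 1 ≤ 6 * R / (R - r) * Real.log (R / max s r) := by
            calc (1 : ℝ) ≤ 3 := by norm_num
              _ = 6 * R / (R - r) * ((R - r) / (2 * R)) := by field_simp; norm_num
              _ ≤ _ := by gcongr
          calc M * Real.log (2 * Real.exp S * R / a) ≤ M * Real.log (4 * Real.exp S * R / a) := by
                gcongr
            _ ≤ (M * Real.log (4 * Real.exp S * R / a)) *
                (6 * R / (R - r) * Real.log (R / max s r)) :=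
                le_mul_of_one_le_right (by positivity) h3
            _ = _ := by ring
  · have hrs : r ≤ s := by linarith
    calc ∫⁻ t, greenKernel R t s ∂ν ≤ ∫⁻ t, ENNReal.ofReal (4 * (R - s) / (R - r)) ∂ν := by
          refine lintegral_mono_ae ?_
          filter_upwards [hsupp] with t ht
          exact greenKernel_le_of_le hrR ht hle hs.2
      _ ≤ ENNReal.ofReal (4 * (R - s) / (R - r)) * ENNReal.ofReal M := by
          rw [lintegral_const]; gcongr
      _ ≤ _ := by
          have h0 : 0 ≤ R - s := sub_nonneg.2 hs.2
          rw [← ENNReal.ofReal_mul (by positivity), max_eq_left hrs]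
          refine ENNReal.ofReal_le_ofReal ?_
          have h1 := hlog1 s (hr.trans_le hrs)
          calc 4 * (R - s) / (R - r) * M ≤ 6 * (R - s) / (R - r) * M := by gcongr; norm_num
            _ = 6 * R / (R - r) * (M * 1) * ((R - s) / R) := by field_simp
            _ ≤ _ := by gcongr

/-- `∫ ln (R / max(|w|, r)) dμ(w) ≤ N_μ(r, R)`, the integral being over the disc of radius `R`. -/
theorem lintegral_log_le_countingN {μ : Measure ℂ} {r R : ℝ} (hr : 0 < r) (hrR : r < R)
    (hμ : μ (Metric.closedBall 0 R) < ⊤) :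
    ∫⁻ w in Metric.closedBall 0 R, ENNReal.ofReal (Real.log (R / max ‖w‖ r)) ∂μ ≤
      countingN μ r R := by
  set ν := μ.restrict (Metric.closedBall 0 R) with hν
  have : IsFiniteMeasure ν := ⟨by simpa [hν] using hμ⟩
  have hker : ∀ w ∈ Metric.closedBall (0 : ℂ) R, ENNReal.ofReal (Real.log (R / max ‖w‖ r)) =
      ∫⁻ t in Ioc r R, {p : ℂ × ℝ | ‖p.1‖ ≤ p.2}.indicator
        (fun p => ENNReal.ofReal p.2⁻¹) (w, t) := by
    intro w hw
    have hw' : ‖w‖ ≤ R := by simpa using hw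
    have h1 : ∀ t, {p : ℂ × ℝ | ‖p.1‖ ≤ p.2}.indicator
        (fun p => ENNReal.ofReal p.2⁻¹) (w, t) =
        (Ici ‖w‖).indicator (fun t => ENNReal.ofReal t⁻¹) t := by
      intro x; simp [indicator]
    simp_rw [h1]
    rw [setLIntegral_indicator measurableSet_Ici,
      ← lintegral_inv_Ioc (lt_max_of_lt_right hr) (max_le hw' hrR.le)]
    refine setLIntegral_congr ?_
    have h2 : (Ici ‖w‖ ∩ Ioc r R : Set ℝ) =ᵐ[volume] (Ioi ‖w‖ ∩ Ioc r R : Set ℝ) :=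
      Ioi_ae_eq_Ici.symm.inter (ae_eq_refl _)
    rw [inter_comm (Ioi _), Ioc_inter_Ioi, sup_comm] at h2
    exact h2.symm
  have hmeas : Measurable ({p : ℂ × ℝ | ‖p.1‖ ≤ p.2}.indicator
        (fun p => ENNReal.ofReal p.2⁻¹)) :=
    Measurable.indicator (by fun_prop) (measurableSet_le (by fun_prop) measurable_snd)
  rw [setLIntegral_congr_fun Metric.isClosed_closedBall.measurableSet hker,
    lintegral_lintegral_swap (f := fun w t => {p : ℂ × ℝ | ‖p.1‖ ≤ p.2}.indicator
        (fun p => ENNReal.ofReal p.2⁻¹) (w, t)) hmeas.aemeasurable, countingN]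
  refine setLIntegral_mono' measurableSet_Ioc fun t ht => ?_
  have h1 : ∀ w, {p : ℂ × ℝ | ‖p.1‖ ≤ p.2}.indicator
        (fun p => ENNReal.ofReal p.2⁻¹) (w, t) =
        (Metric.closedBall 0 t).indicator (fun _ => ENNReal.ofReal t⁻¹) w := by
    intro w; simp [indicator]
  simp_rw [h1]
  rw [lintegral_indicator_const Metric.isClosed_closedBall.measurableSet,
    ENNReal.ofReal_inv_of_pos (hr.trans ht.1), div_eq_mul_inv, mul_comm]
  gcongr
  exact Measure.restrict_le_self

end

end DeltaSubharmonic

namespace DeltaSubharmonic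

noncomputable section

/-! ### A smooth regularization of the logarithmic kernel -/

/-- A smooth monotone step which is `0` on `(-∞, 1/2]` and `1` on `[1, ∞)`. -/
def smoothStep (s : ℝ) : ℝ := Real.smoothTransition (2 * s - 1)

theorem contDiff_smoothStep : ContDiff ℝ ∞ smoothStep :=
  Real.smoothTransition.contDiff.comp (by fun_prop)

theorem smoothStep_of_le {s : ℝ} (hs : s ≤ 1 / 2) : smoothStep s = 0 :=
  Real.smoothTransition.zero_of_nonpos (by linarith)

theorem smoothStep_of_ge {s : ℝ} (hs : 1 ≤ s) : smoothStep s = 1 :=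
  Real.smoothTransition.one_of_one_le (by linarith)

theorem monotone_smoothStep : Monotone smoothStep := fun _ _ h =>
  Real.smoothTransition.monotone (by linarith)

theorem deriv_smoothStep_nonneg (s : ℝ) : 0 ≤ deriv smoothStep s :=
  monotone_smoothStep.deriv_nonneg

theorem deriv_smoothStep_of_gt {s : ℝ} (hs : 1 < s) : deriv smoothStep s = 0 := by
  have : smoothStep =ᶠ[nhds s] fun _ => 1 := by
    filter_upwards [lt_mem_nhds hs] with x hx using smoothStep_of_ge hx.le
  rw [this.deriv_eq, deriv_const]

theorem hasDerivAt_smoothStep (s : ℝ) : HasDerivAt smoothStep (deriv smoothStep s) s :=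
  (contDiff_smoothStep.differentiable (by simp) s).hasDerivAt

theorem continuous_deriv_smoothStep : Continuous (deriv smoothStep) :=
  contDiff_smoothStep.continuous_deriv (by simp)

theorem contDiff_smoothStep_mul_inv : ContDiff ℝ ∞ fun s : ℝ => smoothStep s * s⁻¹ := by
  rw [contDiff_iff_contDiffAt]
  intro s
  rcases eq_or_ne s 0 with rfl | hs
  · refine (contDiffAt_const (c := (0 : ℝ))).congr_of_eventuallyEq ?_
    filter_upwards [gt_mem_nhds (show (0 : ℝ) < 1 / 2 by norm_num)] with x hx
    rw [smoothStep_of_le hx.le, zero_mul]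
  · exact contDiff_smoothStep.contDiffAt.mul (contDiffAt_id.inv hs)

/-- A smooth function on the line which coincides with `Real.log` on `[1, ∞)` and is constant
on `(-∞, 1/2]`. -/
def logProfile (s : ℝ) : ℝ := ∫ τ in (1 : ℝ)..s, smoothStep τ * τ⁻¹

theorem hasDerivAt_logProfile (s : ℝ) : HasDerivAt logProfile (smoothStep s * s⁻¹) s :=
  (contDiff_smoothStep_mul_inv.continuous).integral_hasStrictDerivAt 1 s |>.hasDerivAt

theorem contDiff_logProfile : ContDiff ℝ ∞ logProfile := by
  rw [contDiff_infty_iff_deriv]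
  refine ⟨fun s => (hasDerivAt_logProfile s).differentiableAt, ?_⟩
  rw [show deriv logProfile = fun s : ℝ => smoothStep s * s⁻¹ from
    funext fun s => (hasDerivAt_logProfile s).deriv]
  exact contDiff_smoothStep_mul_inv

theorem logProfile_of_ge {s : ℝ} (hs : 1 ≤ s) : logProfile s = Real.log s := by
  rw [logProfile, intervalIntegral.integral_congr (g := fun τ : ℝ => τ⁻¹),
    integral_inv_of_pos one_pos (by linarith), div_one]
  intro τ hτ
  rw [uIcc_of_le hs] at hτ
  simp [smoothStep_of_ge hτ.1]

theorem logProfile_nonpos {s : ℝ} (hs : s ≤ 1) : logProfile s ≤ 0 := by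
  rw [logProfile, intervalIntegral.integral_symm]
  refine neg_nonpos.2 (intervalIntegral.integral_nonneg hs fun τ _ => ?_)
  rcases le_total τ (1 / 2) with h | h
  · simp [smoothStep_of_le h]
  · exact mul_nonneg (Real.smoothTransition.nonneg _) (inv_nonneg.2 (by linarith))

theorem log_le_logProfile {s : ℝ} (hs : 0 < s) : Real.log s ≤ logProfile s := by
  rcases le_total 1 s with h | h
  · exact (logProfile_of_ge h).ge
  · rw [logProfile, intervalIntegral.integral_symm, ← neg_neg (Real.log s), ← Real.log_inv,
      ← one_div, ← integral_inv_of_pos hs one_pos]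
    refine neg_le_neg (intervalIntegral.integral_mono_on h
      (contDiff_smoothStep_mul_inv.continuous.intervalIntegrable _ _) ?_ fun τ hτ => ?_)
    · exact intervalIntegral.intervalIntegrable_inv (fun x hx => by
        rw [uIcc_of_le h] at hx; linarith [hx.1]) continuousOn_id
    · exact mul_le_of_le_one_left (inv_nonneg.2 (hs.le.trans hτ.1))
        (Real.smoothTransition.le_one _)

/-- A smooth radial function which coincides with `log ‖w‖` for `‖w‖ ≥ ε`. -/
def logMoll (ε : ℝ) (w : ℂ) : ℝ := Real.log ε + logProfile (‖w‖ ^ 2 / ε ^ 2) / 2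

/-- The radial profile of the Laplacian of `logMoll ε`. -/
def molKernel (ε ρ : ℝ) : ℝ := 2 / ε ^ 2 * deriv smoothStep (ρ ^ 2 / ε ^ 2)

theorem contDiff_logMoll (ε : ℝ) : ContDiff ℝ ∞ (logMoll ε) := by
  unfold logMoll
  have h1 : ContDiff ℝ ∞ fun w : ℂ => ‖w‖ ^ 2 / ε ^ 2 := (contDiff_norm_sq ℝ).div_const _
  exact contDiff_const.add ((contDiff_logProfile.comp h1).div_const _)

theorem logMoll_of_le {ε : ℝ} {w : ℂ} (hε : 0 < ε) (hw : ε ≤ ‖w‖) :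
    logMoll ε w = Real.log ‖w‖ := by
  have hw0 : 0 < ‖w‖ := hε.trans_le hw
  have h1 : 1 ≤ ‖w‖ ^ 2 / ε ^ 2 := by
    rw [le_div_iff₀ (by positivity), one_mul]
    gcongr
  rw [logMoll, logProfile_of_ge h1, Real.log_div (by positivity) (by positivity), Real.log_pow,
    Real.log_pow]
  push_cast
  ring

theorem log_norm_le_logMoll {ε : ℝ} {w : ℂ} (hε : 0 < ε) (hw : w ≠ 0) :
    Real.log ‖w‖ ≤ logMoll ε w := by
  have hw0 : 0 < ‖w‖ := norm_pos_iff.2 hw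
  have h1 := log_le_logProfile (s := ‖w‖ ^ 2 / ε ^ 2) (by positivity)
  rw [Real.log_div (by positivity) (by positivity), Real.log_pow, Real.log_pow] at h1
  push_cast at h1
  rw [logMoll]
  linarith

theorem logMoll_le_log {ε : ℝ} {w : ℂ} (hε : 0 < ε) (hw : ‖w‖ ≤ ε) :
    logMoll ε w ≤ Real.log ε := by
  have h1 : ‖w‖ ^ 2 / ε ^ 2 ≤ 1 := by
    rw [div_le_iff₀ (by positivity), one_mul]
    gcongr
  have := logProfile_nonpos h1
  rw [logMoll]
  linarith

theorem logMoll_le {ε B : ℝ} {w : ℂ} (hε : 0 < ε) (hB : ε ≤ B) (hw : ‖w‖ ≤ B) :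
    logMoll ε w ≤ Real.log B := by
  rcases le_total ‖w‖ ε with h | h
  · exact (logMoll_le_log hε h).trans (Real.log_le_log hε hB)
  · rw [logMoll_of_le hε h]
    exact Real.log_le_log (hε.trans_le h) hw

theorem molKernel_nonneg (ε ρ : ℝ) : 0 ≤ molKernel ε ρ :=
  mul_nonneg (by positivity) (deriv_smoothStep_nonneg _)

theorem molKernel_of_gt {ε ρ : ℝ} (hε : 0 < ε) (hρ : ε < ρ) : molKernel ε ρ = 0 := by
  rw [molKernel, deriv_smoothStep_of_gt, mul_zero]
  rw [lt_div_iff₀ (by positivity), one_mul]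
  gcongr

theorem continuous_molKernel (ε : ℝ) : Continuous (molKernel ε) := by
  unfold molKernel
  have := continuous_deriv_smoothStep
  fun_prop

theorem lintegral_molKernel_mul {ε : ℝ} (hε : 0 < ε) :
    ∫⁻ ρ in Ioi (0 : ℝ), ENNReal.ofReal ρ * ENNReal.ofReal (molKernel ε ρ) = 1 := by
  have hd : ∀ x ∈ Set.uIcc 0 ε, HasDerivAt (fun ρ => smoothStep (ρ ^ 2 / ε ^ 2))
      (x * molKernel ε x) x := by
    intro x _
    have h1 : HasDerivAt (fun ρ : ℝ => ρ ^ 2 / ε ^ 2) (2 * x / ε ^ 2) x := by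
      simpa using (hasDerivAt_pow 2 x).div_const (ε ^ 2)
    have h2 := (hasDerivAt_smoothStep (x ^ 2 / ε ^ 2)).comp x h1
    refine h2.congr_deriv ?_
    unfold molKernel
    ring
  have hcont : Continuous fun x => x * molKernel ε x := continuous_id.mul (continuous_molKernel ε)
  have h3 := intervalIntegral.integral_eq_sub_of_hasDerivAt hd (hcont.intervalIntegrable _ _)
  rw [div_self (by positivity), smoothStep_of_ge le_rfl, smoothStep_of_le (by norm_num),
    intervalIntegral.integral_of_le hε.le, sub_zero] at h3
  have h4 : ∫⁻ ρ in Ioi (0 : ℝ), ENNReal.ofReal ρ * ENNReal.ofReal (molKernel ε ρ) =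
      ∫⁻ ρ in Ioc 0 ε, ENNReal.ofReal (ρ * molKernel ε ρ) := by
    rw [← Ioc_union_Ioi_eq_Ioi hε.le,
      lintegral_union measurableSet_Ioi (Ioc_disjoint_Ioi le_rfl)]
    have h5 : ∫⁻ ρ in Ioi ε, ENNReal.ofReal ρ * ENNReal.ofReal (molKernel ε ρ) = 0 := by
      rw [setLIntegral_congr_fun measurableSet_Ioi (g := fun _ => 0), lintegral_zero]
      intro ρ hρ
      simp [molKernel_of_gt hε hρ]
    rw [h5, add_zero]
    refine setLIntegral_congr_fun measurableSet_Ioc fun ρ hρ => ?_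
    exact (ENNReal.ofReal_mul hρ.1.le).symm
  rw [h4, ← ofReal_integral_eq_lintegral_ofReal, h3, ENNReal.ofReal_one]
  · exact (hcont.integrableOn_Icc (a := 0) (b := ε)).mono_set Ioc_subset_Icc_self
  · filter_upwards [ae_restrict_mem measurableSet_Ioc] with ρ hρ
    exact mul_nonneg hρ.1.le (molKernel_nonneg _ _)

theorem laplacian_radial {F F' F'' : ℝ → ℝ} (h1 : ∀ s, HasDerivAt F (F' s) s)
    (h2 : ∀ s, HasDerivAt F' (F'' s) s) (w : ℂ) :
    Laplacian.laplacian (fun w : ℂ => F (‖w‖ ^ 2)) w =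
      4 * F' (‖w‖ ^ 2) + 4 * ‖w‖ ^ 2 * F'' (‖w‖ ^ 2) := by
  have hn : ∀ w : ℂ, HasFDerivAt (fun w : ℂ => ‖w‖ ^ 2) (2 • (innerSL ℝ w)) w := fun w =>
    (hasStrictFDerivAt_norm_sq w).hasFDerivAt
  have hf : fderiv ℝ (fun w : ℂ => F (‖w‖ ^ 2)) = fun w => F' (‖w‖ ^ 2) • (2 • (innerSL ℝ w)) :=
    funext fun w => ((h1 _).comp_hasFDerivAt w (hn w)).fderiv
  have hf2 : ∀ v : ℂ, fderiv ℝ (fderiv ℝ (fun w : ℂ => F (‖w‖ ^ 2))) w v v =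
      F' (‖w‖ ^ 2) * (2 * inner ℝ v v) + F'' (‖w‖ ^ 2) * (2 * inner ℝ w v) * (2 * inner ℝ w v) := by
    intro v
    have h3 : HasFDerivAt (fun w : ℂ => F' (‖w‖ ^ 2)) (F'' (‖w‖ ^ 2) • (2 • (innerSL ℝ w))) w :=
      (h2 _).comp_hasFDerivAt w (hn w)
    have h4 : HasFDerivAt (fun w : ℂ => 2 • innerSL ℝ w) (2 • (innerSL ℝ : ℂ →L[ℝ] ℂ →L[ℝ] ℝ)) w :=
      ((innerSL ℝ : ℂ →L[ℝ] ℂ →L[ℝ] ℝ).hasFDerivAt).const_smul (2 : ℕ)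
    rw [hf, (h3.fun_smul h4).fderiv]
    have h5 : (innerSL ℝ : ℂ →L[ℝ] ℂ →L[ℝ] ℝ) v v = inner ℝ v v := innerSL_apply_apply ℝ v v
    simp [h5]
    ring
  rw [InnerProductSpace.laplacian_eq_iteratedFDeriv_complexPlane]
  simp only [iteratedFDeriv_two_apply, Matrix.cons_val_zero, Matrix.cons_val_one, hf2]
  rw [← Complex.normSq_eq_norm_sq, Complex.normSq_apply]
  simp only [Complex.inner]
  simp
  ring

theorem laplacian_logMoll {ε : ℝ} (hε : 0 < ε) (w : ℂ) :
    Laplacian.laplacian (logMoll ε) w = molKernel ε ‖w‖ := by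
  have hlin : ∀ s : ℝ, HasDerivAt (fun s : ℝ => s / ε ^ 2) (1 / ε ^ 2) s := fun s =>
    (hasDerivAt_id s).div_const _
  have hdp : ∀ s, HasDerivAt (fun s : ℝ => smoothStep s * s⁻¹)
      (deriv (fun s : ℝ => smoothStep s * s⁻¹) s) s := fun s =>
    (contDiff_smoothStep_mul_inv.differentiable (by simp) s).hasDerivAt
  have h1 : ∀ s, HasDerivAt (fun s => Real.log ε + logProfile (s / ε ^ 2) / 2)
      ((smoothStep (s / ε ^ 2) * (s / ε ^ 2)⁻¹) * (1 / ε ^ 2) / 2) s := fun s =>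
    (((hasDerivAt_logProfile _).comp s (hlin s)).div_const 2).const_add _
  have h2 : ∀ s, HasDerivAt
      (fun s => (smoothStep (s / ε ^ 2) * (s / ε ^ 2)⁻¹) * (1 / ε ^ 2) / 2)
      (deriv (fun s : ℝ => smoothStep s * s⁻¹) (s / ε ^ 2) * (1 / ε ^ 2) * (1 / ε ^ 2) / 2) s :=
    fun s => (((hdp _).comp s (hlin s)).mul_const _).div_const 2
  have h3 := laplacian_radial h1 h2 w
  have h4 : (fun w : ℂ => Real.log ε + logProfile (‖w‖ ^ 2 / ε ^ 2) / 2) = logMoll ε := rfl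
  rw [h4] at h3
  rw [h3, molKernel]
  set s := ‖w‖ ^ 2 / ε ^ 2 with hs
  have hw : ‖w‖ ^ 2 = s * ε ^ 2 := by rw [hs]; field_simp
  rw [hw]
  rcases eq_or_ne s 0 with h0 | h0
  · have h5 : deriv smoothStep 0 = 0 := by
      have : smoothStep =ᶠ[nhds 0] fun _ => 0 := by
        filter_upwards [gt_mem_nhds (show (0 : ℝ) < 1 / 2 by norm_num)] with x hx
        exact smoothStep_of_le hx.le
      rw [this.deriv_eq, deriv_const]
    rw [h0, h5]
    simp
  · have h5 : deriv (fun s : ℝ => smoothStep s * s⁻¹) s =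
        deriv smoothStep s * s⁻¹ + smoothStep s * (-(s ^ 2)⁻¹) :=
      ((hasDerivAt_smoothStep s).mul (hasDerivAt_inv h0)).deriv
    rw [h5]
    field_simp
    ring

end

end DeltaSubharmonic

namespace DeltaSubharmonic

noncomputable section

/-! ### Superharmonic functions with values in `[0, ∞]` -/

/-- `∫₀^{2π} f(z + ρ e^{iθ}) dθ`. -/
def circleLIntegral (f : ℂ → ℝ≥0∞) (z : ℂ) (ρ : ℝ) : ℝ≥0∞ :=
  ∫⁻ θ in Ioc 0 (2 * Real.pi), f (circleMap z ρ θ)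

theorem continuous_uncurry_circleMap (z : ℂ) :
    Continuous fun p : ℝ × ℝ => circleMap z p.1 p.2 := by
  unfold circleMap
  fun_prop

theorem lintegral_Ioc_eq_of_periodic {g : ℝ → ℝ≥0∞} {T : ℝ} (hT : 0 < T)
    (hg : Function.Periodic g T) (s t : ℝ) :
    ∫⁻ x in Ioc s (s + T), g x = ∫⁻ x in Ioc t (t + T), g x := by
  have : VAddInvariantMeasure (AddSubgroup.zmultiples T) ℝ volume :=
    ⟨fun c s _ => measure_preimage_add _ _ _⟩
  exact (isAddFundamentalDomain_Ioc hT s).setLIntegral_eq (G := AddSubgroup.zmultiples T)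
    (isAddFundamentalDomain_Ioc hT t) _ hg.map_vadd_zmultiples

theorem lintegral_mul_radial {f : ℂ → ℝ≥0∞} (hf : Measurable f) {k : ℝ → ℝ≥0∞}
    (hk : Measurable k) (z : ℂ) :
    ∫⁻ w, f w * k ‖w - z‖ = ∫⁻ ρ in Ioi (0 : ℝ), ENNReal.ofReal ρ * k ρ * circleLIntegral f z ρ := by
  rw [← lintegral_add_right_eq_self (μ := (volume : Measure ℂ)) (fun w => f w * k ‖w - z‖) z,
    ← Complex.lintegral_comp_polarCoord_symm]
  have hmc : Measurable fun p : ℝ × ℝ => circleMap z p.1 p.2 :=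
    (continuous_uncurry_circleMap z).measurable
  have h1 : ∀ p ∈ Ioi (0 : ℝ) ×ˢ Ioo (-Real.pi) Real.pi, ENNReal.ofReal p.1 •
      (f (Complex.polarCoord.symm p + z) * k ‖Complex.polarCoord.symm p + z - z‖) =
      ENNReal.ofReal p.1 * k p.1 * f (circleMap z p.1 p.2) := by
    intro p hp
    have h2 : Complex.polarCoord.symm p + z = circleMap z p.1 p.2 := by
      rw [circleMap, Complex.exp_mul_I, add_comm]
      simp
    rw [add_sub_cancel_right, Complex.norm_polarCoord_symm, abs_of_pos hp.1, h2, smul_eq_mul,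
      mul_comm (f _), mul_assoc]
  have h0 : polarCoord.target = Ioi (0 : ℝ) ×ˢ Ioo (-Real.pi) Real.pi := rfl
  rw [h0, setLIntegral_congr_fun (measurableSet_Ioi.prod measurableSet_Ioo) h1,
    Measure.volume_eq_prod, ← Measure.prod_restrict, lintegral_prod _ (by fun_prop)]
  refine lintegral_congr fun ρ => ?_
  dsimp only
  have hm : Measurable fun θ => f (circleMap z ρ θ) :=
    hf.comp (continuous_circleMap z ρ).measurable
  rw [lintegral_const_mul _ hm, setLIntegral_congr Ioo_ae_eq_Ioc]
  congr 1
  have h3 : Function.Periodic (fun θ => f (circleMap z ρ θ)) (2 * Real.pi) := fun θ => by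
    simp only [periodic_circleMap z ρ θ]
  have h4 := lintegral_Ioc_eq_of_periodic Real.two_pi_pos h3 (-Real.pi) 0
  rw [show -Real.pi + 2 * Real.pi = Real.pi by ring, zero_add] at h4
  exact h4

/-- Lower semicontinuous functions whose circular means over circles bounding discs in `D` do not
exceed the value at the centre. -/
structure IsSuperMean (f : ℂ → ℝ≥0∞) (D : Set ℂ) : Prop where
  lsc : LowerSemicontinuous f
  supermean : ∀ z : ℂ, ∀ ρ : ℝ, 0 < ρ → Metric.closedBall z ρ ⊆ D →
    circleLIntegral f z ρ ≤ ENNReal.ofReal (2 * Real.pi) * f z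

theorem IsSuperMean.measurable {f : ℂ → ℝ≥0∞} {D : Set ℂ} (hf : IsSuperMean f D) : Measurable f :=
  hf.lsc.measurable

theorem IsSuperMean.lintegral_mul_le {f : ℂ → ℝ≥0∞} {D : Set ℂ} (hf : IsSuperMean f D)
    {k : ℝ → ℝ≥0∞} (hk : Measurable k) {ε : ℝ} (hkε : ∀ ρ, ε < ρ → k ρ = 0) {z : ℂ}
    (hz : Metric.closedBall z ε ⊆ D) :
    ∫⁻ w, f w * k ‖w - z‖ ≤
      f z * (ENNReal.ofReal (2 * Real.pi) * ∫⁻ ρ in Ioi (0 : ℝ), ENNReal.ofReal ρ * k ρ) := by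
  rw [lintegral_mul_radial hf.measurable hk]
  calc _ ≤ ∫⁻ ρ in Ioi (0 : ℝ), ENNReal.ofReal ρ * k ρ * (ENNReal.ofReal (2 * Real.pi) * f z) := by
        refine setLIntegral_mono' measurableSet_Ioi fun ρ hρ => ?_
        rcases le_or_gt ρ ε with h | h
        · gcongr
          exact hf.supermean z ρ hρ ((Metric.closedBall_subset_closedBall h).trans hz)
        · simp [hkε ρ h]
    _ = _ := by
        rw [lintegral_mul_const _ (by fun_prop)]
        ring

/-- The area mean of `f` with the weight `molKernel ε`. -/
def moll (f : ℂ → ℝ≥0∞) (ε : ℝ) (z : ℂ) : ℝ≥0∞ :=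
  (∫⁻ w, f w * ENNReal.ofReal (molKernel ε ‖w - z‖)) / ENNReal.ofReal (2 * Real.pi)

theorem ofReal_two_pi_ne_zero : ENNReal.ofReal (2 * Real.pi) ≠ 0 := by
  simpa using Real.pi_pos

theorem measurable_ofReal_molKernel (ε : ℝ) :
    Measurable fun ρ => ENNReal.ofReal (molKernel ε ρ) :=
  (continuous_molKernel ε).measurable.ennreal_ofReal

theorem IsSuperMean.moll_le {f : ℂ → ℝ≥0∞} {D : Set ℂ} (hf : IsSuperMean f D) {ε : ℝ} (hε : 0 < ε)
    {z : ℂ} (hz : Metric.closedBall z ε ⊆ D) : moll f ε z ≤ f z := by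
  have h := hf.lintegral_mul_le (measurable_ofReal_molKernel ε)
    (fun ρ hρ => by rw [molKernel_of_gt hε hρ, ENNReal.ofReal_zero]) hz
  rw [lintegral_molKernel_mul hε, mul_one] at h
  exact ENNReal.div_le_of_le_mul h

theorem lintegral_molKernel {ε : ℝ} (hε : 0 < ε) (z : ℂ) :
    ∫⁻ w, ENNReal.ofReal (molKernel ε ‖w - z‖) = ENNReal.ofReal (2 * Real.pi) := by
  have h := lintegral_mul_radial (f := fun _ => 1) measurable_const (measurable_ofReal_molKernel ε) z
  simp only [one_mul, circleLIntegral, lintegral_const, Measure.restrict_apply_univ,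
    Real.volume_Ioc, sub_zero] at h
  rw [h, lintegral_mul_const, lintegral_molKernel_mul hε, one_mul]
  exact ENNReal.measurable_ofReal.mul (measurable_ofReal_molKernel ε)

theorem IsSuperMean.le_liminf_moll {f : ℂ → ℝ≥0∞} {D : Set ℂ} (hf : IsSuperMean f D)
    {ε : ℕ → ℝ} (hε : ∀ n, 0 < ε n) (hε0 : Filter.Tendsto ε Filter.atTop (nhds 0)) (z : ℂ) :
    f z ≤ Filter.liminf (fun n => moll f (ε n) z) Filter.atTop := by
  refine le_of_forall_lt fun y hy => ?_
  obtain ⟨y', hy', hy''⟩ := exists_between hy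
  refine hy'.trans_le (Filter.le_liminf_of_le (by isBoundedDefault) ?_)
  obtain ⟨δ, hδ, hball⟩ := Metric.eventually_nhds_iff_ball.1 (hf.lsc z y' hy'')
  filter_upwards [hε0.eventually (gt_mem_nhds hδ)] with n hn
  rw [moll, ENNReal.le_div_iff_mul_le (Or.inl ofReal_two_pi_ne_zero) (Or.inl ENNReal.ofReal_ne_top),
    ← lintegral_molKernel (hε n) z, ← lintegral_const_mul']
  · refine lintegral_mono fun w => ?_
    rcases lt_or_ge (ε n) ‖w - z‖ with h | h
    · simp [molKernel_of_gt (hε n) h]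
    · gcongr
      exact (hball w (by simpa [dist_eq_norm] using h.trans_lt hn)).le
  · exact hy''.ne_top

/-- `C - u` on `D`, extended by `0`. -/
def deficit (u : ℂ → EReal) (D : Set ℂ) (C : ℝ) : ℂ → ℝ≥0∞ :=
  D.indicator fun z => ((C : EReal) - u z).toENNReal

theorem lt_toENNReal_sub_iff {C : ℝ} {x : EReal} {y : ℝ≥0∞} (hy : y ≠ ⊤) :
    y < ((C : EReal) - x).toENNReal ↔ x < ((C - y.toReal : ℝ) : EReal) := by
  lift y to NNReal using hy
  induction x with
  | bot => exact ⟨fun _ => EReal.bot_lt_coe _, fun _ => by simp⟩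
  | top => simp
  | coe x =>
    rw [← EReal.coe_sub, EReal.toENNReal_of_ne_top (EReal.coe_ne_top _), EReal.toReal_coe,
      EReal.coe_lt_coe_iff, ENNReal.coe_toReal, ← ENNReal.ofReal_coe_nnreal,
      ENNReal.ofReal_lt_ofReal_iff_of_nonneg y.coe_nonneg]
    constructor <;> intro h <;> linarith

theorem lowerSemicontinuous_deficit {u : ℂ → EReal} {D : Set ℂ} (hu : UpperSemicontinuousOn u D)
    (hD : IsOpen D) (C : ℝ) : LowerSemicontinuous (deficit u D C) := by
  intro z y hy
  have hyt : y ≠ ⊤ := hy.ne_top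
  have hz : z ∈ D := by
    by_contra h
    simp [deficit, h] at hy
  rw [gt_iff_lt, deficit, indicator_of_mem hz, lt_toENNReal_sub_iff hyt] at hy
  have h1 := hu z hz _ hy
  rw [hD.nhdsWithin_eq hz] at h1
  filter_upwards [h1, hD.mem_nhds hz] with w hw hwD
  rw [gt_iff_lt, deficit, indicator_of_mem hwD]
  exact (lt_toENNReal_sub_iff hyt).2 hw

theorem toENNReal_sub_add {C : ℝ} (hC : 0 ≤ C) {x : EReal} (hx : x ≤ C) :
    ((C : EReal) - x).toENNReal + x.toENNReal = ENNReal.ofReal C + (-x).toENNReal := by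
  induction x with
  | bot => simp
  | top => simp at hx
  | coe x =>
    have hx' : x ≤ C := EReal.coe_le_coe_iff.1 hx
    rw [← EReal.coe_sub, ← EReal.coe_neg, EReal.toENNReal_of_ne_top (EReal.coe_ne_top _),
      EReal.toENNReal_of_ne_top (EReal.coe_ne_top _), EReal.toENNReal_of_ne_top (EReal.coe_ne_top _)]
    simp only [EReal.toReal_coe]
    rcases le_total 0 x with h | h
    · rw [ENNReal.ofReal_of_nonpos (p := -x) (by linarith), add_zero,
        ← ENNReal.ofReal_add (by linarith) h, sub_add_cancel]
    · rw [ENNReal.ofReal_of_nonpos h, add_zero, ← ENNReal.ofReal_add hC (by linarith),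
        sub_eq_add_neg]

theorem IsSubharmonicOn.isSuperMean_deficit {u : ℂ → EReal} {Ω D : Set ℂ}
    (hu : IsSubharmonicOn u Ω) (hD : IsOpen D) (hDΩ : D ⊆ Ω) {C : ℝ} (hC : 0 ≤ C)
    (huC : ∀ z ∈ D, u z ≤ C) : IsSuperMean (deficit u D C) D := by
  have hlsc := lowerSemicontinuous_deficit (hu.usc.mono hDΩ) hD C
  refine ⟨hlsc, fun z ρ hρ hz => ?_⟩
  have hmem : ∀ θ, circleMap z ρ θ ∈ D := fun θ =>
    hz (Metric.sphere_subset_closedBall (circleMap_mem_sphere z hρ.le θ))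
  have hzD : z ∈ D := hz (Metric.mem_closedBall_self hρ.le)
  have hsub := hu.submean z (hDΩ hzD) ρ hρ (hz.trans hDΩ)
  set A := ∫⁻ θ in Ioc 0 (2 * Real.pi), (u (circleMap z ρ θ)).toENNReal with hA
  set B := ∫⁻ θ in Ioc 0 (2 * Real.pi), (-u (circleMap z ρ θ)).toENNReal with hB
  have hid : circleLIntegral (deficit u D C) z ρ + A = ENNReal.ofReal (2 * Real.pi * C) + B := by
    have h1 : Measurable fun θ => deficit u D C (circleMap z ρ θ) :=
      hlsc.measurable.comp (continuous_circleMap z ρ).measurable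
    rw [circleLIntegral, hA, ← lintegral_add_left h1, hB]
    have h2 : ENNReal.ofReal (2 * Real.pi * C) =
        ∫⁻ θ in Ioc 0 (2 * Real.pi), ENNReal.ofReal C := by
      rw [lintegral_const, Measure.restrict_apply_univ, Real.volume_Ioc, sub_zero, mul_comm,
        ENNReal.ofReal_mul hC]
    rw [h2, ← lintegral_add_left measurable_const]
    refine lintegral_congr fun θ => ?_
    rw [deficit, indicator_of_mem (hmem θ)]
    exact toENNReal_sub_add hC (huC _ (hmem θ))
  have hAfin : A ≠ ⊤ := by
    have h1 : A ≤ ∫⁻ θ in Ioc 0 (2 * Real.pi), ENNReal.ofReal C :=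
      lintegral_mono fun θ => by
        have := EReal.toENNReal_le_toENNReal (huC _ (hmem θ))
        rwa [EReal.toENNReal_of_ne_top (EReal.coe_ne_top _), EReal.toReal_coe] at this
    refine ne_top_of_le_ne_top ?_ h1
    rw [lintegral_const, Measure.restrict_apply_univ, Real.volume_Ioc]
    exact ENNReal.mul_ne_top ENNReal.ofReal_ne_top ENNReal.ofReal_ne_top
  have hsub' : u z ≤ ((A / ENNReal.ofReal (2 * Real.pi) : ℝ≥0∞) : EReal) -
    ((B / ENNReal.ofReal (2 * Real.pi) : ℝ≥0∞) : EReal) := hsub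
  have hval : deficit u D C z = ((C : EReal) - u z).toENNReal := indicator_of_mem hzD _
  rw [hval]
  have hpi := Real.two_pi_pos
  induction hx : u z with
  | bot => simp [ENNReal.mul_top, Real.pi_pos]
  | top => exact absurd hx (hu.lt_top z (hDΩ hzD)).ne
  | coe x =>
    rw [hx] at hsub'
    have hBfin : B ≠ ⊤ := by
      rintro hBt
      rw [hBt, ENNReal.top_div_of_ne_top ENNReal.ofReal_ne_top] at hsub'
      simp at hsub'
    lift A to NNReal using hAfin with a
    lift B to NNReal using hBfin with b
    have hF : circleLIntegral (deficit u D C) z ρ ≠ ⊤ := fun h => by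
      rw [h, top_add] at hid
      exact (ENNReal.add_ne_top.2 ⟨ENNReal.ofReal_ne_top, ENNReal.coe_ne_top⟩) hid.symm
    rw [← ENNReal.toReal_eq_toReal_iff' (by finiteness) (by finiteness),
      ENNReal.toReal_add hF (by finiteness), ENNReal.toReal_add (by finiteness) (by finiteness),
      ENNReal.toReal_ofReal (by positivity)] at hid
    rw [← EReal.coe_ennreal_toReal (ENNReal.div_ne_top (by finiteness) ofReal_two_pi_ne_zero),
      ← EReal.coe_ennreal_toReal (ENNReal.div_ne_top (by finiteness) ofReal_two_pi_ne_zero),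
      ← EReal.coe_sub, EReal.coe_le_coe_iff, ENNReal.toReal_div, ENNReal.toReal_div,
      ENNReal.toReal_ofReal hpi.le, ← sub_div, le_div_iff₀ hpi] at hsub'
    rw [← EReal.coe_sub, EReal.toENNReal_of_ne_top (EReal.coe_ne_top _), EReal.toReal_coe,
      ← ENNReal.ofReal_mul hpi.le, ← ENNReal.ofReal_toReal hF]
    refine ENNReal.ofReal_le_ofReal ?_
    linarith

end

end DeltaSubharmonic

namespace DeltaSubharmonic

noncomputable section

/-! ### Local integrability of subharmonic functions -/

theorem IsSubharmonicOn.exists_le {u : ℂ → EReal} {Ω K : Set ℂ} (hu : IsSubharmonicOn u Ω)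
    (hK : IsCompact K) (hKΩ : K ⊆ Ω) : ∃ C : ℝ, 0 ≤ C ∧ ∀ z ∈ K, u z ≤ C := by
  rcases K.eq_empty_or_nonempty with rfl | hne
  · exact ⟨0, le_rfl, by simp⟩
  obtain ⟨z₀, hz₀, hmax⟩ := (hu.usc.mono hKΩ).exists_isMaxOn hne hK
  refine ⟨max 0 (u z₀).toReal, le_max_left _ _, fun z hz => ?_⟩
  exact (hmax hz).trans ((EReal.le_coe_toReal (hu.lt_top z₀ (hKΩ hz₀)).ne).trans
    (EReal.coe_le_coe_iff.2 (le_max_right _ _)))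

theorem neg_toENNReal_le {C : ℝ} (hC : 0 ≤ C) (x : EReal) :
    (-x).toENNReal ≤ ((C : EReal) - x).toENNReal := by
  refine EReal.toENNReal_le_toENNReal ?_
  rw [sub_eq_add_neg]
  exact le_add_of_nonneg_left (by exact_mod_cast hC)

theorem sub_toENNReal_le (C : ℝ) (x : EReal) :
    ((C : EReal) - x).toENNReal ≤ ENNReal.ofReal C + (-x).toENNReal := by
  rw [sub_eq_add_neg]
  refine EReal.toENNReal_add_le.trans ?_
  rw [EReal.toENNReal_of_ne_top (EReal.coe_ne_top _), EReal.toReal_coe]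

theorem IsSubharmonicOn.lintegral_ball_neg_lt_top {u : ℂ → EReal} {Ω : Set ℂ}
    (hu : IsSubharmonicOn u Ω) {z : ℂ} {ρ : ℝ} (hρ : 0 < ρ)
    (hz : Metric.closedBall z (2 * ρ) ⊆ Ω) (huz : u z ≠ ⊥) :
    ∫⁻ w in Metric.ball z ρ, (-u w).toENNReal < ⊤ := by
  obtain ⟨C, hC, huC⟩ := hu.exists_le (isCompact_closedBall z (2 * ρ)) hz
  have hsub : Metric.ball z (2 * ρ) ⊆ Metric.closedBall z (2 * ρ) := Metric.ball_subset_closedBall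
  have hf := hu.isSuperMean_deficit Metric.isOpen_ball (hsub.trans hz) hC fun w hw => huC w (hsub hw)
  set f := deficit u (Metric.ball z (2 * ρ)) C with hfdef
  have hk : Measurable ((Iic ρ).indicator fun _ : ℝ => (1 : ℝ≥0∞)) :=
    measurable_const.indicator measurableSet_Iic
  have h1 := hf.lintegral_mul_le hk (ε := ρ) (z := z) (fun x hx => by simp [hx])
    (Metric.closedBall_subset_ball (by linarith))
  have hfz : f z = ((C : EReal) - u z).toENNReal :=
    indicator_of_mem (Metric.mem_ball_self (by positivity)) _
  calc ∫⁻ w in Metric.ball z ρ, (-u w).toENNReal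
      ≤ ∫⁻ w in Metric.ball z ρ, f w * (Iic ρ).indicator (fun _ : ℝ => (1 : ℝ≥0∞)) ‖w - z‖ := by
        refine setLIntegral_mono' Metric.isOpen_ball.measurableSet fun w hw => ?_
        have h2 : ‖w - z‖ ∈ Iic ρ := (mem_ball_iff_norm.1 hw).le
        rw [indicator_of_mem h2, mul_one, hfdef, deficit, indicator_of_mem
          (Metric.ball_subset_ball (by linarith) hw)]
        exact neg_toENNReal_le hC _
    _ ≤ ∫⁻ w, f w * (Iic ρ).indicator (fun _ : ℝ => (1 : ℝ≥0∞)) ‖w - z‖ :=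
        setLIntegral_le_lintegral _ _
    _ ≤ _ := h1
    _ < ⊤ := by
        refine ENNReal.mul_lt_top ?_ (ENNReal.mul_lt_top ENNReal.ofReal_lt_top ?_)
        · rw [hfz]
          refine (sub_toENNReal_le C _).trans_lt (ENNReal.add_lt_top.2 ⟨ENNReal.ofReal_lt_top, ?_⟩)
          rw [lt_top_iff_ne_top, Ne, EReal.toENNReal_eq_top_iff, EReal.neg_eq_top_iff]
          exact huz
        · calc _ ≤ ∫⁻ x in Ioc 0 ρ, ENNReal.ofReal ρ := by
                rw [← lintegral_indicator measurableSet_Ioi, ← lintegral_indicator measurableSet_Ioc]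
                refine lintegral_mono fun x => ?_
                by_cases h0 : 0 < x <;> by_cases hx : x ≤ ρ <;>
                  simp [indicator, h0, hx, ENNReal.ofReal_le_ofReal]
            _ < ⊤ := by
                rw [lintegral_const]
                exact ENNReal.mul_lt_top ENNReal.ofReal_lt_top (by simp)

theorem IsSubharmonicOn.exists_lintegral_ball_lt_top {u : ℂ → EReal} {Ω : Set ℂ}
    (hu : IsSubharmonicOn u Ω) (hΩ : IsOpen Ω) (hconn : IsPreconnected Ω)
    (hne : ∃ z ∈ Ω, u z ≠ ⊥) {z : ℂ} (hz : z ∈ Ω) :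
    ∃ ρ > 0, ∫⁻ w in Metric.ball z ρ, (-u w).toENNReal < ⊤ := by
  by_contra hcon
  set A : Set ℂ := {z | ∃ ρ > 0, ∫⁻ w in Metric.ball z ρ, (-u w).toENNReal < ⊤} with hA
  set B : Set ℂ := {z | ∃ ρ > 0, ∀ w ∈ Metric.ball z ρ, u w = ⊥} with hB
  have hAo : IsOpen A := by
    refine Metric.isOpen_iff.2 fun x ⟨ρ, hρ, hx⟩ => ⟨ρ, hρ, fun y hy => ?_⟩
    refine ⟨ρ - dist y x, sub_pos.2 hy, (lintegral_mono_set ?_).trans_lt hx⟩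
    exact Metric.ball_subset_ball' (by linarith)
  have hBo : IsOpen B := by
    refine Metric.isOpen_iff.2 fun x ⟨ρ, hρ, hx⟩ => ⟨ρ, hρ, fun y hy => ?_⟩
    exact ⟨ρ - dist y x, sub_pos.2 hy, fun w hw =>
      hx w (Metric.ball_subset_ball' (by linarith) hw)⟩
  have hAB : A ∩ B = ∅ := by
    refine eq_empty_of_forall_notMem fun x ⟨⟨ρ, hρ, h1⟩, ρ', hρ', h2⟩ => ?_
    have hmin : 0 < min ρ ρ' := lt_min hρ hρ'
    have h3 : ∫⁻ w in Metric.ball x (min ρ ρ'), (-u w).toENNReal < ⊤ :=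
      (lintegral_mono_set (Metric.ball_subset_ball (min_le_left _ _))).trans_lt h1
    rw [setLIntegral_congr_fun Metric.isOpen_ball.measurableSet (g := fun _ => ⊤), lintegral_const,
      Measure.restrict_apply_univ, ENNReal.top_mul (Metric.measure_ball_pos _ _ hmin).ne'] at h3
    · exact lt_irrefl _ h3
    · intro w hw
      simp [h2 w (Metric.ball_subset_ball (min_le_right _ _) hw)]
  have hcover : ∀ x ∈ Ω, x ∉ A → x ∈ B := by
    intro x hx hxA
    obtain ⟨δ, hδ, hball⟩ := Metric.isOpen_iff.1 hΩ x hx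
    refine ⟨δ / 4, by positivity, fun w hw => ?_⟩
    by_contra hw'
    refine hxA ⟨δ / 4 - dist w x, sub_pos.2 hw, ?_⟩
    have h1 := hu.lintegral_ball_neg_lt_top (z := w) (ρ := δ / 4) (by positivity) ?_ hw'
    · refine (lintegral_mono_set (Metric.ball_subset_ball' ?_)).trans_lt h1
      rw [dist_comm x w]; linarith
    · refine (Metric.closedBall_subset_closedBall' (ε₂ := δ / 2 + δ / 4) (y := x) ?_).trans
        ((Metric.closedBall_subset_ball (by linarith)).trans hball)
      have := Metric.mem_ball.1 hw
      linarith
  obtain ⟨x, hx, hux⟩ := hne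
  have hxA : x ∈ A := by
    by_contra h
    obtain ⟨ρ, hρ, h1⟩ := hcover x hx h
    exact hux (h1 x (Metric.mem_ball_self hρ))
  obtain ⟨y, -, hy⟩ := hconn A B hAo hBo (fun y hy => or_iff_not_imp_left.2 (hcover y hy))
    ⟨x, hx, hxA⟩ ⟨z, hz, hcover z hz hcon⟩
  rw [hAB] at hy
  exact hy

theorem IsSubharmonicOn.lintegral_neg_lt_top {u : ℂ → EReal} {Ω K : Set ℂ}
    (hu : IsSubharmonicOn u Ω) (hΩ : IsOpen Ω) (hconn : IsPreconnected Ω)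
    (hne : ∃ z ∈ Ω, u z ≠ ⊥) (hK : IsCompact K) (hKΩ : K ⊆ Ω) :
    ∫⁻ w in K, (-u w).toENNReal < ⊤ := by
  refine hK.induction_on (p := fun s => ∫⁻ w in s, (-u w).toENNReal < ⊤) (by simp)
    (fun s t hst ht => (lintegral_mono_set hst).trans_lt ht)
    (fun s t hs ht => (lintegral_union_le _ _ _).trans_lt (ENNReal.add_lt_top.2 ⟨hs, ht⟩))
    fun x hx => ?_
  obtain ⟨ρ, hρ, h⟩ := hu.exists_lintegral_ball_lt_top hΩ hconn hne (hKΩ hx)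
  exact ⟨Metric.ball x ρ, mem_nhdsWithin_of_mem_nhds (Metric.ball_mem_nhds x hρ), h⟩

theorem IsSubharmonicOn.lintegral_deficit_lt_top {u : ℂ → EReal} {Ω K D : Set ℂ}
    (hu : IsSubharmonicOn u Ω) (hΩ : IsOpen Ω) (hconn : IsPreconnected Ω)
    (hne : ∃ z ∈ Ω, u z ≠ ⊥) (hK : IsCompact K) (hKΩ : K ⊆ Ω) (hD : MeasurableSet D) (hDK : D ⊆ K)
    (C : ℝ) : ∫⁻ w, deficit u D C w < ⊤ := by
  rw [deficit, lintegral_indicator hD]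
  calc _ ≤ ∫⁻ w in K, (ENNReal.ofReal C + (-u w).toENNReal) :=
        (lintegral_mono_set hDK).trans (lintegral_mono fun w => sub_toENNReal_le C _)
    _ = ENNReal.ofReal C * volume K + ∫⁻ w in K, (-u w).toENNReal := by
        rw [lintegral_add_left measurable_const, lintegral_const, Measure.restrict_apply_univ]
    _ < ⊤ := ENNReal.add_lt_top.2 ⟨ENNReal.mul_lt_top ENNReal.ofReal_lt_top hK.measure_lt_top,
        hu.lintegral_neg_lt_top hΩ hconn hne hK hKΩ⟩

end

end DeltaSubharmonic

namespace DeltaSubharmonic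

noncomputable section

/-! ### The Laplacian as a limit of circular means -/

theorem laplacian_eq_fderiv (φ : ℂ → ℝ) (w : ℂ) : Laplacian.laplacian φ w =
    fderiv ℝ (fderiv ℝ φ) w 1 1 + fderiv ℝ (fderiv ℝ φ) w Complex.I Complex.I := by
  rw [InnerProductSpace.laplacian_eq_iteratedFDeriv_complexPlane]
  simp [iteratedFDeriv_two_apply]

section TestFunction

variable {φ : ℂ → ℝ}

theorem contDiff_fderiv_of_infty {E F : Type*} [NormedAddCommGroup E] [NormedSpace ℝ E]
    [NormedAddCommGroup F] [NormedSpace ℝ F] {φ : E → F} (hφ : ContDiff ℝ ∞ φ) :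
    ContDiff ℝ ∞ (fderiv ℝ φ) := hφ.fderiv_right (by simp)

theorem continuous_laplacian (hφ : ContDiff ℝ ∞ φ) :
    Continuous fun w => Laplacian.laplacian φ w := by
  simp_rw [laplacian_eq_fderiv]
  have := (contDiff_fderiv_of_infty (contDiff_fderiv_of_infty hφ)).continuous
  fun_prop

theorem tsupport_laplacian_subset : tsupport (fun w => Laplacian.laplacian φ w) ⊆ tsupport φ := by
  refine closure_minimal (fun w hw => ?_) (isClosed_tsupport φ)
  by_contra h
  refine hw ?_
  change Laplacian.laplacian φ w = 0
  rw [laplacian_eq_fderiv]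
  have h1 : w ∉ tsupport (fderiv ℝ (fderiv ℝ φ)) := fun h' =>
    h (tsupport_fderiv_subset ℝ (tsupport_fderiv_subset ℝ h'))
  rw [image_eq_zero_of_notMem_tsupport h1]
  simp

theorem hasCompactSupport_laplacian (hc : HasCompactSupport φ) :
    HasCompactSupport fun w => Laplacian.laplacian φ w :=
  hc.of_isClosed_subset (isClosed_tsupport _) tsupport_laplacian_subset

theorem integral_fderiv_apply_eq_zero (hφ : ContDiff ℝ ∞ φ) (hc : HasCompactSupport φ) (v : ℂ) :
    ∫ w, fderiv ℝ φ w v = 0 := by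
  have hd : Continuous fun w => fderiv ℝ φ w v := by
    have := (contDiff_fderiv_of_infty hφ).continuous
    fun_prop
  have h := integral_bilinear_hasLineDerivAt_right_eq_neg_left_of_integrable (μ := volume)
    (f := fun _ : ℂ => (1 : ℝ)) (f' := fun _ => 0) (g := φ) (g' := fun w => fderiv ℝ φ w v) (v := v)
    (B := ContinuousLinearMap.mul ℝ ℝ) (by simp)
    (by simpa using hd.integrable_of_hasCompactSupport (hc.fderiv_apply ℝ v))
    (by simpa using hφ.continuous.integrable_of_hasCompactSupport hc)
    (fun x _ => (hasFDerivAt_const (1 : ℝ) x).hasLineDerivAt v)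
    (fun x _ => (hφ.differentiable (by simp) x).hasFDerivAt.hasLineDerivAt v)
  simpa using h

theorem integral_laplacian_eq_zero (hφ : ContDiff ℝ ∞ φ) (hc : HasCompactSupport φ) :
    ∫ w, Laplacian.laplacian φ w = 0 := by
  have hφ' := contDiff_fderiv_of_infty hφ
  have key : ∀ v, ∫ w, fderiv ℝ (fderiv ℝ φ) w v v = 0 ∧
      Integrable fun w => fderiv ℝ (fderiv ℝ φ) w v v := by
    intro v
    have h1 : ∀ w, fderiv ℝ (fun w => fderiv ℝ φ w v) w v = fderiv ℝ (fderiv ℝ φ) w v v := by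
      intro w
      rw [fderiv_clm_apply (hφ'.differentiable (by simp) w) (differentiableAt_const v)]
      simp
    have h2 : ContDiff ℝ ∞ fun w => fderiv ℝ φ w v := hφ'.clm_apply contDiff_const
    have h3 : HasCompactSupport fun w => fderiv ℝ φ w v := hc.fderiv_apply ℝ v
    simp_rw [← h1]
    refine ⟨integral_fderiv_apply_eq_zero h2 h3 v, ?_⟩
    have h4 : Continuous fun w => fderiv ℝ (fun w => fderiv ℝ φ w v) w v := by
      have := (contDiff_fderiv_of_infty h2).continuous
      fun_prop
    exact h4.integrable_of_hasCompactSupport (h3.fderiv_apply ℝ v)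
  simp_rw [laplacian_eq_fderiv]
  rw [integral_add (key 1).2 (key Complex.I).2, (key 1).1, (key Complex.I).1, add_zero]

theorem norm_sub_sub_le_of_lipschitz_fderiv {E F : Type*} [NormedAddCommGroup E] [NormedSpace ℝ E]
    [NormedAddCommGroup F] [NormedSpace ℝ F] {g : E → F} (hg : Differentiable ℝ g) {K : NNReal}
    (hK : LipschitzWith K (fderiv ℝ g)) (w x : E) :
    ‖g (w + x) - g w - fderiv ℝ g w x‖ ≤ K * ‖x‖ ^ 2 := by
  have h := (convex_closedBall w ‖x‖).norm_image_sub_le_of_norm_hasFDerivWithin_le'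
    (f := g) (f' := fderiv ℝ g) (φ := fderiv ℝ g w) (C := K * ‖x‖) (x := w) (y := w + x)
    (fun y _ => (hg y).hasFDerivAt.hasFDerivWithinAt)
    (fun y hy => by
      rw [← dist_eq_norm]
      exact (hK.dist_le_mul y w).trans (mul_le_mul_of_nonneg_left hy K.coe_nonneg))
    (Metric.mem_closedBall_self (norm_nonneg x)) (by simp)
  rw [add_sub_cancel_left] at h
  exact h.trans_eq (by ring)

theorem abs_taylor_sub_le (hφ : Differentiable ℝ φ) (hφ' : Differentiable ℝ (fderiv ℝ φ))
    {K : NNReal} (hK : LipschitzWith K (fderiv ℝ (fderiv ℝ φ))) (w x : ℂ) :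
    |φ (w + x) - φ w - fderiv ℝ φ w x - fderiv ℝ (fderiv ℝ φ) w x x / 2| ≤ K * ‖x‖ ^ 3 := by
  have step := norm_sub_sub_le_of_lipschitz_fderiv hφ' hK w
  set T := fderiv ℝ φ w with hT
  set B := fderiv ℝ (fderiv ℝ φ) w with hB
  clear_value B
  have hline : ∀ s : ℝ, HasDerivAt (fun s : ℝ => w + s • x) x s := fun s => by
    simpa using ((hasDerivAt_id s).smul_const x).const_add w
  have h := norm_image_sub_le_of_norm_deriv_le_segment_01' (C := K * ‖x‖ ^ 3)
    (f := fun s : ℝ => φ (w + s • x) - s * T x - s ^ 2 / 2 * B x x)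
    (f' := fun s : ℝ => fderiv ℝ φ (w + s • x) x - T x - s * B x x) ?_ ?_
  · have h0 : φ (w + x) - φ w - T x - B x x / 2 =
        φ (w + (1 : ℝ) • x) - 1 * T x - 1 ^ 2 / 2 * B x x -
        (φ (w + (0 : ℝ) • x) - 0 * T x - 0 ^ 2 / 2 * B x x) := by
      rw [one_smul, zero_smul, add_zero]
      ring
    rw [h0, ← Real.norm_eq_abs]
    exact h
  · intro s _
    have h1 := (hφ (w + s • x)).hasFDerivAt.comp_hasDerivAt s (hline s)
    have h2 : HasDerivAt (fun s : ℝ => s * T x) (T x) s := by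
      simpa using (hasDerivAt_id s).mul_const (T x)
    have h3 : HasDerivAt (fun s : ℝ => s ^ 2 / 2 * B x x) (s * B x x) s := by
      have := (((hasDerivAt_pow 2 s).div_const 2).mul_const (B x x))
      refine this.congr_deriv ?_
      simp
    exact ((h1.sub h2).sub h3).hasDerivWithinAt
  · intro s hs
    have h1 : fderiv ℝ φ (w + s • x) x - T x - s * B x x =
        (fderiv ℝ φ (w + s • x) - T - B (s • x)) x := by
      rw [map_smul]
      simp only [_root_.sub_apply, _root_.smul_apply, smul_eq_mul]
    rw [h1]
    refine (ContinuousLinearMap.le_opNorm _ _).trans ?_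
    have h2 := step (s • x)
    have h3 : ‖s • x‖ ≤ ‖x‖ := by
      rw [norm_smul, Real.norm_of_nonneg hs.1]
      exact mul_le_of_le_one_left (norm_nonneg _) hs.2.le
    calc _ ≤ K * ‖s • x‖ ^ 2 * ‖x‖ := mul_le_mul_of_nonneg_right h2 (norm_nonneg _)
      _ ≤ K * ‖x‖ ^ 2 * ‖x‖ := by gcongr
      _ = _ := by ring

theorem exists_lipschitzWith_of_hasCompactSupport {E F : Type*} [NormedAddCommGroup E]
    [NormedSpace ℝ E] [NormedAddCommGroup F] [NormedSpace ℝ F] {g : E → F} (hg : ContDiff ℝ ∞ g)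
    (hc : HasCompactSupport g) : ∃ K : NNReal, LipschitzWith K g := by
  obtain ⟨C, hC⟩ := (hc.fderiv ℝ).exists_bound_of_continuous
    (contDiff_fderiv_of_infty hg).continuous
  refine ⟨C.toNNReal, lipschitzWith_of_nnnorm_fderiv_le (𝕜 := ℝ) (hg.differentiable (by simp))
    fun x => ?_⟩
  rw [← NNReal.coe_le_coe, coe_nnnorm]
  exact (hC x).trans (Real.le_coe_toNNReal C)

theorem exists_taylor_bound (hφ : ContDiff ℝ ∞ φ) (hc : HasCompactSupport φ) :
    ∃ K : ℝ, 0 ≤ K ∧ ∀ w x : ℂ, |φ (w + x) - φ w - fderiv ℝ φ w x -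
      fderiv ℝ (fderiv ℝ φ) w x x / 2| ≤ K * ‖x‖ ^ 3 := by
  have hD := contDiff_fderiv_of_infty hφ
  have hD2 := contDiff_fderiv_of_infty hD
  have hc2 : HasCompactSupport (fderiv ℝ (fderiv ℝ φ)) := (hc.fderiv ℝ).fderiv ℝ
  have hd : Differentiable ℝ φ := hφ.differentiable (by simp)
  have hd' : Differentiable ℝ (fderiv ℝ φ) := hD.differentiable (by simp)
  obtain ⟨K, hK⟩ := exists_lipschitzWith_of_hasCompactSupport hD2 hc2
  refine ⟨K, K.coe_nonneg, fun w x => ?_⟩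
  exact abs_taylor_sub_le hd hd' hK w x

theorem exists_circleAverage_bound (hφ : ContDiff ℝ ∞ φ) (hc : HasCompactSupport φ) :
    ∃ K : ℝ, 0 ≤ K ∧ ∀ (w : ℂ) (ρ : ℝ), 0 ≤ ρ →
      |Real.circleAverage φ w ρ - φ w - ρ ^ 2 / 4 * Laplacian.laplacian φ w| ≤ K * ρ ^ 3 := by
  obtain ⟨K, hK0, hK⟩ := exists_taylor_bound hφ hc
  refine ⟨K, hK0, fun w ρ hρ => ?_⟩
  set T := fderiv ℝ φ w with hT
  set B := fderiv ℝ (fderiv ℝ φ) w with hB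
  set x : ℝ → ℂ := fun θ => circleMap 0 ρ θ with hx
  have hxc : Continuous x := continuous_circleMap 0 ρ
  have hxe : ∀ θ, x θ = (ρ * Real.cos θ) • (1 : ℂ) + (ρ * Real.sin θ) • Complex.I := by
    intro θ
    simp only [hx, circleMap, Complex.exp_mul_I, zero_add]
    simp
    ring
  have hTx : ∀ θ, T (x θ) = Real.cos θ * (ρ * T 1) + Real.sin θ * (ρ * T Complex.I) := by
    intro θ
    rw [hxe, map_add, map_smul, map_smul]
    simp
    ring
  have hBx : ∀ θ, B (x θ) (x θ) = Real.cos θ ^ 2 * (ρ ^ 2 * B 1 1) +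
      Real.sin θ * Real.cos θ * (ρ ^ 2 * (B 1 Complex.I + B Complex.I 1)) +
      Real.sin θ ^ 2 * (ρ ^ 2 * B Complex.I Complex.I) := by
    intro θ
    rw [hxe]
    simp only [map_add, map_smul, _root_.add_apply, _root_.smul_apply,
      smul_eq_mul]
    ring
  have hIT : ∫ θ in (0 : ℝ)..2 * Real.pi, T (x θ) = 0 := by
    simp_rw [hTx]
    rw [intervalIntegral.integral_add (Continuous.intervalIntegrable (by fun_prop) _ _)
      (Continuous.intervalIntegrable (by fun_prop) _ _), intervalIntegral.integral_mul_const,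
      intervalIntegral.integral_mul_const, integral_cos, integral_sin]
    simp
  have hIB : ∫ θ in (0 : ℝ)..2 * Real.pi, B (x θ) (x θ) =
      Real.pi * ρ ^ 2 * Laplacian.laplacian φ w := by
    simp_rw [hBx]
    rw [intervalIntegral.integral_add (Continuous.intervalIntegrable (by fun_prop) _ _)
      (Continuous.intervalIntegrable (by fun_prop) _ _),
      intervalIntegral.integral_add (Continuous.intervalIntegrable (by fun_prop) _ _)
      (Continuous.intervalIntegrable (by fun_prop) _ _), intervalIntegral.integral_mul_const,
      intervalIntegral.integral_mul_const, intervalIntegral.integral_mul_const, integral_cos_sq,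
      integral_sin_sq, integral_sin_mul_cos₁, laplacian_eq_fderiv]
    simp
    ring
  have hφx : Continuous fun θ => φ (w + x θ) := hφ.continuous.comp (by fun_prop)
  have hmain : ∫ θ in (0 : ℝ)..2 * Real.pi, (φ (w + x θ) - φ w - T (x θ) - B (x θ) (x θ) / 2) =
      2 * Real.pi * (Real.circleAverage φ w ρ - φ w - ρ ^ 2 / 4 * Laplacian.laplacian φ w) := by
    have hTc : Continuous fun θ => T (x θ) := by fun_prop
    have hBc : Continuous fun θ => B (x θ) (x θ) / 2 := by fun_prop
    rw [intervalIntegral.integral_sub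
      (f := fun θ => φ (w + x θ) - φ w - T (x θ))
      (((hφx.sub continuous_const).sub hTc).intervalIntegrable _ _) (hBc.intervalIntegrable _ _),
      intervalIntegral.integral_sub (f := fun θ => φ (w + x θ) - φ w)
        ((hφx.sub continuous_const).intervalIntegrable _ _)
        (hTc.intervalIntegrable _ _),
      intervalIntegral.integral_sub (hφx.intervalIntegrable _ _)
        (continuous_const.intervalIntegrable _ _), hIT, intervalIntegral.integral_div, hIB,
      intervalIntegral.integral_const, Real.circleAverage_def]
    have h1 : ∀ θ, w + x θ = circleMap w ρ θ := fun θ => by simp [hx, circleMap]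
    simp_rw [h1]
    have := Real.pi_pos.ne'
    simp only [smul_eq_mul]
    field_simp
    ring
  have hbound := intervalIntegral.norm_integral_le_of_norm_le_const (a := 0) (b := 2 * Real.pi)
    (C := K * ρ ^ 3) (f := fun θ => φ (w + x θ) - φ w - T (x θ) - B (x θ) (x θ) / 2)
    (fun θ _ => by
      have h1 : ‖x θ‖ = ρ := by simp [hx, abs_of_nonneg hρ]
      have := hK w (x θ)
      rwa [h1] at this)
  have h2pi := Real.two_pi_pos
  rw [hmain, Real.norm_eq_abs, abs_mul, abs_of_pos h2pi, sub_zero, abs_of_pos h2pi, mul_comm] at hbound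
  exact le_of_mul_le_mul_right hbound h2pi

end TestFunction

end

end DeltaSubharmonic

namespace DeltaSubharmonic

noncomputable section

/-! ### Positivity of the distributional Laplacian -/

theorem measurable_uncurry_circleMap (ρ : ℝ) :
    Measurable fun p : ℂ × ℝ => circleMap p.1 ρ p.2 := by
  unfold circleMap
  fun_prop

theorem lintegral_mul_circleLIntegral {f g : ℂ → ℝ≥0∞} (hf : Measurable f) (hg : Measurable g)
    (ρ : ℝ) : ∫⁻ w, f w * circleLIntegral g w ρ = ∫⁻ w, circleLIntegral f w ρ * g w := by
  have hm := measurable_uncurry_circleMap ρ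
  have h1 : ∀ w, f w * circleLIntegral g w ρ =
      ∫⁻ θ in Ioc 0 (2 * Real.pi), f w * g (circleMap w ρ θ) := fun w => by
    have h3 : Measurable fun θ => g (circleMap w ρ θ) :=
      hg.comp (continuous_circleMap w ρ).measurable
    rw [circleLIntegral, lintegral_const_mul _ h3]
  have h2 : ∀ w, circleLIntegral f w ρ * g w =
      ∫⁻ θ in Ioc 0 (2 * Real.pi), f (circleMap w ρ (θ + Real.pi)) * g w := fun w => by
    have h4 : Measurable fun θ => f (circleMap w ρ (θ + Real.pi)) :=
      hf.comp ((continuous_circleMap w ρ).comp (continuous_add_const Real.pi)).measurable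
    rw [lintegral_mul_const _ h4]
    congr 1
    have h3 : Function.Periodic (fun θ => f (circleMap w ρ θ)) (2 * Real.pi) := fun θ => by
      simp only [periodic_circleMap w ρ θ]
    rw [circleLIntegral, show Ioc 0 (2 * Real.pi) = Ioc 0 (0 + 2 * Real.pi) by rw [zero_add],
      lintegral_Ioc_eq_of_periodic Real.two_pi_pos h3 0 Real.pi]
    have h4 := (measurePreserving_add_right (volume : Measure ℝ)
      Real.pi).setLIntegral_comp_preimage_emb (measurableEmbedding_addRight Real.pi)
      (fun θ => f (circleMap w ρ θ)) (Ioc Real.pi (Real.pi + 2 * Real.pi))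
    rw [← h4]
    congr 2
    ext x
    simp only [mem_preimage, mem_Ioc]
    constructor <;> rintro ⟨h5, h6⟩ <;> constructor <;> linarith
  simp_rw [h1, h2]
  have hm2 : Measurable fun p : ℂ × ℝ => circleMap p.1 ρ (p.2 + Real.pi) :=
    hm.comp (measurable_fst.prodMk (measurable_snd.add_const _))
  rw [lintegral_lintegral_swap (f := fun w θ => f w * g (circleMap w ρ θ))
      (((hf.comp measurable_fst).mul (hg.comp hm)).aemeasurable),
    lintegral_lintegral_swap (f := fun w θ => f (circleMap w ρ (θ + Real.pi)) * g w)
      (((hf.comp hm2).mul (hg.comp measurable_fst)).aemeasurable)]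
  refine lintegral_congr fun θ => ?_
  rw [← lintegral_add_right_eq_self (μ := (volume : Measure ℂ))
    (fun w => f (circleMap w ρ (θ + Real.pi)) * g w) (circleMap 0 ρ θ)]
  refine lintegral_congr fun w => ?_
  have h5 : circleMap (w + circleMap 0 ρ θ) ρ (θ + Real.pi) = w := by
    simp [circleMap, add_mul, Complex.exp_add]
  have h6 : w + circleMap 0 ρ θ = circleMap w ρ θ := by simp [circleMap]
  rw [h5, h6]

theorem circleLIntegral_ofReal {φ : ℂ → ℝ} (hφ : Continuous φ) (h0 : ∀ w, 0 ≤ φ w) (w : ℂ) (ρ : ℝ) :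
    circleLIntegral (fun w => ENNReal.ofReal (φ w)) w ρ =
      ENNReal.ofReal (2 * Real.pi) * ENNReal.ofReal (Real.circleAverage φ w ρ) := by
  have hc : Continuous fun θ => φ (circleMap w ρ θ) := hφ.comp (continuous_circleMap w ρ)
  rw [circleLIntegral, ← ofReal_integral_eq_lintegral_ofReal, ← ENNReal.ofReal_mul (by positivity),
    Real.circleAverage_def, intervalIntegral.integral_of_le Real.two_pi_pos.le, smul_eq_mul,
    ← mul_assoc, mul_inv_cancel₀ Real.two_pi_pos.ne', one_mul]
  · exact (hc.integrableOn_Icc (a := 0) (b := 2 * Real.pi)).mono_set Ioc_subset_Icc_self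
  · exact Filter.Eventually.of_forall fun θ => h0 _

section Weight

variable {f : ℂ → ℝ≥0∞} {g : ℂ → ℝ}

theorem integrable_toReal_of_lintegral (hf : Measurable f) (hfi : ∫⁻ w, f w ≠ ⊤) :
    Integrable fun w => (f w).toReal := integrable_toReal_of_lintegral_ne_top hf.aemeasurable hfi

theorem integrable_toReal_mul (hf : Measurable f) (hfi : ∫⁻ w, f w ≠ ⊤) (hg : Continuous g)
    {K : ℝ} (hK : ∀ w, |g w| ≤ K) : Integrable fun w => (f w).toReal * g w :=
  (integrable_toReal_of_lintegral hf hfi).mul_bdd hg.aestronglyMeasurable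
    (Filter.Eventually.of_forall hK)

theorem integral_toReal_mul (hf : Measurable f) (hfi : ∫⁻ w, f w ≠ ⊤) (hg : Measurable g)
    (h0 : ∀ w, 0 ≤ g w) :
    ∫ w, (f w).toReal * g w = (∫⁻ w, f w * ENNReal.ofReal (g w)).toReal := by
  rw [integral_eq_lintegral_of_nonneg_ae
    (Filter.Eventually.of_forall fun w => mul_nonneg ENNReal.toReal_nonneg (h0 w))
    (hf.ennreal_toReal.mul hg).aestronglyMeasurable]
  congr 1
  refine lintegral_congr_ae ?_
  filter_upwards [ae_lt_top hf hfi] with w hw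
  rw [ENNReal.ofReal_mul ENNReal.toReal_nonneg, ENNReal.ofReal_toReal hw.ne]

end Weight

theorem IsSuperMean.integral_laplacian_nonpos {f : ℂ → ℝ≥0∞} {D : Set ℂ} (hf : IsSuperMean f D)
    (hfi : ∫⁻ w, f w ≠ ⊤) {φ : ℂ → ℝ} (hφ : ContDiff ℝ ∞ φ) (hc : HasCompactSupport φ)
    (h0 : ∀ w, 0 ≤ φ w) {δ : ℝ} (hδ : 0 < δ)
    (hD : ∀ w ∈ tsupport φ, Metric.closedBall w δ ⊆ D) :
    ∫ w, (f w).toReal * Laplacian.laplacian φ w ≤ 0 := by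
  obtain ⟨K, hK0, hK⟩ := exists_circleAverage_bound hφ hc
  obtain ⟨C, hC⟩ := hc.exists_bound_of_continuous hφ.continuous
  obtain ⟨C', hC'⟩ := (hasCompactSupport_laplacian hc).exists_bound_of_continuous
    (continuous_laplacian hφ)
  have hfm := hf.measurable
  have hint1 := integrable_toReal_mul hfm hfi hφ.continuous hC
  have hint2 := integrable_toReal_mul hfm hfi (continuous_laplacian hφ) hC'
  have hint0 := integrable_toReal_of_lintegral hfm hfi
  set I := ∫ w, (f w).toReal with hI
  have key : ∀ ρ, 0 < ρ → ρ ≤ δ →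
      ∫ w, (f w).toReal * Laplacian.laplacian φ w ≤ 4 * K * I * ρ := by
    intro ρ hρ hρδ
    have hcont : Continuous fun w => Real.circleAverage φ w ρ := by
      have h1 : Continuous (Function.uncurry fun (w : ℂ) (θ : ℝ) => φ (circleMap w ρ θ)) := by
        refine hφ.continuous.comp ?_
        simp only [circleMap]
        fun_prop
      simp_rw [Real.circleAverage_def, smul_eq_mul]
      have h2 : Continuous fun w => ∫ θ in (0 : ℝ)..2 * Real.pi, φ (circleMap w ρ θ) :=
        intervalIntegral.continuous_parametric_intervalIntegral_of_continuous' h1 _ _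
      exact continuous_const.mul h2
    have havg0 : ∀ w, 0 ≤ Real.circleAverage φ w ρ := fun w =>
      Real.circleAverage_nonneg_of_nonneg fun x _ => h0 x
    have havgC : ∀ w, |Real.circleAverage φ w ρ| ≤ C + ρ ^ 2 / 4 * C' + K * ρ ^ 3 := by
      intro w
      have h1 := hK w ρ hρ.le
      have h2 := hC w
      have h3 := hC' w
      rw [Real.norm_eq_abs] at h2 h3
      have h4 : |ρ ^ 2 / 4 * Laplacian.laplacian φ w| ≤ ρ ^ 2 / 4 * C' := by
        rw [abs_mul, abs_of_nonneg (by positivity : 0 ≤ ρ ^ 2 / 4)]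
        gcongr
      rw [abs_le] at h1 h2 h4 ⊢
      constructor <;> linarith
    have hint3 := integrable_toReal_mul hfm hfi hcont havgC
    have hle : ∫⁻ w, f w * ENNReal.ofReal (Real.circleAverage φ w ρ) ≤
        ∫⁻ w, f w * ENNReal.ofReal (φ w) := by
      have hmφ : Measurable fun w => ENNReal.ofReal (φ w) :=
        hφ.continuous.measurable.ennreal_ofReal
      have h1 := lintegral_mul_circleLIntegral hfm hmφ ρ
      simp_rw [circleLIntegral_ofReal hφ.continuous h0] at h1
      have h2 : ∫⁻ w, circleLIntegral f w ρ * ENNReal.ofReal (φ w) ≤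
          ∫⁻ w, ENNReal.ofReal (2 * Real.pi) * (f w * ENNReal.ofReal (φ w)) := by
        refine lintegral_mono fun w => ?_
        by_cases hw : w ∈ tsupport φ
        · rw [← mul_assoc]
          gcongr
          exact hf.supermean w ρ hρ ((Metric.closedBall_subset_closedBall hρδ).trans (hD w hw))
        · simp [image_eq_zero_of_notMem_tsupport hw]
      have hm1 : Measurable fun w => f w * ENNReal.ofReal (φ w) := hfm.mul hmφ
      have hm2 : Measurable fun w => f w * ENNReal.ofReal (Real.circleAverage φ w ρ) :=
        hfm.mul hcont.measurable.ennreal_ofReal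
      rw [← h1, lintegral_const_mul _ hm1] at h2
      have h3 : ∀ w, f w * (ENNReal.ofReal (2 * Real.pi) *
          ENNReal.ofReal (Real.circleAverage φ w ρ)) = ENNReal.ofReal (2 * Real.pi) *
          (f w * ENNReal.ofReal (Real.circleAverage φ w ρ)) := fun w => by ring
      simp_rw [h3] at h2
      rw [lintegral_const_mul _ hm2] at h2
      exact (ENNReal.mul_le_mul_iff_right ofReal_two_pi_ne_zero ENNReal.ofReal_ne_top).1 h2
    have hfin : ∫⁻ w, f w * ENNReal.ofReal (φ w) ≠ ⊤ := by
      refine ne_top_of_le_ne_top (ENNReal.mul_ne_top hfi (ENNReal.ofReal_ne_top (r := C))) ?_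
      rw [← lintegral_mul_const _ hfm]
      refine lintegral_mono fun w => ?_
      gcongr
      exact (le_abs_self _).trans (hC w)
    have hle' : ∫ w, (f w).toReal * Real.circleAverage φ w ρ ≤ ∫ w, (f w).toReal * φ w := by
      rw [integral_toReal_mul hfm hfi hcont.measurable havg0,
        integral_toReal_mul hfm hfi hφ.continuous.measurable h0]
      exact ENNReal.toReal_mono hfin hle
    have h5 : ∫ w, ρ ^ 2 / 4 * ((f w).toReal * Laplacian.laplacian φ w) ≤
        ∫ w, ((f w).toReal * Real.circleAverage φ w ρ - (f w).toReal * φ w +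
          K * ρ ^ 3 * (f w).toReal) := by
      refine integral_mono (hint2.const_mul _) ((hint3.sub hint1).add (hint0.const_mul _))
        fun w => ?_
      have h1 := (abs_le.1 (hK w ρ hρ.le)).1
      have h2 : 0 ≤ (f w).toReal := ENNReal.toReal_nonneg
      dsimp only
      nlinarith
    rw [integral_const_mul, integral_add
      (f := fun w => (f w).toReal * Real.circleAverage φ w ρ - (f w).toReal * φ w)
      (hint3.sub hint1) (hint0.const_mul _),
      integral_sub hint3 hint1, integral_const_mul] at h5
    have h6 : ρ ^ 2 / 4 * ∫ w, (f w).toReal * Laplacian.laplacian φ w ≤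
        ρ ^ 2 / 4 * (4 * K * I * ρ) := by
      calc _ ≤ K * ρ ^ 3 * I := by linarith
        _ = _ := by ring
    exact le_of_mul_le_mul_left h6 (by positivity)
  have hlim : Filter.Tendsto (fun ρ : ℝ => 4 * K * I * ρ) (nhdsWithin 0 (Ioi 0)) (nhds 0) := by
    have : Filter.Tendsto (fun ρ : ℝ => 4 * K * I * ρ) (nhds 0) (nhds (4 * K * I * 0)) :=
      (continuous_const.mul continuous_id).tendsto 0
    rw [mul_zero] at this
    exact this.mono_left nhdsWithin_le_nhds
  refine ge_of_tendsto hlim ?_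
  filter_upwards [Ioc_mem_nhdsGT hδ] with ρ hρ
  exact key ρ hρ.1 hρ.2

/-- On `D` the function `u` coincides almost everywhere with `C` minus its deficit. -/
theorem toReal_eq_sub_deficit {u : ℂ → EReal} {D : Set ℂ} {C : ℝ} {w : ℂ} (hw : w ∈ D)
    (hu : u w ≤ C) (hfin : deficit u D C w ≠ ⊤) : (u w).toReal = C - (deficit u D C w).toReal := by
  rw [deficit, indicator_of_mem hw] at hfin ⊢
  induction hx : u w with
  | bot => simp [hx] at hfin
  | top => simp [hx] at hu
  | coe x =>
    rw [hx, EReal.coe_le_coe_iff] at hu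
    rw [← EReal.coe_sub, EReal.toENNReal_of_ne_top (EReal.coe_ne_top _), EReal.toReal_coe,
      EReal.toReal_coe, ENNReal.toReal_ofReal (by linarith)]
    ring

theorem IsSubharmonicOn.integral_laplacian_eq {u : ℂ → EReal} {Ω K D : Set ℂ}
    (hu : IsSubharmonicOn u Ω) (hΩ : IsOpen Ω) (hconn : IsPreconnected Ω)
    (hne : ∃ z ∈ Ω, u z ≠ ⊥) (hK : IsCompact K) (hKΩ : K ⊆ Ω) (hD : IsOpen D) (hDK : D ⊆ K)
    {C : ℝ} (huC : ∀ z ∈ D, u z ≤ C) {φ : ℂ → ℝ} (hφ : ContDiff ℝ ∞ φ)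
    (hc : HasCompactSupport φ) (hs : tsupport φ ⊆ D) :
    Integrable (fun w => (u w).toReal * Laplacian.laplacian φ w) ∧
    ∫ w, (u w).toReal * Laplacian.laplacian φ w =
      -∫ w, (deficit u D C w).toReal * Laplacian.laplacian φ w := by
  have hfi := (hu.lintegral_deficit_lt_top hΩ hconn hne hK hKΩ hD.measurableSet hDK C).ne
  have hfm := (lowerSemicontinuous_deficit (hu.usc.mono (hDK.trans hKΩ)) hD C).measurable
  obtain ⟨C', hC'⟩ := (hasCompactSupport_laplacian hc).exists_bound_of_continuous
    (continuous_laplacian hφ)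
  have hint2 := integrable_toReal_mul hfm hfi (continuous_laplacian hφ) hC'
  have hint1 : Integrable fun w => C * Laplacian.laplacian φ w :=
    ((continuous_laplacian hφ).integrable_of_hasCompactSupport
      (hasCompactSupport_laplacian hc)).const_mul C
  have h1 : (fun w => (u w).toReal * Laplacian.laplacian φ w) =ᵐ[volume]
      fun w => C * Laplacian.laplacian φ w -
        (deficit u D C w).toReal * Laplacian.laplacian φ w := by
    filter_upwards [ae_lt_top hfm hfi] with w hw
    by_cases hwD : w ∈ D
    · rw [toReal_eq_sub_deficit hwD (huC w hwD) hw.ne, sub_mul]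
    · have h2 : Laplacian.laplacian φ w = 0 :=
        image_eq_zero_of_notMem_tsupport (f := fun w => Laplacian.laplacian φ w)
          fun h => hwD (hs (tsupport_laplacian_subset h))
      rw [h2]
      simp
  refine ⟨(hint1.sub hint2).congr h1.symm, ?_⟩
  rw [integral_congr_ae h1, integral_sub hint1 hint2, integral_const_mul,
    integral_laplacian_eq_zero hφ hc]
  simp

/-- The distributional Laplacian of a subharmonic function is defined and positive. -/
theorem IsSubharmonicOn.integral_laplacian_nonneg {u : ℂ → EReal} {Ω : Set ℂ}
    (hu : IsSubharmonicOn u Ω) (hΩ : IsOpen Ω) (hconn : IsPreconnected Ω)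
    (hne : ∃ z ∈ Ω, u z ≠ ⊥) {φ : ℂ → ℝ} (hφ : ContDiff ℝ ∞ φ)
    (hc : HasCompactSupport φ) (hs : tsupport φ ⊆ Ω) :
    Integrable (fun w => (u w).toReal * Laplacian.laplacian φ w) ∧
    ((∀ w, 0 ≤ φ w) → 0 ≤ ∫ w, (u w).toReal * Laplacian.laplacian φ w) := by
  obtain ⟨δ, hδ, hδΩ⟩ := hc.isCompact.exists_cthickening_subset_open hΩ hs
  have hK : IsCompact (Metric.cthickening δ (tsupport φ)) := hc.isCompact.cthickening
  obtain ⟨C, hC, huC⟩ := hu.exists_le hK hδΩ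
  set D := Metric.thickening δ (tsupport φ) with hDdef
  have hD : IsOpen D := Metric.isOpen_thickening
  have hDK : D ⊆ Metric.cthickening δ (tsupport φ) := Metric.thickening_subset_cthickening _ _
  have huC' : ∀ z ∈ D, u z ≤ C := fun z hz => huC z (hDK hz)
  obtain ⟨hint, heq⟩ := hu.integral_laplacian_eq hΩ hconn hne hK hδΩ hD hDK huC' hφ hc
    (Metric.self_subset_thickening hδ _)
  refine ⟨hint, fun h0 => ?_⟩
  rw [heq, le_neg, neg_zero]
  refine (hu.isSuperMean_deficit hD (hDK.trans hδΩ) hC huC').integral_laplacian_nonpos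
    (hu.lintegral_deficit_lt_top hΩ hconn hne hK hδΩ hD.measurableSet hDK C).ne hφ hc h0
    (half_pos hδ) fun w hw => ?_
  exact (Metric.closedBall_subset_ball (by linarith)).trans (Metric.ball_subset_thickening hw δ)

end

end DeltaSubharmonic

namespace DeltaSubharmonic

noncomputable section

/-! ### Existence of the Riesz measure -/

section ExtendZero

open CompactlySupported

variable {Ω : Set ℂ}

/-- Extension by zero of a function with compact support in `Ω`. -/
def extendZero (f : C_c(Ω, ℝ)) : ℂ → ℝ := Function.extend Subtype.val f 0

theorem extendZero_apply (f : C_c(Ω, ℝ)) (x : Ω) : extendZero f x = f x :=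
  Subtype.val_injective.extend_apply _ _ _

theorem extendZero_of_notMem (f : C_c(Ω, ℝ)) {z : ℂ} (hz : z ∉ Ω) : extendZero f z = 0 :=
  Function.extend_apply' _ _ _ (by rintro ⟨x, rfl⟩; exact hz x.2)

theorem extendZero_add (f g : C_c(Ω, ℝ)) : extendZero (f + g) = extendZero f + extendZero g := by
  ext z
  by_cases hz : z ∈ Ω
  · lift z to Ω using hz
    simp [extendZero_apply]
  · simp [extendZero_of_notMem _ hz]

theorem extendZero_smul (c : ℝ) (f : C_c(Ω, ℝ)) : extendZero (c • f) = c • extendZero f := by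
  ext z
  by_cases hz : z ∈ Ω
  · lift z to Ω using hz
    simp [extendZero_apply]
  · simp [extendZero_of_notMem _ hz]

theorem tsupport_extendZero_subset (f : C_c(Ω, ℝ)) :
    tsupport (extendZero f) ⊆ Subtype.val '' tsupport f := by
  refine closure_minimal (fun z hz => ?_)
    (f.hasCompactSupport.isCompact.image continuous_subtype_val).isClosed
  have hzΩ : z ∈ Ω := by
    by_contra h
    exact hz (extendZero_of_notMem f h)
  lift z to Ω using hzΩ
  rw [Function.mem_support, extendZero_apply] at hz
  exact ⟨z, subset_tsupport _ hz, rfl⟩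

theorem tsupport_extendZero_subset_domain (f : C_c(Ω, ℝ)) : tsupport (extendZero f) ⊆ Ω :=
  (tsupport_extendZero_subset f).trans (by rintro _ ⟨x, -, rfl⟩; exact x.2)

theorem hasCompactSupport_extendZero (f : C_c(Ω, ℝ)) : HasCompactSupport (extendZero f) :=
  (f.hasCompactSupport.isCompact.image continuous_subtype_val).of_isClosed_subset
    (isClosed_tsupport _) (tsupport_extendZero_subset f)

/-- Restriction to `Ω` of a continuous function with compact support in `Ω`. -/
def restrictDomain (φ : ℂ → ℝ) (hφ : Continuous φ) (hc : HasCompactSupport φ)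
    (hs : tsupport φ ⊆ Ω) : C_c(Ω, ℝ) where
  toFun x := φ x
  continuous_toFun := hφ.comp continuous_subtype_val
  hasCompactSupport' := by
    refine HasCompactSupport.intro (K := Subtype.val ⁻¹' tsupport φ)
      (Topology.IsInducing.subtypeVal.isCompact_preimage' hc.isCompact
        (by rwa [Subtype.range_coe])) fun x hx => ?_
    exact image_eq_zero_of_notMem_tsupport hx

theorem extendZero_restrictDomain {φ : ℂ → ℝ} (hφ : Continuous φ) (hc : HasCompactSupport φ)
    (hs : tsupport φ ⊆ Ω) : extendZero (restrictDomain φ hφ hc hs) = φ := by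
  ext z
  by_cases hz : z ∈ Ω
  · lift z to Ω using hz
    exact extendZero_apply _ z
  · rw [extendZero_of_notMem _ hz, image_eq_zero_of_notMem_tsupport fun h => hz (hs h)]

variable (Ω) in
/-- The functions with compact support in `Ω` which are smooth. -/
def smoothSubmodule : Submodule ℝ C_c(Ω, ℝ) where
  carrier := {f | ContDiff ℝ ∞ (extendZero f)}
  add_mem' := fun {f g} hf hg => by
    simp only [mem_ofPred_eq, extendZero_add] at *
    exact hf.add hg
  zero_mem' := by
    have : extendZero (0 : C_c(Ω, ℝ)) = 0 := by
      have := extendZero_smul 0 (0 : C_c(Ω, ℝ))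
      simpa using this
    simp only [mem_ofPred_eq, this]
    exact contDiff_const
  smul_mem' := fun c f hf => by
    simp only [mem_ofPred_eq, extendZero_smul] at *
    exact contDiff_const.smul hf

theorem mem_smoothSubmodule {f : C_c(Ω, ℝ)} :
    f ∈ smoothSubmodule Ω ↔ ContDiff ℝ ∞ (extendZero f) := Iff.rfl

end ExtendZero

theorem exists_smooth_one_le {Ω K : Set ℂ} (hΩ : IsOpen Ω) (hK : IsCompact K) (hKΩ : K ⊆ Ω) :
    ∃ φ : ℂ → ℝ, ContDiff ℝ ∞ φ ∧ HasCompactSupport φ ∧ tsupport φ ⊆ Ω ∧ (∀ z, 0 ≤ φ z) ∧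
      ∀ z ∈ K, 1 ≤ φ z := by
  obtain ⟨L, hL, hKL, hLΩ⟩ := exists_compact_between hK hΩ hKΩ
  obtain ⟨f, hsupp, hf, hrange⟩ := (isOpen_interior (s := L)).exists_contDiff_support_eq (n := ⊤)
  have h0 : ∀ z, 0 ≤ f z := fun z => (hrange ⟨z, rfl⟩).1
  have hts : tsupport f ⊆ L := closure_minimal (hsupp.trans_subset interior_subset) hL.isClosed
  have hcs : HasCompactSupport f := hL.of_isClosed_subset (isClosed_tsupport _) hts
  rcases K.eq_empty_or_nonempty with rfl | hne
  · exact ⟨f, hf, hcs, hts.trans hLΩ, h0, by simp⟩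
  obtain ⟨z₀, hz₀, hmin⟩ := hK.exists_isMinOn hne hf.continuous.continuousOn
  have hpos : 0 < f z₀ := (h0 z₀).lt_of_ne fun h => by
    have : z₀ ∈ Function.support f := hsupp ▸ hKL hz₀
    exact this h.symm
  have hsupp' : tsupport (fun z => (f z₀)⁻¹ * f z) ⊆ tsupport f := tsupport_mul_subset_right
  refine ⟨fun z => (f z₀)⁻¹ * f z, contDiff_const.mul hf, hcs.mul_left,
    hsupp'.trans (hts.trans hLΩ), fun z => mul_nonneg (inv_nonneg.2 hpos.le) (h0 z),
    fun z hz => ?_⟩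
  change 1 ≤ (f z₀)⁻¹ * f z
  rw [inv_mul_eq_div, le_div_iff₀ hpos, one_mul]
  exact hmin hz

section Functional

open CompactlySupported

variable {u : ℂ → EReal} {Ω : Set ℂ}

/-- The distributional Laplacian of `u`, divided by `2π`, as a functional on smooth functions. -/
def laplacianFunctional (u : ℂ → EReal) (Ω : Set ℂ)
    (hint : ∀ f : smoothSubmodule Ω, Integrable fun w => (u w).toReal *
      Laplacian.laplacian (extendZero (f : C_c(Ω, ℝ))) w) :
    C_c(Ω, ℝ) →ₗ.[ℝ] ℝ where
  domain := smoothSubmodule Ω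
  toFun :=
    { toFun := fun f => (2 * Real.pi)⁻¹ *
        ∫ w, (u w).toReal * Laplacian.laplacian (extendZero (f : C_c(Ω, ℝ))) w
      map_add' := fun f g => by
        rw [← mul_add, ← integral_add (hint f) (hint g)]
        congr 2
        ext w
        have hf := (contDiff_infty.1 (mem_smoothSubmodule.1 f.2) 2).contDiffAt (x := w)
        have hg := (contDiff_infty.1 (mem_smoothSubmodule.1 g.2) 2).contDiffAt (x := w)
        rw [Submodule.coe_add, extendZero_add, hf.laplacian_add hg, mul_add]
      map_smul' := fun c f => by
        rw [RingHom.id_apply, smul_eq_mul, mul_left_comm]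
        congr 1
        rw [← integral_const_mul]
        refine integral_congr_ae (Filter.Eventually.of_forall fun w => ?_)
        beta_reduce
        have hf := (contDiff_infty.1 (mem_smoothSubmodule.1 f.2) 2).contDiffAt (x := w)
        rw [Submodule.coe_smul, extendZero_smul,
          InnerProductSpace.laplacian_smul c hf, smul_eq_mul]
        ring }

theorem restrictDomain_mem_smoothSubmodule {φ : ℂ → ℝ} (hφ : ContDiff ℝ ∞ φ)
    (hc : HasCompactSupport φ) (hs : tsupport φ ⊆ Ω) :
    restrictDomain φ hφ.continuous hc hs ∈ smoothSubmodule Ω := by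
  rwa [mem_smoothSubmodule, extendZero_restrictDomain]

variable (Ω) in
/-- The cone of nonnegative functions with compact support in `Ω`. -/
def nonnegCone : PointedCone ℝ C_c(Ω, ℝ) where
  carrier := {f | ∀ x, 0 ≤ f x}
  add_mem' := fun hf hg x => add_nonneg (hf x) (hg x)
  zero_mem' := fun _ => le_rfl
  smul_mem' := fun c _ hf x => mul_nonneg c.2 (hf x)

theorem exists_smooth_add_nonneg (hΩ : IsOpen Ω) (y : C_c(Ω, ℝ)) :
    ∃ x : smoothSubmodule Ω, (x : C_c(Ω, ℝ)) + y ∈ nonnegCone Ω := by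
  obtain ⟨φ, hφ, hc, hs, h0, h1⟩ := exists_smooth_one_le hΩ
    (hasCompactSupport_extendZero y).isCompact (tsupport_extendZero_subset_domain y)
  obtain ⟨C, hC⟩ := y.hasCompactSupport.exists_bound_of_continuous y.continuous
  have hx := restrictDomain_mem_smoothSubmodule hφ hc hs
  refine ⟨C • ⟨_, hx⟩, ?_⟩
  rw [Submodule.coe_smul]
  intro x
  change 0 ≤ C * φ x + y x
  have h3 := abs_le.1 (hC x)
  have h4 : 0 ≤ C := (norm_nonneg _).trans (hC x)
  by_cases hy : (x : ℂ) ∈ tsupport (extendZero y)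
  · nlinarith [h1 x hy, h3.1]
  · have h5 := image_eq_zero_of_notMem_tsupport hy
    rw [extendZero_apply] at h5
    rw [h5, add_zero]
    exact mul_nonneg h4 (h0 x)

theorem IsSubharmonicOn.exists_positiveLinearMap
    (hu : IsSubharmonicOn u Ω) (hΩ : IsOpen Ω) (hconn : IsPreconnected Ω)
    (hne : ∃ z ∈ Ω, u z ≠ ⊥) : ∃ Λ : C_c(Ω, ℝ) →ₚ[ℝ] ℝ, ∀ (φ : ℂ → ℝ) (hφ : ContDiff ℝ ∞ φ)
      (hc : HasCompactSupport φ) (hs : tsupport φ ⊆ Ω),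
      Λ (restrictDomain φ hφ.continuous hc hs) =
        (2 * Real.pi)⁻¹ * ∫ w, (u w).toReal * Laplacian.laplacian φ w := by
  have key : ∀ f : smoothSubmodule Ω,
      Integrable (fun w => (u w).toReal * Laplacian.laplacian (extendZero (f : C_c(Ω, ℝ))) w) ∧
      ((∀ w, 0 ≤ extendZero (f : C_c(Ω, ℝ)) w) →
        0 ≤ ∫ w, (u w).toReal * Laplacian.laplacian (extendZero (f : C_c(Ω, ℝ))) w) := fun f =>
    hu.integral_laplacian_nonneg hΩ hconn hne (mem_smoothSubmodule.1 f.2)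
      (hasCompactSupport_extendZero _) (tsupport_extendZero_subset_domain _)
  obtain ⟨g, hgT, hgpos⟩ := riesz_extension (nonnegCone Ω)
    (laplacianFunctional u Ω fun f => (key f).1)
    (fun f hf => by
      refine mul_nonneg (by positivity) ((key f).2 fun w => ?_)
      by_cases hw : w ∈ Ω
      · lift w to Ω using hw
        rw [extendZero_apply]
        exact hf w
      · rw [extendZero_of_notMem _ hw])
    (exists_smooth_add_nonneg hΩ)
  refine ⟨PositiveLinearMap.mk₀ g fun f hf => hgpos f hf, fun φ hφ hc hs => ?_⟩
  have h2 := hgT ⟨_, restrictDomain_mem_smoothSubmodule hφ hc hs⟩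
  have h3 : laplacianFunctional u Ω (fun f => (key f).1)
      ⟨_, restrictDomain_mem_smoothSubmodule hφ hc hs⟩ =
      (2 * Real.pi)⁻¹ * ∫ w, (u w).toReal * Laplacian.laplacian
      (extendZero (restrictDomain φ hφ.continuous hc hs)) w := rfl
  rw [extendZero_restrictDomain] at h3
  exact h2.trans h3

theorem IsSubharmonicOn.exists_isRieszMeasure
    (hu : IsSubharmonicOn u Ω) (hΩ : IsOpen Ω) (hconn : IsPreconnected Ω)
    (hne : ∃ z ∈ Ω, u z ≠ ⊥) : ∃ μ, IsRieszMeasure u Ω μ := by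
  have : LocallyCompactSpace Ω := hΩ.locallyCompactSpace
  obtain ⟨Λ, hΛ⟩ := hu.exists_positiveLinearMap hΩ hconn hne
  have hemb : MeasurableEmbedding (Subtype.val : Ω → ℂ) :=
    MeasurableEmbedding.subtype_coe hΩ.measurableSet
  refine ⟨(RealRMK.rieszMeasure Λ).map Subtype.val, ?_, fun K hK hKc => ?_, fun φ hφ hc hs => ?_⟩
  · rw [hemb.map_apply]
    simp
  · rw [hemb.map_apply]
    exact (Topology.IsInducing.subtypeVal.isCompact_preimage' hKc
      (by rwa [Subtype.range_coe])).measure_lt_top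
  · rw [hemb.integral_map, ← hΛ φ hφ hc hs, ← RealRMK.integral_rieszMeasure]
    rfl

end Functional

theorem IsSubharmonicOn.isRieszMeasure_rieszMeasure {u : ℂ → EReal} {Ω : Set ℂ}
    (hu : IsSubharmonicOn u Ω) (hΩ : IsOpen Ω) (hconn : IsPreconnected Ω)
    (hne : ∃ z ∈ Ω, u z ≠ ⊥) : IsRieszMeasure u Ω (rieszMeasure u Ω) := by
  have h := hu.exists_isRieszMeasure hΩ hconn hne
  rw [rieszMeasure, dif_pos h]
  exact h.choose_spec

end

end DeltaSubharmonic

namespace DeltaSubharmonic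

noncomputable section

/-! ### Averages of translates of a test function -/

section Translates

theorem integrable_translate {F : Type} [NormedAddCommGroup F] {J : ℂ → F} {P : Measure ℂ}
    [IsFiniteMeasure P] (hJ : Continuous J) (hc : HasCompactSupport J)
    (w : ℂ) : Integrable (fun ζ => J (w - ζ)) P := by
  obtain ⟨C, hC⟩ := hc.exists_bound_of_continuous hJ
  exact Integrable.of_bound (by fun_prop) C (Filter.Eventually.of_forall fun ζ => hC _)

variable {F : Type} [NormedAddCommGroup F] [NormedSpace ℝ F] {J : ℂ → F} {P : Measure ℂ}

theorem hasFDerivAt_integral_translate [IsFiniteMeasure P]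
    (hJ : ContDiff ℝ ∞ J) (hc : HasCompactSupport J) (w : ℂ) :
    HasFDerivAt (fun w => ∫ ζ, J (w - ζ) ∂P) (∫ ζ, fderiv ℝ J (w - ζ) ∂P) w := by
  have hJ' : Continuous (fderiv ℝ J) := hJ.continuous_fderiv (by simp)
  obtain ⟨C, hC⟩ := (hc.fderiv ℝ).exists_bound_of_continuous hJ'
  have hJc := hJ.continuous
  refine hasFDerivAt_integral_of_dominated_of_fderiv_le (bound := fun _ => C)
    (F' := fun w ζ => fderiv ℝ J (w - ζ)) Filter.univ_mem
    (Filter.Eventually.of_forall fun x => (integrable_translate hJc hc x).aestronglyMeasurable)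
    (integrable_translate hJc hc w) (by fun_prop)
    (Filter.Eventually.of_forall fun ζ x _ => hC _) (integrable_const C)
    (Filter.Eventually.of_forall fun ζ x _ => ?_)
  have h1 : HasFDerivAt J (fderiv ℝ J (x - ζ)) (x - ζ) :=
    ((hJ.differentiable (by simp)) (x - ζ)).hasFDerivAt
  exact (hasFDerivAt_comp_sub ζ).2 h1

theorem fderiv_integral_translate [IsFiniteMeasure P]
    (hJ : ContDiff ℝ ∞ J) (hc : HasCompactSupport J) :
    fderiv ℝ (fun w => ∫ ζ, J (w - ζ) ∂P) = fun w => ∫ ζ, fderiv ℝ J (w - ζ) ∂P :=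
  funext fun w => (hasFDerivAt_integral_translate hJ hc w).fderiv

theorem contDiff_fderiv_of_contDiff_infty (hJ : ContDiff ℝ ∞ J) : ContDiff ℝ ∞ (fderiv ℝ J) :=
  hJ.fderiv_right (by simp)

theorem contDiff_integral_translate [IsFiniteMeasure P]
    (hJ : ContDiff ℝ ∞ J) (hc : HasCompactSupport J) :
    ContDiff ℝ ∞ fun w => ∫ ζ, J (w - ζ) ∂P := by
  rw [contDiff_infty]
  intro n
  induction n generalizing F with
  | zero =>
    rw [Nat.cast_zero, contDiff_zero]
    exact continuous_iff_continuousAt.2 fun w =>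
      (hasFDerivAt_integral_translate hJ hc w).continuousAt
  | succ n ih =>
    rw [Nat.cast_succ, contDiff_succ_iff_fderiv]
    refine ⟨fun w => (hasFDerivAt_integral_translate hJ hc w).differentiableAt, by simp, ?_⟩
    rw [fderiv_integral_translate hJ hc]
    exact ih (contDiff_fderiv_of_contDiff_infty hJ) (hc.fderiv ℝ)

end Translates

theorem laplacian_integral_translate {J : ℂ → ℝ} {P : Measure ℂ} [IsFiniteMeasure P]
    (hJ : ContDiff ℝ ∞ J) (hc : HasCompactSupport J) (w : ℂ) :
    Laplacian.laplacian (fun w => ∫ ζ, J (w - ζ) ∂P) w =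
      ∫ ζ, Laplacian.laplacian J (w - ζ) ∂P := by
  have hJ1 := contDiff_fderiv_of_contDiff_infty hJ
  have hJ2 := contDiff_fderiv_of_contDiff_infty hJ1
  have hc1 := hc.fderiv ℝ
  have hint := integrable_translate (P := P) hJ2.continuous (hc1.fderiv ℝ) w
  have key : ∀ v : ℂ, (∫ ζ, fderiv ℝ (fderiv ℝ J) (w - ζ) ∂P) v v =
      ∫ ζ, fderiv ℝ (fderiv ℝ J) (w - ζ) v v ∂P := fun v => by
    rw [ContinuousLinearMap.integral_apply hint,
      ContinuousLinearMap.integral_apply (hint.apply_continuousLinearMap v)]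
  simp_rw [laplacian_eq_fderiv]
  rw [fderiv_integral_translate hJ hc, fderiv_integral_translate hJ1 hc1, key, key, integral_add]
  · exact (hint.apply_continuousLinearMap _).apply_continuousLinearMap _
  · exact (hint.apply_continuousLinearMap _).apply_continuousLinearMap _

theorem laplacian_comp_sub (J : ℂ → ℝ) (w z : ℂ) :
    Laplacian.laplacian (fun w => J (w - z)) w = Laplacian.laplacian J (w - z) := by
  have h : fderiv ℝ (fun w => J (w - z)) = fun w => fderiv ℝ J (w - z) :=
    funext fun w => fderiv_comp_sub z
  simp_rw [laplacian_eq_fderiv]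
  rw [h, fderiv_comp_sub (f := fderiv ℝ J) z]

theorem exists_smooth_cutoff {a b : ℝ} (ha : 0 < a) (hab : a < b) :
    ∃ ψ : ℂ → ℝ, ContDiff ℝ ∞ ψ ∧ HasCompactSupport ψ ∧ tsupport ψ ⊆ Metric.ball 0 b ∧
      ∀ w ∈ Metric.closedBall 0 a, ψ w = 1 := by
  let ψ : ContDiffBump (0 : ℂ) := ⟨a, (a + b) / 2, ha, by linarith⟩
  refine ⟨ψ, ψ.contDiff, ψ.hasCompactSupport, ?_, fun w hw => ψ.one_of_mem_closedBall hw⟩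
  rw [ψ.tsupport_eq]
  exact Metric.closedBall_subset_ball (by change (a + b) / 2 < b; linarith)

theorem laplacian_congr {f g : ℂ → ℝ} {D : Set ℂ} (hD : IsOpen D) (h : ∀ w ∈ D, f w = g w)
    {w : ℂ} (hw : w ∈ D) : Laplacian.laplacian f w = Laplacian.laplacian g w := by
  have h1 : f =ᶠ[nhds w] g := Filter.eventuallyEq_of_mem (hD.mem_nhds hw) h
  simp_rw [laplacian_eq_fderiv]
  rw [h1.fderiv.fderiv_eq]

/-- The Riesz measure tested against a smooth function which vanishes near the boundary. -/
theorem IsSubharmonicOn.setIntegral_eq {u : ℂ → EReal} {Ω : Set ℂ} {μ : Measure ℂ}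
    (hu : IsSubharmonicOn u Ω) (hΩ : IsOpen Ω) (hconn : IsPreconnected Ω)
    (hne : ∃ z ∈ Ω, u z ≠ ⊥) (hμ : IsRieszMeasure u Ω μ) {R' R₁ C : ℝ} (hR' : 0 < R')
    (hR : R' < R₁) (hΩR : Metric.closedBall 0 R₁ ⊆ Ω) (huC : ∀ z ∈ Metric.ball 0 R₁, u z ≤ C)
    {G : ℂ → ℝ} (hG : ContDiff ℝ ∞ G) (hG0 : ∀ w ∈ Metric.ball 0 R₁, R' < ‖w‖ → G w = 0) :
    ∫ w in Metric.ball 0 R₁, G w ∂μ = -((2 * Real.pi)⁻¹ *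
      ∫ w, (deficit u (Metric.ball 0 R₁) C w).toReal * Laplacian.laplacian G w) := by
  obtain ⟨ψ, hψ, hψc, hψs, hψ1⟩ := exists_smooth_cutoff hR' hR
  have hs : tsupport (fun w => ψ w * G w) ⊆ Metric.ball 0 R₁ := tsupport_mul_subset_left.trans hψs
  have hsm : ContDiff ℝ ∞ fun w => ψ w * G w := hψ.mul hG
  have hcs : HasCompactSupport fun w => ψ w * G w := hψc.mul_right
  have hball : Metric.ball (0 : ℂ) R₁ ⊆ Metric.closedBall 0 R₁ := Metric.ball_subset_closedBall
  have heq : ∀ w ∈ Metric.ball 0 R₁, ψ w * G w = G w := fun w hw => by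
    rcases le_or_gt ‖w‖ R' with h | h
    · rw [hψ1 w (by simpa using h), one_mul]
    · rw [hG0 w hw h, mul_zero]
  have h1 := hμ.integral_eq _ hsm hcs (hs.trans (hball.trans hΩR))
  rw [(hu.integral_laplacian_eq hΩ hconn hne (isCompact_closedBall 0 R₁) hΩR Metric.isOpen_ball
    hball huC hsm hcs hs).2, mul_neg] at h1
  rw [← setIntegral_eq_integral_of_forall_compl_eq_zero (s := Metric.ball 0 R₁) fun w hw =>
    image_eq_zero_of_notMem_tsupport fun h => hw (hs h)] at h1
  rw [← setIntegral_congr_fun Metric.isOpen_ball.measurableSet heq, h1]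
  congr 3
  ext w
  by_cases hw : w ∈ Metric.ball 0 R₁
  · rw [laplacian_congr Metric.isOpen_ball heq hw]
  · simp [deficit, indicator_of_notMem hw]

end

end DeltaSubharmonic

namespace DeltaSubharmonic

noncomputable section

/-! ### The Poisson–Jensen formula for mollified kernels -/

theorem hasCompactSupport_molKernel {ε : ℝ} (hε : 0 < ε) :
    HasCompactSupport fun w : ℂ => molKernel ε ‖w‖ :=
  HasCompactSupport.intro (isCompact_closedBall 0 ε) fun w hw =>
    molKernel_of_gt hε (by simpa using hw)

theorem continuous_integral_translate {J : ℂ → ℝ} {P : Measure ℂ} [IsFiniteMeasure P]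
    (hJ : Continuous J) (hc : HasCompactSupport J) : Continuous fun w => ∫ ζ, J (w - ζ) ∂P := by
  obtain ⟨C, hC⟩ := hc.exists_bound_of_continuous hJ
  exact continuous_of_dominated (bound := fun _ => C)
    (fun w => (integrable_translate hJ hc w).aestronglyMeasurable)
    (fun w => Filter.Eventually.of_forall fun ζ => hC _) (integrable_const C)
    (Filter.Eventually.of_forall fun ζ => by fun_prop)

theorem lintegral_mul_molKernel (f : ℂ → ℝ≥0∞) (ε : ℝ) (z : ℂ) :
    ∫⁻ w, f w * ENNReal.ofReal (molKernel ε ‖w - z‖) = ENNReal.ofReal (2 * Real.pi) * moll f ε z := by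
  rw [moll, ENNReal.mul_div_cancel ofReal_two_pi_ne_zero ENNReal.ofReal_ne_top]

theorem measurable_moll {f : ℂ → ℝ≥0∞} (hf : Measurable f) (ε : ℝ) : Measurable (moll f ε) := by
  refine Measurable.div_const (Measurable.lintegral_prod_right' (f := fun p : ℂ × ℂ =>
    f p.2 * ENNReal.ofReal (molKernel ε ‖p.2 - p.1‖)) ?_) _
  have := (continuous_molKernel ε).measurable
  fun_prop

section Mollified

variable {f : ℂ → ℝ≥0∞} {P : Measure ℂ} {ε : ℝ}

theorem exists_moll_le (hε : 0 < ε) (hfi : ∫⁻ w, f w ≠ ⊤) :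
    ∃ A : ℝ≥0∞, A ≠ ⊤ ∧ ∀ z, moll f ε z ≤ A := by
  obtain ⟨C, hC⟩ := (hasCompactSupport_molKernel hε).exists_bound_of_continuous
    ((continuous_molKernel ε).comp continuous_norm)
  refine ⟨(∫⁻ w, f w) * ENNReal.ofReal C / ENNReal.ofReal (2 * Real.pi),
    ENNReal.div_ne_top (ENNReal.mul_ne_top hfi ENNReal.ofReal_ne_top) ofReal_two_pi_ne_zero,
    fun z => ?_⟩
  rw [moll, ← lintegral_mul_const' _ _ ENNReal.ofReal_ne_top]
  gcongr with w
  exact (le_abs_self _).trans (hC (w - z))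

theorem integral_toReal_mul_molKernel (hε : 0 < ε) (hf : Measurable f) (hfi : ∫⁻ w, f w ≠ ⊤)
    (z : ℂ) : Integrable (fun w => (f w).toReal * molKernel ε ‖w - z‖) ∧
    ∫ w, (f w).toReal * molKernel ε ‖w - z‖ = 2 * Real.pi * (moll f ε z).toReal := by
  have hk := continuous_molKernel ε
  obtain ⟨C, hC⟩ := (hasCompactSupport_molKernel hε).exists_bound_of_continuous
    (hk.comp continuous_norm)
  refine ⟨integrable_toReal_mul hf hfi (by fun_prop) fun w => hC (w - z), ?_⟩
  rw [integral_toReal_mul hf hfi (Continuous.measurable (by fun_prop))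
    fun w => molKernel_nonneg _ _, lintegral_mul_molKernel, ENNReal.toReal_mul,
    ENNReal.toReal_ofReal (by positivity)]

theorem integral_toReal_mul_integral_molKernel [IsFiniteMeasure P] (hε : 0 < ε)
    (hf : Measurable f) (hfi : ∫⁻ w, f w ≠ ⊤) :
    Integrable (fun w => (f w).toReal * ∫ ζ, molKernel ε ‖w - ζ‖ ∂P) ∧
    ∫ w, (f w).toReal * ∫ ζ, molKernel ε ‖w - ζ‖ ∂P =
      2 * Real.pi * (∫⁻ ζ, moll f ε ζ ∂P).toReal := by
  have hk := continuous_molKernel ε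
  have hk' : Continuous fun w : ℂ => molKernel ε ‖w‖ := by fun_prop
  have hcs := hasCompactSupport_molKernel hε
  obtain ⟨C, hC⟩ := hcs.exists_bound_of_continuous hk'
  have hcont := continuous_integral_translate (P := P) hk' hcs
  have hm := measurable_ofReal_molKernel ε
  refine ⟨integrable_toReal_mul hf hfi hcont (K := C * P.real univ)
    fun w => norm_integral_le_of_norm_le_const (Filter.Eventually.of_forall fun ζ => hC _), ?_⟩
  rw [integral_toReal_mul hf hfi hcont.measurable
    fun w => integral_nonneg fun ζ => molKernel_nonneg _ _]
  have h1 : ∀ w, f w * ENNReal.ofReal (∫ ζ, molKernel ε ‖w - ζ‖ ∂P) =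
      ∫⁻ ζ, f w * ENNReal.ofReal (molKernel ε ‖w - ζ‖) ∂P := fun w => by
    rw [ofReal_integral_eq_lintegral_ofReal (integrable_translate hk' hcs w)
      (Filter.Eventually.of_forall fun ζ => molKernel_nonneg _ _), lintegral_const_mul]
    fun_prop
  simp_rw [h1]
  rw [lintegral_lintegral_swap (by fun_prop)]
  simp_rw [lintegral_mul_molKernel]
  rw [lintegral_const_mul _ (measurable_moll hf ε), ENNReal.toReal_mul,
    ENNReal.toReal_ofReal (by positivity)]

end Mollified

theorem toReal_lintegral_ofReal_sub_eq {D : Set ℂ} (hD : MeasurableSet D) {μ : Measure ℂ}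
    (hμ : μ D < ⊤) {g : ℂ → ℝ} (hg : Continuous g) {K : ℝ} (hK : ∀ w, |g w| ≤ K) {B : ℝ}
    (h0 : ∀ w ∈ D, g w ≤ B) :
    ∫⁻ w in D, ENNReal.ofReal (B - g w) ∂μ ≠ ⊤ ∧
    (∫⁻ w in D, ENNReal.ofReal (B - g w) ∂μ).toReal = B * μ.real D - ∫ w in D, g w ∂μ := by
  have : IsFiniteMeasure (μ.restrict D) := ⟨by simpa using hμ⟩
  have hgi : Integrable g (μ.restrict D) :=
    Integrable.of_bound hg.aestronglyMeasurable K (Filter.Eventually.of_forall hK)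
  have hsub : Integrable (fun w => B - g w) (μ.restrict D) := (integrable_const B).sub hgi
  rw [← ofReal_integral_eq_lintegral_ofReal hsub
    ((ae_restrict_iff' hD).2 (Filter.Eventually.of_forall fun w hw => sub_nonneg.2 (h0 w hw)))]
  refine ⟨ENNReal.ofReal_ne_top, ?_⟩
  rw [ENNReal.toReal_ofReal, integral_sub (integrable_const B) hgi]
  · simp [Measure.real, mul_comm]
  · exact setIntegral_nonneg hD fun w hw => sub_nonneg.2 (h0 w hw)

theorem moll_identity {f : ℂ → ℝ≥0∞} {μ P : Measure ℂ} [IsProbabilityMeasure P] {R R₁ ε : ℝ}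
    {z : ℂ} (hf : Measurable f) (hfi : ∫⁻ w, f w ≠ ⊤)
    (hf0 : ∀ w ∉ Metric.ball 0 R₁, f w = 0) (hμ : μ (Metric.ball 0 R₁) < ⊤)
    (htest : ∀ (R' : ℝ) (G : ℂ → ℝ), 0 < R' → R' < R₁ → ContDiff ℝ ∞ G →
      (∀ w ∈ Metric.ball 0 R₁, R' < ‖w‖ → G w = 0) →
      ∫ w in Metric.ball 0 R₁, G w ∂μ =
        -((2 * Real.pi)⁻¹ * ∫ w, (f w).toReal * Laplacian.laplacian G w))
    (hR : 0 < R) (hε : 0 < ε) (hR₁ : R + ε < R₁) (hz : z ∈ Metric.closedBall 0 R)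
    (hP : ∀ᵐ ζ ∂P, ζ ∈ Metric.closedBall 0 R)
    (hlog : ∀ w : ℂ, R < ‖w‖ → ∫ ζ, Real.log ‖w - ζ‖ ∂P = Real.log ‖w - z‖) :
    ∫⁻ w in Metric.ball 0 R₁, ENNReal.ofReal (Real.log (2 * R₁) - logMoll ε (w - z)) ∂μ +
        ∫⁻ ζ, moll f ε ζ ∂P =
      moll f ε z + ∫⁻ w in Metric.ball 0 R₁,
        ∫⁻ ζ, ENNReal.ofReal (Real.log (2 * R₁) - logMoll ε (w - ζ)) ∂P ∂μ := by
  set D : Set ℂ := Metric.ball 0 R₁ with hDdef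
  have hDm : MeasurableSet D := Metric.isOpen_ball.measurableSet
  obtain ⟨η, hη, hηc, -, hη1⟩ := exists_smooth_cutoff (a := 2 * R₁) (b := 2 * R₁ + 1)
    (by linarith) (by linarith)
  set J : ℂ → ℝ := fun x => η x * logMoll ε x with hJdef
  have hJ : ContDiff ℝ ∞ J := hη.mul (contDiff_logMoll ε)
  have hJc : HasCompactSupport J := hηc.mul_right
  obtain ⟨K, hK⟩ := hJc.exists_bound_of_continuous hJ.continuous
  have hclose : ∀ w ∈ D, ∀ ζ ∈ Metric.closedBall (0 : ℂ) R, ‖w - ζ‖ < 2 * R₁ := by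
    intro w hw ζ hζ
    have h1 : ‖w‖ < R₁ := by simpa [hDdef] using hw
    have h2 : ‖ζ‖ ≤ R := by simpa using hζ
    linarith [norm_sub_le w ζ]
  have hJeq : ∀ x : ℂ, ‖x‖ < 2 * R₁ → J x = logMoll ε x := fun x hx => by
    rw [hJdef]
    simp only [hη1 x (by simpa using hx.le), one_mul]
  have hJlap : ∀ x : ℂ, ‖x‖ < 2 * R₁ → Laplacian.laplacian J x = molKernel ε ‖x‖ := fun x hx => by
    rw [← laplacian_logMoll hε]
    exact laplacian_congr Metric.isOpen_ball (D := Metric.ball 0 (2 * R₁))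
      (fun y hy => hJeq y (by simpa using hy)) (by simpa using hx)
  have hJle : ∀ x : ℂ, ‖x‖ < 2 * R₁ → J x ≤ Real.log (2 * R₁) := fun x hx => by
    rw [hJeq x hx]
    exact logMoll_le hε (by linarith) hx.le
  set A : ℂ → ℝ := fun w => ∫ ζ, J (w - ζ) ∂P with hA
  have hAs : ContDiff ℝ ∞ A := contDiff_integral_translate hJ hJc
  have hAK : ∀ w, |A w| ≤ K := fun w => by
    simpa using norm_integral_le_of_norm_le_const (μ := P)
      (Filter.Eventually.of_forall fun ζ => hK (w - ζ))
  have hJz : ContDiff ℝ ∞ fun w => J (w - z) := hJ.comp (contDiff_id.sub contDiff_const)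
  have hAeq : ∀ w ∈ D, A w = ∫ ζ, logMoll ε (w - ζ) ∂P := fun w hw =>
    integral_congr_ae (hP.mono fun ζ hζ => hJeq _ (hclose w hw ζ hζ))
  have hAle : ∀ w ∈ D, A w ≤ Real.log (2 * R₁) := fun w hw => by
    have h1 : A w ≤ ∫ ζ, Real.log (2 * R₁) ∂P :=
      integral_mono_ae (integrable_translate hJ.continuous hJc w) (integrable_const _)
        (hP.mono fun ζ hζ => hJle _ (hclose w hw ζ hζ))
    simpa using h1
  have hfar : ∀ w : ℂ, R + ε < ‖w‖ → ∀ ζ ∈ Metric.closedBall (0 : ℂ) R,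
      logMoll ε (w - ζ) = Real.log ‖w - ζ‖ := fun w hw ζ hζ => by
    have h2 : ‖ζ‖ ≤ R := by simpa using hζ
    refine logMoll_of_le hε ?_
    linarith [norm_sub_norm_le w ζ]
  have hG0 : ∀ w ∈ D, R + ε < ‖w‖ → A w - J (w - z) = 0 := fun w hw hw' => by
    rw [hAeq w hw, hJeq _ (hclose w hw z hz), hfar w hw' z hz, sub_eq_zero,
      ← hlog w (by linarith)]
    exact integral_congr_ae (hP.mono fun ζ hζ => hfar w hw' ζ hζ)
  have hmain := htest (R + ε) (fun w => A w - J (w - z)) (by linarith) hR₁ (hAs.sub hJz) hG0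
  obtain ⟨hi1, he1⟩ := integral_toReal_mul_integral_molKernel (P := P) hε hf hfi
  obtain ⟨hi0, he0⟩ := integral_toReal_mul_molKernel hε hf hfi z
  have hlap : ∀ w, (f w).toReal * Laplacian.laplacian (fun w => A w - J (w - z)) w =
      (f w).toReal * (∫ ζ, molKernel ε ‖w - ζ‖ ∂P) - (f w).toReal * molKernel ε ‖w - z‖ := by
    intro w
    by_cases hw : w ∈ D
    · have h1 := (contDiff_infty.1 hAs 2).contDiffAt (x := w)
      have h2 := (contDiff_infty.1 hJz 2).contDiffAt (x := w)
      have h3 : Laplacian.laplacian (fun w => A w - J (w - z)) w =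
          Laplacian.laplacian A w - Laplacian.laplacian (fun w => J (w - z)) w :=
        h1.laplacian_sub h2
      rw [h3, ← mul_sub, laplacian_comp_sub, hA, laplacian_integral_translate hJ hJc,
        hJlap _ (hclose w hw z hz)]
      congr 2
      exact integral_congr_ae (hP.mono fun ζ hζ => hJlap _ (hclose w hw ζ hζ))
    · simp [hf0 w hw]
  simp_rw [hlap] at hmain
  rw [integral_sub hi1 hi0, he1, he0] at hmain
  have hfin : IsFiniteMeasure (μ.restrict D) := ⟨by simpa using hμ⟩
  have hbd : ∀ g : ℂ → ℝ, Continuous g → (∀ w, |g w| ≤ K) → Integrable g (μ.restrict D) :=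
    fun g hg hgK => Integrable.of_bound hg.aestronglyMeasurable K (Filter.Eventually.of_forall hgK)
  rw [integral_sub (hbd _ hAs.continuous hAK) (hbd _ hJz.continuous fun w => hK _)] at hmain
  obtain ⟨hzt, hze⟩ := toReal_lintegral_ofReal_sub_eq hDm hμ hJz.continuous (K := K)
    (fun w => hK _) (B := Real.log (2 * R₁)) fun w hw => hJle _ (hclose w hw z hz)
  obtain ⟨hAt, hAe⟩ := toReal_lintegral_ofReal_sub_eq hDm hμ hAs.continuous (K := K)
    hAK (B := Real.log (2 * R₁)) hAle
  have hz' : ∫⁻ w in D, ENNReal.ofReal (Real.log (2 * R₁) - logMoll ε (w - z)) ∂μ =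
      ∫⁻ w in D, ENNReal.ofReal (Real.log (2 * R₁) - J (w - z)) ∂μ :=
    setLIntegral_congr_fun hDm fun w hw => by
      rw [hJeq _ (hclose w hw z hz)]
  have hA' : ∫⁻ w in D, ∫⁻ ζ, ENNReal.ofReal (Real.log (2 * R₁) - logMoll ε (w - ζ)) ∂P ∂μ =
      ∫⁻ w in D, ENNReal.ofReal (Real.log (2 * R₁) - A w) ∂μ :=
    setLIntegral_congr_fun hDm fun w hw => by
      have h1 := integrable_translate (P := P) hJ.continuous hJc w
      have h2 : Real.log (2 * R₁) - A w = ∫ ζ, (Real.log (2 * R₁) - J (w - ζ)) ∂P := by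
        rw [integral_sub (integrable_const _) h1]
        simp [hA]
      have h3 : Integrable (fun ζ => Real.log (2 * R₁) - J (w - ζ)) P :=
        (integrable_const _).sub h1
      rw [h2, ofReal_integral_eq_lintegral_ofReal h3
        (hP.mono fun ζ hζ => sub_nonneg.2 (hJle _ (hclose w hw ζ hζ)))]
      exact lintegral_congr_ae (hP.mono fun ζ hζ => by
        beta_reduce
        rw [hJeq _ (hclose w hw ζ hζ)])
  obtain ⟨Q, hQ, hmQ⟩ := exists_moll_le hε hfi
  have hmP : ∫⁻ ζ, moll f ε ζ ∂P ≠ ⊤ := by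
    refine ((lintegral_mono hmQ).trans_lt ?_).ne
    simpa using hQ.lt_top
  have hmz : moll f ε z ≠ ⊤ := ((hmQ z).trans_lt hQ.lt_top).ne
  rw [hz', hA', ← ENNReal.toReal_eq_toReal_iff' (ENNReal.add_ne_top.2 ⟨hzt, hmP⟩)
    (ENNReal.add_ne_top.2 ⟨hmz, hAt⟩), ENNReal.toReal_add hzt hmP, ENNReal.toReal_add hmz hAt,
    hze, hAe]
  have hpi : (2 * Real.pi)⁻¹ * (2 * Real.pi * (∫⁻ ζ, moll f ε ζ ∂P).toReal -
      2 * Real.pi * (moll f ε z).toReal) = (∫⁻ ζ, moll f ε ζ ∂P).toReal - (moll f ε z).toReal := by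
    have := Real.pi_pos
    field_simp
  rw [hpi] at hmain
  linarith

end

end DeltaSubharmonic

namespace DeltaSubharmonic

noncomputable section

/-! ### The Poisson–Jensen formula -/

theorem tendsto_lintegral_of_le_of_tendsto {α : Type*} [MeasurableSpace α] {ν : Measure α}
    {F : ℕ → α → ℝ≥0∞} {f : α → ℝ≥0∞} (hF : ∀ n, Measurable (F n))
    (hle : ∀ᶠ n in Filter.atTop, ∀ᵐ x ∂ν, F n x ≤ f x)
    (hlim : ∀ᵐ x ∂ν, Filter.Tendsto (fun n => F n x) Filter.atTop (nhds (f x))) :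
    Filter.Tendsto (fun n => ∫⁻ x, F n x ∂ν) Filter.atTop (nhds (∫⁻ x, f x ∂ν)) := by
  refine tendsto_of_le_liminf_of_limsup_le ?_ ?_
  · refine le_trans (le_of_eq ?_) (lintegral_liminf_le hF)
    exact lintegral_congr_ae (hlim.mono fun x hx => hx.liminf_eq.symm)
  · exact Filter.limsup_le_of_le (by isBoundedDefault) (hle.mono fun n hn => lintegral_mono_ae hn)

/-- `B - log ‖x‖`, with the value `∞` at the origin. -/
def logDeficit (B : ℝ) (x : ℂ) : ℝ≥0∞ :=
  if x = 0 then ⊤ else ENNReal.ofReal (B - Real.log ‖x‖)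

theorem logDeficit_of_ne {B : ℝ} {x : ℂ} (hx : x ≠ 0) :
    logDeficit B x = ENNReal.ofReal (B - Real.log ‖x‖) := if_neg hx

theorem measurable_logDeficit (B : ℝ) : Measurable (logDeficit B) :=
  Measurable.ite (measurableSet_singleton 0) measurable_const (by fun_prop)

theorem ofReal_sub_logMoll_le {ε : ℝ} (hε : 0 < ε) (B : ℝ) (x : ℂ) :
    ENNReal.ofReal (B - logMoll ε x) ≤ logDeficit B x := by
  rcases eq_or_ne x 0 with rfl | hx
  · simp [logDeficit]
  · rw [logDeficit_of_ne hx]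
    exact ENNReal.ofReal_le_ofReal (by linarith [log_norm_le_logMoll hε hx])

theorem tendsto_ofReal_sub_logMoll {ε : ℕ → ℝ} (hε : ∀ n, 0 < ε n)
    (hε0 : Filter.Tendsto ε Filter.atTop (nhds 0)) (B : ℝ) (x : ℂ) :
    Filter.Tendsto (fun n => ENNReal.ofReal (B - logMoll (ε n) x)) Filter.atTop
      (nhds (logDeficit B x)) := by
  rcases eq_or_ne x 0 with rfl | hx
  · have h1 : Filter.Tendsto (fun n => Real.log (ε n)) Filter.atTop Filter.atBot :=
      Real.tendsto_log_nhdsGT_zero.comp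
        (tendsto_nhdsWithin_iff.2 ⟨hε0, Filter.Eventually.of_forall hε⟩)
    have h2 : Filter.Tendsto (fun n => B - Real.log (ε n)) Filter.atTop Filter.atTop :=
      Filter.tendsto_atTop_add_const_left _ B (Filter.tendsto_neg_atBot_atTop.comp h1)
    rw [logDeficit, if_pos rfl]
    refine ENNReal.tendsto_ofReal_atTop.comp (Filter.tendsto_atTop_mono (fun n => ?_) h2)
    linarith [logMoll_le_log (hε n) (w := 0) (by simpa using (hε n).le)]
  · rw [logDeficit_of_ne hx]
    refine Filter.Tendsto.congr' ?_ tendsto_const_nhds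
    filter_upwards [hε0.eventually (gt_mem_nhds (norm_pos_iff.2 hx))] with n hn
    rw [logMoll_of_le (hε n) hn.le]

theorem IsSuperMean.tendsto_moll {f : ℂ → ℝ≥0∞} {D : Set ℂ} (hf : IsSuperMean f D) {ε : ℕ → ℝ}
    (hε : ∀ n, 0 < ε n) (hε0 : Filter.Tendsto ε Filter.atTop (nhds 0)) {z : ℂ}
    (hz : ∀ n, Metric.closedBall z (ε n) ⊆ D) :
    Filter.Tendsto (fun n => moll f (ε n) z) Filter.atTop (nhds (f z)) :=
  tendsto_of_le_liminf_of_limsup_le (hf.le_liminf_moll hε hε0 z)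
    (Filter.limsup_le_of_le (by isBoundedDefault)
      (Filter.Eventually.of_forall fun n => hf.moll_le (hε n) (hz n)))

theorem continuous_logMoll (ε : ℝ) : Continuous (logMoll ε) := (contDiff_logMoll ε).continuous

theorem potential_identity {f : ℂ → ℝ≥0∞} {μ P : Measure ℂ} [IsProbabilityMeasure P] {R R₁ : ℝ}
    {z : ℂ} (hf : IsSuperMean f (Metric.ball 0 R₁)) (hfi : ∫⁻ w, f w ≠ ⊤)
    (hf0 : ∀ w ∉ Metric.ball 0 R₁, f w = 0) (hμ : μ (Metric.ball 0 R₁) < ⊤)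
    (htest : ∀ (R' : ℝ) (G : ℂ → ℝ), 0 < R' → R' < R₁ → ContDiff ℝ ∞ G →
      (∀ w ∈ Metric.ball 0 R₁, R' < ‖w‖ → G w = 0) →
      ∫ w in Metric.ball 0 R₁, G w ∂μ =
        -((2 * Real.pi)⁻¹ * ∫ w, (f w).toReal * Laplacian.laplacian G w))
    (hR : 0 < R) (hR₁ : R < R₁) (hz : z ∈ Metric.closedBall 0 R)
    (hP : ∀ᵐ ζ ∂P, ζ ∈ Metric.closedBall 0 R)
    (hlog : ∀ w : ℂ, R < ‖w‖ → ∫ ζ, Real.log ‖w - ζ‖ ∂P = Real.log ‖w - z‖) :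
    ∫⁻ w in Metric.ball 0 R₁, logDeficit (Real.log (2 * R₁)) (w - z) ∂μ + ∫⁻ ζ, f ζ ∂P =
      f z + ∫⁻ w in Metric.ball 0 R₁,
        ∫⁻ ζ, logDeficit (Real.log (2 * R₁)) (w - ζ) ∂P ∂μ := by
  set ε : ℕ → ℝ := fun n => (R₁ - R) / 2 * (1 / 2) ^ n with hεdef
  have hgap : 0 < (R₁ - R) / 2 := by linarith
  have hε : ∀ n, 0 < ε n := fun n => by positivity
  have hεle : ∀ n, ε n ≤ (R₁ - R) / 2 := fun n =>
    mul_le_of_le_one_right hgap.le (pow_le_one₀ (by norm_num) (by norm_num))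
  have hε0 : Filter.Tendsto ε Filter.atTop (nhds 0) := by
    have := (tendsto_pow_atTop_nhds_zero_of_lt_one (r := (1 / 2 : ℝ)) (by norm_num)
      (by norm_num)).const_mul ((R₁ - R) / 2)
    rwa [mul_zero] at this
  have hsub : ∀ ζ ∈ Metric.closedBall (0 : ℂ) R, ∀ n,
      Metric.closedBall ζ (ε n) ⊆ Metric.ball 0 R₁ := fun ζ hζ n => by
    refine Metric.closedBall_subset_ball' ?_
    have := hεle n
    have := Metric.mem_closedBall.1 hζ
    linarith
  have hid : ∀ n, _ := fun n => moll_identity hf.measurable hfi hf0 hμ htest hR (hε n)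
    (by linarith [hεle n]) hz hP hlog
  have hL := fun n => (continuous_logMoll (ε n)).measurable
  have t1 : Filter.Tendsto (fun n => ∫⁻ w in Metric.ball 0 R₁,
      ENNReal.ofReal (Real.log (2 * R₁) - logMoll (ε n) (w - z)) ∂μ) Filter.atTop
      (nhds (∫⁻ w in Metric.ball 0 R₁, logDeficit (Real.log (2 * R₁)) (w - z) ∂μ)) :=
    tendsto_lintegral_of_le_of_tendsto (fun n => by have := hL n; fun_prop)
      (Filter.Eventually.of_forall fun n => Filter.Eventually.of_forall fun w =>
        ofReal_sub_logMoll_le (hε n) _ _)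
      (Filter.Eventually.of_forall fun w => tendsto_ofReal_sub_logMoll hε hε0 _ _)
  have t2 : Filter.Tendsto (fun n => ∫⁻ ζ, moll f (ε n) ζ ∂P) Filter.atTop
      (nhds (∫⁻ ζ, f ζ ∂P)) :=
    tendsto_lintegral_of_le_of_tendsto (fun n => measurable_moll hf.measurable _)
      (Filter.Eventually.of_forall fun n => hP.mono fun ζ hζ => hf.moll_le (hε n) (hsub ζ hζ n))
      (hP.mono fun ζ hζ => hf.tendsto_moll hε hε0 (hsub ζ hζ))
  have t3 := hf.tendsto_moll hε hε0 (hsub z hz)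
  have t4 : Filter.Tendsto (fun n => ∫⁻ w in Metric.ball 0 R₁,
      ∫⁻ ζ, ENNReal.ofReal (Real.log (2 * R₁) - logMoll (ε n) (w - ζ)) ∂P ∂μ) Filter.atTop
      (nhds (∫⁻ w in Metric.ball 0 R₁,
        ∫⁻ ζ, logDeficit (Real.log (2 * R₁)) (w - ζ) ∂P ∂μ)) := by
    refine tendsto_lintegral_of_le_of_tendsto (fun n => ?_)
      (Filter.Eventually.of_forall fun n => Filter.Eventually.of_forall fun w =>
        lintegral_mono fun ζ => ofReal_sub_logMoll_le (hε n) _ _)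
      (Filter.Eventually.of_forall fun w => ?_)
    · refine Measurable.lintegral_prod_right' (f := fun p : ℂ × ℂ =>
        ENNReal.ofReal (Real.log (2 * R₁) - logMoll (ε n) (p.1 - p.2))) ?_
      have := hL n
      fun_prop
    · exact tendsto_lintegral_of_le_of_tendsto (fun n => by have := hL n; fun_prop)
        (Filter.Eventually.of_forall fun n => Filter.Eventually.of_forall fun ζ =>
          ofReal_sub_logMoll_le (hε n) _ _)
        (Filter.Eventually.of_forall fun ζ => tendsto_ofReal_sub_logMoll hε hε0 _ _)
  exact tendsto_nhds_unique (t1.add t2) ((t3.add t4).congr fun n => (hid n).symm)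

end

end DeltaSubharmonic

namespace DeltaSubharmonic

noncomputable section

/-! ### The Poisson measure of a disc -/

section Poisson

variable {R : ℝ} {z : ℂ}

theorem norm_circleMap_sub_ge (hR : 0 < R) (z : ℂ) (θ : ℝ) : R - ‖z‖ ≤ ‖circleMap 0 R θ - z‖ := by
  have h := norm_sub_norm_le (circleMap 0 R θ) z
  rwa [norm_circleMap_zero, abs_of_pos hR] at h

theorem poissonKernel_circleMap (hR : 0 < R) (z : ℂ) (θ : ℝ) :
    poissonKernel 0 z (circleMap 0 R θ) = (R ^ 2 - ‖z‖ ^ 2) / ‖circleMap 0 R θ - z‖ ^ 2 := by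
  rw [poissonKernel_def, sub_zero, sub_zero, norm_circleMap_zero, abs_of_pos hR]

theorem poissonKernel_circleMap_le (hz : ‖z‖ < R) (θ : ℝ) :
    poissonKernel 0 z (circleMap 0 R θ) ≤ (R + ‖z‖) / (R - ‖z‖) := by
  have hR : 0 < R := (norm_nonneg z).trans_lt hz
  have h1 := norm_circleMap_sub_ge hR z θ
  have h2 : 0 < R - ‖z‖ := sub_pos.2 hz
  have h4 := norm_nonneg z
  rw [poissonKernel_circleMap hR, div_le_div_iff₀ (by have := h2.trans_le h1; positivity) h2]
  have h3 : (R - ‖z‖) ^ 2 ≤ ‖circleMap 0 R θ - z‖ ^ 2 := by gcongr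
  nlinarith [mul_le_mul_of_nonneg_left h3 (by linarith : 0 ≤ R + ‖z‖)]

theorem le_poissonKernel_circleMap (hz : ‖z‖ < R) (θ : ℝ) :
    (R - ‖z‖) / (R + ‖z‖) ≤ poissonKernel 0 z (circleMap 0 R θ) := by
  have hR : 0 < R := (norm_nonneg z).trans_lt hz
  have h0 := norm_circleMap_sub_ge hR z θ
  have h1 := norm_sub_le (circleMap 0 R θ) z
  rw [norm_circleMap_zero, abs_of_pos hR] at h1
  have h2 : 0 < R - ‖z‖ := sub_pos.2 hz
  have h4 := norm_nonneg z
  rw [poissonKernel_circleMap hR, div_le_div_iff₀ (by linarith)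
    (by have := h2.trans_le h0; positivity)]
  have h3 : ‖circleMap 0 R θ - z‖ ^ 2 ≤ (R + ‖z‖) ^ 2 := by gcongr
  nlinarith [mul_le_mul_of_nonneg_left h3 h2.le]

theorem poissonKernel_circleMap_nonneg (hz : ‖z‖ < R) (θ : ℝ) :
    0 ≤ poissonKernel 0 z (circleMap 0 R θ) :=
  (div_nonneg (sub_nonneg.2 hz.le) (by have := norm_nonneg z; linarith)).trans
    (le_poissonKernel_circleMap hz θ)

variable (R z) in
theorem measurable_poissonKernel_circleMap :
    Measurable fun θ => poissonKernel 0 z (circleMap 0 R θ) := by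
  have h := (continuous_circleMap 0 R).measurable
  simp_rw [poissonKernel_def]
  fun_prop

variable (R z) in
/-- The density of the Poisson measure in the angular variable. -/
def poissonDensity (θ : ℝ) : ℝ≥0∞ :=
  ENNReal.ofReal (poissonKernel 0 z (circleMap 0 R θ) / (2 * Real.pi))

variable (R z) in
theorem measurable_poissonDensity : Measurable (poissonDensity R z) :=
  ((measurable_poissonKernel_circleMap R z).div_const _).ennreal_ofReal

variable (R z) in
/-- The harmonic measure of the disc of radius `R`, seen from `z`. -/
def poissonMeasure : Measure ℂ :=
  ((volume.restrict (Ioc 0 (2 * Real.pi))).withDensity (poissonDensity R z)).map (circleMap 0 R)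

theorem lintegral_poissonMeasure {g : ℂ → ℝ≥0∞} (hg : Measurable g) :
    ∫⁻ ζ, g ζ ∂poissonMeasure R z =
      ∫⁻ θ in Ioc 0 (2 * Real.pi), poissonDensity R z θ * g (circleMap 0 R θ) := by
  have h := (continuous_circleMap 0 R).measurable
  rw [poissonMeasure, lintegral_map hg h]
  exact lintegral_withDensity_eq_lintegral_mul _ (measurable_poissonDensity R z) (hg.comp h)

theorem lintegral_poissonMeasure_le (g : ℂ → ℝ≥0∞) :
    ∫⁻ ζ, g ζ ∂poissonMeasure R z ≤
      ∫⁻ θ in Ioc 0 (2 * Real.pi), poissonDensity R z θ * g (circleMap 0 R θ) :=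
  (lintegral_map_le _ _).trans
    (lintegral_withDensity_le_lintegral_mul _ (measurable_poissonDensity R z) _)

theorem ae_poissonMeasure (hR : 0 < R) : ∀ᵐ ζ ∂poissonMeasure R z, ζ ∈ Metric.sphere 0 R := by
  refine (ae_map_iff (p := fun ζ => ζ ∈ Metric.sphere 0 R)
    (continuous_circleMap 0 R).aemeasurable Metric.isClosed_sphere.measurableSet).2 ?_
  exact Filter.Eventually.of_forall fun θ => circleMap_mem_sphere 0 hR.le θ

theorem integral_poissonMeasure (hz : ‖z‖ < R) {g : ℂ → ℝ} (hg : Measurable g) :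
    ∫ ζ, g ζ ∂poissonMeasure R z = Real.circleAverage (poissonKernel 0 z • g) 0 R := by
  have h := (continuous_circleMap 0 R).measurable
  rw [poissonMeasure, integral_map h.aemeasurable hg.aestronglyMeasurable,
    integral_withDensity_eq_integral_toReal_smul (measurable_poissonDensity R z)
      (Filter.Eventually.of_forall fun θ => ENNReal.ofReal_lt_top),
    Real.circleAverage_def, intervalIntegral.integral_of_le (by positivity), ← integral_smul]
  refine integral_congr_ae (Filter.Eventually.of_forall fun θ => ?_)
  have h1 := poissonKernel_circleMap_nonneg hz θ
  simp only [poissonDensity, smul_eq_mul, Pi.smul_apply']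
  rw [ENNReal.toReal_ofReal (by positivity)]
  ring

theorem integral_poissonMeasure_of_harmonic (hz : ‖z‖ < R) {g : ℂ → ℝ} (hg : Measurable g)
    (hharm : ∀ ζ ∈ Metric.closedBall (0 : ℂ) R, InnerProductSpace.HarmonicAt g ζ) :
    ∫ ζ, g ζ ∂poissonMeasure R z = g z := by
  rw [integral_poissonMeasure hz hg]
  exact InnerProductSpace.HarmonicOnNhd.circleAverage_poissonKernel_smul hharm (by simpa using hz)

theorem isProbabilityMeasure_poissonMeasure (hz : ‖z‖ < R) :
    IsProbabilityMeasure (poissonMeasure R z) := by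
  have h1 := integral_poissonMeasure_of_harmonic hz (g := fun _ => 1) measurable_const
    fun ζ _ => InnerProductSpace.harmonicAt_const 1
  have h2 : (poissonMeasure R z).real univ = 1 := by simpa using h1
  refine ⟨?_⟩
  rw [Measure.real, ENNReal.toReal_eq_one_iff] at h2
  exact h2

theorem harmonicAt_log_norm_sub {w ζ : ℂ} (h : w ≠ ζ) :
    InnerProductSpace.HarmonicAt (fun ζ => Real.log ‖w - ζ‖) ζ :=
  AnalyticAt.harmonicAt_log_norm (by fun_prop) (sub_ne_zero.2 h)

theorem integral_log_poissonMeasure_of_gt (hz : ‖z‖ < R) {w : ℂ} (hw : R < ‖w‖) :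
    ∫ ζ, Real.log ‖w - ζ‖ ∂poissonMeasure R z = Real.log ‖w - z‖ := by
  refine integral_poissonMeasure_of_harmonic hz (g := fun ζ => Real.log ‖w - ζ‖) (by fun_prop)
    fun ζ hζ => harmonicAt_log_norm_sub ?_
  rintro rfl
  exact absurd hw (by simpa using hζ)

/-- The identity expressing that `(w, z)` and its reflection have proportional distances. -/
theorem norm_sq_sub_conj_mul (R : ℝ) (w z : ℂ) :
    ‖(R : ℂ) ^ 2 - starRingEnd ℂ w * z‖ ^ 2 =
      R ^ 2 * ‖w - z‖ ^ 2 + (R ^ 2 - ‖w‖ ^ 2) * (R ^ 2 - ‖z‖ ^ 2) := by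
  simp only [← Complex.normSq_eq_norm_sq, Complex.normSq_apply]
  simp [pow_two]
  ring

theorem norm_sub_conj_mul_of_norm_eq (hR : 0 < R) (w : ℂ) {ζ : ℂ} (hζ : ‖ζ‖ = R) :
    ‖(R : ℂ) ^ 2 - starRingEnd ℂ w * ζ‖ = R * ‖w - ζ‖ := by
  have h := norm_sq_sub_conj_mul R w ζ
  rw [hζ, sub_self, mul_zero, add_zero, ← mul_pow] at h
  exact (pow_left_inj₀ (norm_nonneg _) (by positivity) two_ne_zero).1 h

theorem norm_sub_conj_mul_pos (hR : 0 < R) {w ζ : ℂ} (hw : ‖w‖ < R) (hζ : ‖ζ‖ ≤ R) :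
    (R : ℂ) ^ 2 - starRingEnd ℂ w * ζ ≠ 0 := by
  intro h
  have h1 : (R : ℂ) ^ 2 = starRingEnd ℂ w * ζ := sub_eq_zero.1 h
  have h2 : R ^ 2 = ‖w‖ * ‖ζ‖ := by
    have := congrArg norm h1
    simpa [abs_of_pos hR] using this
  nlinarith [norm_nonneg w, norm_nonneg ζ]

theorem integral_log_poissonMeasure_of_lt (hz : ‖z‖ < R) {w : ℂ} (hw : ‖w‖ < R) :
    ∫ ζ, Real.log ‖w - ζ‖ ∂poissonMeasure R z =
      Real.log (‖(R : ℂ) ^ 2 - starRingEnd ℂ w * z‖ / R) := by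
  have hR : 0 < R := (norm_nonneg z).trans_lt hz
  have hprob := isProbabilityMeasure_poissonMeasure hz
  have h1 := integral_poissonMeasure_of_harmonic hz
    (g := fun ζ => Real.log ‖((R : ℂ) ^ 2 - starRingEnd ℂ w * ζ) / R‖) (by fun_prop)
    fun ζ hζ => AnalyticAt.harmonicAt_log_norm (by fun_prop)
      (div_ne_zero (norm_sub_conj_mul_pos hR hw (by simpa using hζ)) (by exact_mod_cast hR.ne'))
  simp only [norm_div, Complex.norm_real, Real.norm_eq_abs, abs_of_pos hR] at h1
  rw [← h1]
  refine integral_congr_ae ((ae_poissonMeasure hR).mono fun ζ hζ => ?_)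
  beta_reduce
  rw [norm_sub_conj_mul_of_norm_eq hR w (by simpa using hζ), mul_div_cancel_left₀ _ hR.ne']

end Poisson

end

end DeltaSubharmonic

namespace DeltaSubharmonic

noncomputable section

/-! ### Logarithmic potential of the Poisson measure and the Green function -/

section Green

variable {R R₁ : ℝ} {z w : ℂ}

theorem lintegral_logDeficit_of_norm_ne (hz : ‖z‖ < R) (hR₁ : R < R₁) (hw : ‖w‖ ≠ R)
    (hwR : ‖w‖ < R₁) :
    ∫⁻ ζ, logDeficit (Real.log (2 * R₁)) (w - ζ) ∂poissonMeasure R z =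
      ENNReal.ofReal (Real.log (2 * R₁) - ∫ ζ, Real.log ‖w - ζ‖ ∂poissonMeasure R z) := by
  have hR : 0 < R := (norm_nonneg z).trans_lt hz
  have hprob := isProbabilityMeasure_poissonMeasure hz
  have hne : ∀ ζ ∈ Metric.sphere (0 : ℂ) R, w - ζ ≠ 0 := fun ζ hζ h => by
    rw [sub_eq_zero.1 h] at hw
    exact hw (by simpa using hζ)
  have hcont : ContinuousOn (fun ζ => Real.log ‖w - ζ‖) (Metric.sphere (0 : ℂ) R) :=
    ContinuousOn.log (by fun_prop) fun ζ hζ => norm_ne_zero_iff.2 (hne ζ hζ)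
  obtain ⟨C, hC⟩ := (isCompact_sphere (0 : ℂ) R).exists_bound_of_continuousOn hcont
  have hmeas : Measurable fun ζ => Real.log ‖w - ζ‖ := by fun_prop
  have hint : Integrable (fun ζ => Real.log ‖w - ζ‖) (poissonMeasure R z) :=
    Integrable.of_bound hmeas.aestronglyMeasurable C ((ae_poissonMeasure hR).mono hC)
  have hsub : Integrable (fun ζ => Real.log (2 * R₁) - Real.log ‖w - ζ‖) (poissonMeasure R z) :=
    (integrable_const _).sub hint
  have h1 : Real.log (2 * R₁) - ∫ ζ, Real.log ‖w - ζ‖ ∂poissonMeasure R z =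
      ∫ ζ, (Real.log (2 * R₁) - Real.log ‖w - ζ‖) ∂poissonMeasure R z := by
    rw [integral_sub (integrable_const _) hint]
    simp
  rw [h1, ofReal_integral_eq_lintegral_ofReal hsub]
  · exact lintegral_congr_ae ((ae_poissonMeasure hR).mono fun ζ hζ => logDeficit_of_ne (hne ζ hζ))
  · refine (ae_poissonMeasure hR).mono fun ζ hζ => sub_nonneg.2 ?_
    refine Real.log_le_log (norm_pos_iff.2 (hne ζ hζ)) ?_
    have h2 : ‖ζ‖ = R := by simpa using hζ
    linarith [norm_sub_le w ζ]

theorem norm_sub_le_norm_smul_sub {ζ : ℂ} {s : ℝ} (hs : 1 ≤ s) (h : ‖ζ‖ ≤ ‖w‖) :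
    ‖w - ζ‖ ≤ ‖s • w - ζ‖ := by
  refine (sq_le_sq₀ (norm_nonneg _) (norm_nonneg _)).1 ?_
  rw [norm_sub_sq_real, norm_sub_sq_real, norm_smul, inner_smul_left, Real.norm_of_nonneg
    (by linarith)]
  have h1 : inner ℝ w ζ ≤ ‖w‖ ^ 2 := by
    nlinarith [real_inner_le_norm w ζ, norm_nonneg w, norm_nonneg ζ]
  simp only [conj_trivial]
  nlinarith [mul_nonneg (sub_nonneg.2 hs) (sub_nonneg.2 hs), sq_nonneg ‖w‖]

theorem logDeficit_anti {B : ℝ} {x y : ℂ} (h : ‖x‖ ≤ ‖y‖) : logDeficit B y ≤ logDeficit B x := by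
  rcases eq_or_ne x 0 with rfl | hx
  · simp [logDeficit]
  · have hx' := norm_pos_iff.2 hx
    rw [logDeficit_of_ne hx, logDeficit_of_ne (norm_pos_iff.1 (hx'.trans_le h))]
    exact ENNReal.ofReal_le_ofReal (sub_le_sub_left (Real.log_le_log hx' h) _)

theorem continuous_logDeficit (B : ℝ) : Continuous (logDeficit B) := by
  refine continuous_iff_continuousAt.2 fun x => ?_
  rcases eq_or_ne x 0 with rfl | hx
  · rw [ContinuousAt, show logDeficit B 0 = ⊤ from if_pos rfl, ENNReal.tendsto_nhds_top_iff_nnreal]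
    intro x
    have hδ : 0 < Real.exp (B - x - 1) := Real.exp_pos _
    filter_upwards [Metric.ball_mem_nhds 0 hδ] with y hy
    have h1 : ‖y‖ ≤ ‖(Real.exp (B - x - 1) : ℂ)‖ := by
      rw [Complex.norm_real, Real.norm_of_nonneg hδ.le]
      exact (by simpa using hy : ‖y‖ < _).le
    refine lt_of_lt_of_le ?_ (logDeficit_anti h1)
    rw [logDeficit_of_ne (by exact_mod_cast hδ.ne'), Complex.norm_real,
      Real.norm_of_nonneg hδ.le, Real.log_exp, ← ENNReal.ofReal_coe_nnreal,
      ENNReal.ofReal_lt_ofReal_iff (by linarith [x.2])]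
    linarith
  · have h1 : ContinuousAt (fun x : ℂ => ENNReal.ofReal (B - Real.log ‖x‖)) x :=
      ENNReal.continuous_ofReal.continuousAt.comp
        (continuousAt_const.sub (continuous_norm.continuousAt.log (norm_ne_zero_iff.2 hx)))
    refine h1.congr ?_
    filter_upwards [isOpen_ne.mem_nhds hx] with y hy using (logDeficit_of_ne hy).symm

theorem lintegral_logDeficit_of_ge (hz : ‖z‖ < R) (hR₁ : R < R₁) (hw : R ≤ ‖w‖)
    (hwR : ‖w‖ < R₁) :
    ∫⁻ ζ, logDeficit (Real.log (2 * R₁)) (w - ζ) ∂poissonMeasure R z =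
      logDeficit (Real.log (2 * R₁)) (w - z) := by
  have hgt : ∀ w : ℂ, R < ‖w‖ → ‖w‖ < R₁ →
      ∫⁻ ζ, logDeficit (Real.log (2 * R₁)) (w - ζ) ∂poissonMeasure R z =
      logDeficit (Real.log (2 * R₁)) (w - z) := fun w hw hwR => by
    rw [lintegral_logDeficit_of_norm_ne hz hR₁ hw.ne' hwR,
      integral_log_poissonMeasure_of_gt hz hw, logDeficit_of_ne]
    rintro h
    rw [sub_eq_zero.1 h] at hw
    linarith
  have hR : 0 < R := (norm_nonneg z).trans_lt hz
  have hw0 : 0 < ‖w‖ := hR.trans_le hw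
  set s : ℕ → ℝ := fun n => 1 + 1 / ((n : ℝ) + 1) with hs
  have hs1 : ∀ n, 1 < s n := fun n => by
    simp only [hs]
    have : 0 < 1 / ((n : ℝ) + 1) := by positivity
    linarith
  have hslim : Filter.Tendsto s Filter.atTop (nhds 1) := by
    have := (tendsto_one_div_add_atTop_nhds_zero_nat (𝕜 := ℝ)).const_add 1
    rwa [add_zero] at this
  have hlim : ∀ ζ : ℂ, Filter.Tendsto (fun n => logDeficit (Real.log (2 * R₁)) (s n • w - ζ))
      Filter.atTop (nhds (logDeficit (Real.log (2 * R₁)) (w - ζ))) := fun ζ => by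
    refine (continuous_logDeficit _).continuousAt.tendsto.comp ?_
    have := (hslim.smul_const w).sub_const ζ
    rwa [one_smul] at this
  have t1 := tendsto_lintegral_of_le_of_tendsto (ν := poissonMeasure R z)
    (F := fun n ζ => logDeficit (Real.log (2 * R₁)) (s n • w - ζ))
    (f := fun ζ => logDeficit (Real.log (2 * R₁)) (w - ζ))
    (fun n => (measurable_logDeficit _).comp (by fun_prop))
    (Filter.Eventually.of_forall fun n => (ae_poissonMeasure hR).mono fun ζ hζ =>
      logDeficit_anti (norm_sub_le_norm_smul_sub (hs1 n).le
        ((by simpa using hζ : ‖ζ‖ = R).trans_le hw)))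
    (Filter.Eventually.of_forall hlim)
  refine tendsto_nhds_unique t1 ((hlim z).congr' ?_)
  have h3 : Filter.Tendsto (fun n => s n * ‖w‖) Filter.atTop (nhds (1 * ‖w‖)) :=
    hslim.mul_const _
  rw [one_mul] at h3
  filter_upwards [h3.eventually (gt_mem_nhds hwR)] with n hn
  have h4 : ‖s n • w‖ = s n * ‖w‖ := by
    rw [norm_smul, Real.norm_of_nonneg (by linarith [hs1 n])]
  refine (hgt _ ?_ (by rwa [h4])).symm
  rw [h4]
  nlinarith [hs1 n]

/-- The Green function of the disc of radius `R`. -/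
def green (R : ℝ) (z w : ℂ) : ℝ≥0∞ :=
  if w = z then ⊤ else
    ENNReal.ofReal (Real.log (‖(R : ℂ) ^ 2 - starRingEnd ℂ w * z‖ / (R * ‖w - z‖)))

theorem green_le_greenKernel (hR : 0 < R) (hz : ‖z‖ < R) (hw : ‖w‖ ≤ R) :
    green R z w ≤ greenKernel R ‖z‖ ‖w‖ := by
  by_cases hn : ‖z‖ = ‖w‖
  · simp [greenKernel, hn]
  have hne : w ≠ z := fun h => hn (by rw [h])
  rw [green, if_neg hne, greenKernel, if_neg hn]
  have hd : 0 < ‖w - z‖ := norm_pos_iff.2 (sub_ne_zero.2 hne)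
  have hd' : 0 < |‖z‖ - ‖w‖| := abs_pos.2 (sub_ne_zero.2 hn)
  have hle : |‖z‖ - ‖w‖| ≤ ‖w - z‖ := by
    rw [abs_sub_comm]
    exact abs_norm_sub_norm_le w z
  have hz0 := norm_nonneg z
  have hw0 := norm_nonneg w
  have hzw : 0 < R ^ 2 - ‖z‖ * ‖w‖ := by nlinarith
  have h1 : ‖(R : ℂ) ^ 2 - starRingEnd ℂ w * z‖ * |‖z‖ - ‖w‖| ≤
      (R ^ 2 - ‖z‖ * ‖w‖) * ‖w - z‖ := by
    refine (sq_le_sq₀ (by positivity) (by positivity)).1 ?_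
    rw [mul_pow, mul_pow, norm_sq_sub_conj_mul, sq_abs]
    have h2 : (‖z‖ - ‖w‖) ^ 2 ≤ ‖w - z‖ ^ 2 := by
      rw [← sq_abs]
      gcongr
    have h3 : 0 ≤ (R ^ 2 - ‖w‖ ^ 2) * (R ^ 2 - ‖z‖ ^ 2) :=
      mul_nonneg (by nlinarith) (by nlinarith)
    nlinarith [mul_le_mul_of_nonneg_left h2 h3]
  have h4 : 0 < ‖(R : ℂ) ^ 2 - starRingEnd ℂ w * z‖ := by
    refine norm_pos_iff.2 fun h => ?_
    have h5 := norm_sq_sub_conj_mul R w z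
    rw [h, norm_zero] at h5
    have h3 : 0 ≤ (R ^ 2 - ‖w‖ ^ 2) * (R ^ 2 - ‖z‖ ^ 2) :=
      mul_nonneg (by nlinarith) (by nlinarith)
    have : 0 < R ^ 2 * ‖w - z‖ ^ 2 := by positivity
    linarith
  refine ENNReal.ofReal_le_ofReal (Real.log_le_log (by positivity) ?_)
  rw [div_le_div_iff₀ (by positivity) (by positivity)]
  nlinarith [mul_le_mul_of_nonneg_left h1 hR.le]

theorem lintegral_logDeficit_add_green (hz : ‖z‖ < R) (hR₁ : R < R₁) (hw : ‖w‖ ≤ R) :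
    logDeficit (Real.log (2 * R₁)) (w - z) =
      ∫⁻ ζ, logDeficit (Real.log (2 * R₁)) (w - ζ) ∂poissonMeasure R z + green R z w := by
  have hR : 0 < R := (norm_nonneg z).trans_lt hz
  rcases eq_or_ne w z with rfl | hne
  · simp [logDeficit, green]
  have hd : 0 < ‖w - z‖ := norm_pos_iff.2 (sub_ne_zero.2 hne)
  rcases hw.eq_or_lt with heq | hlt
  · rw [lintegral_logDeficit_of_ge hz hR₁ heq.ge (by linarith), green, if_neg hne]
    have h1 : ‖(R : ℂ) ^ 2 - starRingEnd ℂ w * z‖ = R * ‖w - z‖ := by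
      have h := norm_sq_sub_conj_mul R w z
      rw [heq, sub_self, zero_mul, add_zero, ← mul_pow] at h
      exact (pow_left_inj₀ (norm_nonneg _) (by positivity) two_ne_zero).1 h
    rw [h1, div_self (by positivity)]
    simp
  · rw [lintegral_logDeficit_of_norm_ne hz hR₁ hlt.ne (by linarith),
      integral_log_poissonMeasure_of_lt hz hlt, green, if_neg hne,
      logDeficit_of_ne (sub_ne_zero.2 hne)]
    set q := ‖(R : ℂ) ^ 2 - starRingEnd ℂ w * z‖ with hq
    have hq0 : 0 < q := norm_pos_iff.2 (norm_sub_conj_mul_pos hR hlt hz.le)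
    have hq1 : q ≤ 2 * R₁ * R := by
      have h1 : q ≤ R ^ 2 + ‖w‖ * ‖z‖ := by
        have := norm_sub_le ((R : ℂ) ^ 2) (starRingEnd ℂ w * z)
        simpa [abs_of_pos hR] using this
      nlinarith [norm_nonneg w, norm_nonneg z]
    have hq2 : R * ‖w - z‖ ≤ q := by
      refine (sq_le_sq₀ (by positivity) (norm_nonneg _)).1 ?_
      rw [mul_pow, norm_sq_sub_conj_mul]
      have h3 : 0 ≤ (R ^ 2 - ‖w‖ ^ 2) * (R ^ 2 - ‖z‖ ^ 2) :=
        mul_nonneg (by nlinarith [norm_nonneg w]) (by nlinarith [norm_nonneg z])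
      linarith
    rw [← ENNReal.ofReal_add]
    · congr 1
      rw [Real.log_div hq0.ne' hR.ne', Real.log_div hq0.ne' (by positivity),
        Real.log_mul hR.ne' hd.ne']
      ring
    · rw [sub_nonneg]
      refine Real.log_le_log (by positivity) ?_
      rwa [div_le_iff₀ hR]
    · refine Real.log_nonneg ?_
      rwa [le_div_iff₀ (by positivity), one_mul]

theorem lintegral_logDeficit_le (hz : ‖z‖ < R) (hR₁ : R < R₁) (hwR : ‖w‖ < R₁) :
    ∫⁻ ζ, logDeficit (Real.log (2 * R₁)) (w - ζ) ∂poissonMeasure R z ≤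
      ENNReal.ofReal (Real.log (2 * R₁) - Real.log (R - ‖z‖)) := by
  have hR : 0 < R := (norm_nonneg z).trans_lt hz
  have hpos : 0 < R - ‖z‖ := sub_pos.2 hz
  rcases lt_or_ge ‖w‖ R with hlt | hge
  · rw [lintegral_logDeficit_of_norm_ne hz hR₁ hlt.ne hwR,
      integral_log_poissonMeasure_of_lt hz hlt]
    refine ENNReal.ofReal_le_ofReal (sub_le_sub_left (Real.log_le_log hpos ?_) _)
    rw [le_div_iff₀ hR]
    have := norm_sub_norm_le ((R : ℂ) ^ 2) (starRingEnd ℂ w * z)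
    simp only [norm_pow, Complex.norm_real, Real.norm_eq_abs, abs_of_pos hR, norm_mul,
      RCLike.norm_conj] at this
    nlinarith [norm_nonneg z]
  · rw [lintegral_logDeficit_of_ge hz hR₁ hge hwR]
    have h1 : R - ‖z‖ ≤ ‖w - z‖ := by linarith [norm_sub_norm_le w z]
    rw [logDeficit_of_ne (norm_pos_iff.1 (hpos.trans_le h1))]
    exact ENNReal.ofReal_le_ofReal (sub_le_sub_left (Real.log_le_log hpos h1) _)

end Green

end

end DeltaSubharmonic

namespace DeltaSubharmonic

noncomputable section

theorem measurable_lintegral_logDeficit {P : Measure ℂ} [SFinite P] (B : ℝ) :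
    Measurable fun w => ∫⁻ ζ, logDeficit B (w - ζ) ∂P := by
  refine Measurable.lintegral_prod_right' (f := fun p : ℂ × ℂ => logDeficit B (p.1 - p.2)) ?_
  have := measurable_logDeficit B
  fun_prop

/-- The Poisson–Jensen formula. -/
theorem IsSubharmonicOn.poisson_jensen {u : ℂ → EReal} {Ω : Set ℂ} {μ : Measure ℂ}
    (hu : IsSubharmonicOn u Ω) (hΩ : IsOpen Ω) (hconn : IsPreconnected Ω)
    (hne : ∃ z ∈ Ω, u z ≠ ⊥) (hμ : IsRieszMeasure u Ω μ) {R R₁ C : ℝ} (hR : R < R₁)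
    (hΩR : Metric.closedBall 0 R₁ ⊆ Ω) (hC : 0 ≤ C) (huC : ∀ z ∈ Metric.ball 0 R₁, u z ≤ C)
    {z : ℂ} (hz : ‖z‖ < R) :
    deficit u (Metric.ball 0 R₁) C z =
      ∫⁻ ζ, deficit u (Metric.ball 0 R₁) C ζ ∂poissonMeasure R z +
        ∫⁻ w in Metric.closedBall 0 R, green R z w ∂μ := by
  have hR0 : 0 < R := (norm_nonneg z).trans_lt hz
  have hprob := isProbabilityMeasure_poissonMeasure hz
  have hball : Metric.ball (0 : ℂ) R₁ ⊆ Metric.closedBall 0 R₁ := Metric.ball_subset_closedBall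
  have hμD : μ (Metric.ball 0 R₁) < ⊤ := (measure_mono hball).trans_lt
    (hμ.finite_on_compacts _ hΩR (isCompact_closedBall 0 R₁))
  have hf := hu.isSuperMean_deficit Metric.isOpen_ball (hball.trans hΩR) hC huC
  have hfi := (hu.lintegral_deficit_lt_top hΩ hconn hne (isCompact_closedBall 0 R₁) hΩR
    Metric.isOpen_ball.measurableSet hball C).ne
  have hid := potential_identity (P := poissonMeasure R z) hf hfi
    (fun w hw => indicator_of_notMem hw _) hμD
    (fun R' G h1 h2 hG hG0 => hu.setIntegral_eq hΩ hconn hne hμ h1 h2 hΩR huC hG hG0) hR0 hR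
    (by simpa using hz.le) ((ae_poissonMeasure hR0).mono fun ζ hζ =>
      Metric.sphere_subset_closedBall hζ) fun w hw => integral_log_poissonMeasure_of_gt hz hw
  set pot : ℂ → ℝ≥0∞ := fun w =>
    ∫⁻ ζ, logDeficit (Real.log (2 * R₁)) (w - ζ) ∂poissonMeasure R z with hpot
  have hpt : ∀ w ∈ Metric.ball (0 : ℂ) R₁, logDeficit (Real.log (2 * R₁)) (w - z) =
      pot w + (Metric.closedBall (0 : ℂ) R).indicator (green R z) w := fun w hw => by
    by_cases hwR : w ∈ Metric.closedBall (0 : ℂ) R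
    · rw [indicator_of_mem hwR]
      exact lintegral_logDeficit_add_green hz hR (by simpa using hwR)
    · rw [indicator_of_notMem hwR, add_zero]
      exact (lintegral_logDeficit_of_ge hz hR (by simpa using (not_le.1 (by simpa using hwR)).le)
        (by simpa using hw)).symm
  rw [setLIntegral_congr_fun Metric.isOpen_ball.measurableSet hpt,
    lintegral_add_left (measurable_lintegral_logDeficit _),
    lintegral_indicator Metric.isClosed_closedBall.measurableSet,
    Measure.restrict_restrict Metric.isClosed_closedBall.measurableSet,
    inter_eq_left.2 (Metric.closedBall_subset_ball hR), add_assoc, add_comm (deficit _ _ _ z)]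
    at hid
  have hfin : ∫⁻ w in Metric.ball 0 R₁, pot w ∂μ ≠ ⊤ := by
    refine ne_top_of_le_ne_top ?_ (setLIntegral_mono measurable_const fun w hw =>
      lintegral_logDeficit_le hz hR (by simpa using hw))
    rw [setLIntegral_const]
    exact ENNReal.mul_ne_top ENNReal.ofReal_ne_top hμD.ne
  rw [ENNReal.add_right_inj hfin] at hid
  rw [← hid, add_comm]

theorem restrict_le_add_restrict_sup_sub {α β : Measure ℂ} {s : Set ℂ} (hs : MeasurableSet s)
    (hβ : β s < ⊤) :
    α.restrict s ≤ β.restrict s + ((α ⊔ β) - β).restrict s := by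
  have h1 : IsFiniteMeasure (β.restrict s) := ⟨by simpa using hβ⟩
  rw [Measure.restrict_sub_eq_restrict_sub_restrict hs, add_comm,
    Measure.sub_add_cancel_of_le (Measure.restrict_mono subset_rfl le_sup_right)]
  exact Measure.restrict_mono subset_rfl le_sup_left

theorem sup_sub_apply_lt_top {α β : Measure ℂ} {s : Set ℂ} (hα : α s < ⊤) (hβ : β s < ⊤) :
    ((α ⊔ β) - β) s < ⊤ := by
  have h1 : (α ⊔ β) - β ≤ α + β :=
    Measure.sub_le.trans (sup_le (Measure.le_add_right le_rfl) (Measure.le_add_left le_rfl))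
  refine (h1 s).trans_lt ?_
  rw [Measure.add_apply]
  exact ENNReal.add_lt_top.2 ⟨hα, hβ⟩

theorem toENNReal_coe_sub (C x : ℝ) :
    ((C : EReal) - (x : EReal)).toENNReal = ENNReal.ofReal (C - x) := by
  rw [← EReal.coe_sub, EReal.toENNReal_of_ne_top (EReal.coe_ne_top _), EReal.toReal_coe]

section Delta

variable {U u v : ℂ → EReal} {Ω D : Set ℂ}

theorem IsDeltaSubharmonicOn.deficit_le_add (h : IsDeltaSubharmonicOn U u v Ω) (hD : D ⊆ Ω)
    {z : ℂ} (hz : z ∈ D) (C : ℝ) :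
    deficit v D C z ≤ deficit u D C z + (U z).toENNReal := by
  have hU := h.eq_sub z (hD hz)
  have hu := (h.subharmonic_left.lt_top z (hD hz)).ne
  have hv := (h.subharmonic_right.lt_top z (hD hz)).ne
  simp only [deficit, indicator_of_mem hz]
  generalize u z = x at *
  generalize v z = y at *
  induction x with
  | top => exact absurd rfl hu
  | bot => simp
  | coe x =>
    induction y with
    | top => exact absurd rfl hv
    | bot => rw [hU (Or.inl (EReal.coe_ne_bot x))]; simp
    | coe y =>
      rw [hU (Or.inl (EReal.coe_ne_bot x)), toENNReal_coe_sub, toENNReal_coe_sub,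
        toENNReal_coe_sub]
      refine le_trans (ENNReal.ofReal_le_ofReal (le_of_eq ?_)) ENNReal.ofReal_add_le
      ring

theorem IsDeltaSubharmonicOn.toENNReal_le_of_deficit_le (h : IsDeltaSubharmonicOn U u v Ω)
    (hD : D ⊆ Ω) {z : ℂ} (hz : z ∈ D) {C : ℝ} (huC : u z ≤ C) (hvz : v z ≠ ⊥) {X : ℝ≥0∞}
    (hX : deficit v D C z ≤ deficit u D C z + X) : (U z).toENNReal ≤ X := by
  have hU := h.eq_sub z (hD hz) (Or.inr hvz)
  have hu := (h.subharmonic_left.lt_top z (hD hz)).ne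
  have hv := (h.subharmonic_right.lt_top z (hD hz)).ne
  simp only [deficit, indicator_of_mem hz] at hX
  rw [hU]
  generalize u z = x at *
  generalize v z = y at *
  induction x with
  | top => exact absurd rfl hu
  | bot => simp
  | coe x =>
    induction y with
    | top => exact absurd rfl hv
    | bot => exact absurd rfl hvz
    | coe y =>
      rw [toENNReal_coe_sub] at hX ⊢
      rw [toENNReal_coe_sub] at hX
      have hxC : x ≤ C := by exact_mod_cast huC
      rcases le_total x y with hxy | hxy
      · rw [ENNReal.ofReal_of_nonpos (by linarith)]
        exact zero_le
      · have h1 : C - y = (C - x) + (x - y) := by ring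
        rw [h1, ENNReal.ofReal_add (by linarith) (by linarith)] at hX
        exact (ENNReal.add_le_add_iff_left ENNReal.ofReal_ne_top).1 hX

theorem IsDeltaSubharmonicOn.toENNReal_le_deficit (h : IsDeltaSubharmonicOn U u v Ω)
    (hD : D ⊆ Ω) {z : ℂ} (hz : z ∈ D) {C : ℝ} (huC : u z ≤ C) (hvz : v z ≠ ⊥) :
    (U z).toENNReal ≤ deficit v D C z :=
  h.toENNReal_le_of_deficit_le hD hz huC hvz le_add_self

theorem ne_bot_of_deficit_ne_top {z : ℂ} (hz : z ∈ D) {C : ℝ} (h : deficit v D C z ≠ ⊤) :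
    v z ≠ ⊥ := by
  intro hv
  rw [deficit, indicator_of_mem hz, hv] at h
  simp at h

end Delta

theorem lintegral_poissonMeasure_le_mul {R r : ℝ} {z : ℂ} (hz : ‖z‖ ≤ r) (hrR : r < R)
    (g : ℂ → ℝ≥0∞) :
    ∫⁻ ζ, g ζ ∂poissonMeasure R z ≤ ENNReal.ofReal ((R + r) / (R - r)) *
      ((∫⁻ θ in Ioc 0 (2 * Real.pi), g (circleMap 0 R θ)) / ENNReal.ofReal (2 * Real.pi)) := by
  refine (lintegral_poissonMeasure_le g).trans ?_
  rw [ENNReal.div_eq_inv_mul, ← mul_assoc,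
    ← lintegral_const_mul' _ _ (ENNReal.mul_ne_top ENNReal.ofReal_ne_top
      (ENNReal.inv_ne_top.2 ofReal_two_pi_ne_zero))]
  refine lintegral_mono fun θ => mul_le_mul_left ?_ _
  rw [poissonDensity, ENNReal.ofReal_div_of_pos (by positivity), div_eq_mul_inv]
  refine mul_le_mul_left (ENNReal.ofReal_le_ofReal ?_) _
  refine (poissonKernel_circleMap_le (hz.trans_lt hrR) θ).trans ?_
  have := norm_nonneg z
  rw [div_le_div_iff₀ (by linarith) (by linarith)]
  nlinarith

theorem lintegral_circle_le_mul {R : ℝ} {z : ℂ} (hz : ‖z‖ < R) {g : ℂ → ℝ≥0∞}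
    (hg : Measurable g) :
    ENNReal.ofReal ((R - ‖z‖) / (R + ‖z‖) / (2 * Real.pi)) *
      ∫⁻ θ in Ioc 0 (2 * Real.pi), g (circleMap 0 R θ) ≤ ∫⁻ ζ, g ζ ∂poissonMeasure R z := by
  rw [lintegral_poissonMeasure hg, ← lintegral_const_mul' _ _ ENNReal.ofReal_ne_top]
  refine lintegral_mono fun θ => mul_le_mul_left (ENNReal.ofReal_le_ofReal ?_) _
  gcongr
  exact le_poissonKernel_circleMap hz θ

end

end DeltaSubharmonic

namespace DeltaSubharmonic

noncomputable section

/-! ### Counting functions and measurability of the maximum characteristic -/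

theorem countingN_anti {μ : Measure ℂ} {r₀ r R : ℝ} (h : r₀ ≤ r) :
    countingN μ r R ≤ countingN μ r₀ R :=
  lintegral_mono_set (Ioc_subset_Ioc_left h)

theorem countingN_lt_top {μ : Measure ℂ} {r R : ℝ} (hr : 0 < r)
    (hμ : μ (Metric.closedBall 0 R) < ⊤) : countingN μ r R < ⊤ := by
  refine (setLIntegral_mono measurable_const (g := fun _ =>
    μ (Metric.closedBall 0 R) / ENNReal.ofReal r) fun t ht => ?_).trans_lt ?_
  · exact ENNReal.div_le_div (measure_mono (Metric.closedBall_subset_closedBall ht.2))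
      (ENNReal.ofReal_le_ofReal ht.1.le)
  · rw [setLIntegral_const, Real.volume_Ioc]
    exact ENNReal.mul_lt_top (ENNReal.div_lt_top hμ.ne (ENNReal.ofReal_pos.2 hr).ne')
      ENNReal.ofReal_lt_top

theorem lintegral_lintegral_greenKernel_le {ν : Measure ℝ} [IsFiniteMeasure ν] {μ : Measure ℂ}
    {r R : ℝ} {K : ℝ≥0∞} (hr : 0 < r) (hrR : r < R) (hKt : K ≠ ⊤)
    (hK : ∀ s ∈ Icc 0 R,
      ∫⁻ t, greenKernel R t s ∂ν ≤ K * ENNReal.ofReal (Real.log (R / max s r)))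
    (hμ : μ (Metric.closedBall 0 R) < ⊤) :
    ∫⁻ t, ∫⁻ w in Metric.closedBall 0 R, greenKernel R t ‖w‖ ∂μ ∂ν ≤ K * countingN μ r R := by
  have : IsFiniteMeasure (μ.restrict (Metric.closedBall 0 R)) := ⟨by simpa using hμ⟩
  have hm : Measurable fun p : ℝ × ℂ => greenKernel R p.1 ‖p.2‖ :=
    (measurable_greenKernel R).comp (measurable_fst.prodMk measurable_snd.norm)
  rw [lintegral_lintegral_swap hm.aemeasurable]
  refine le_trans ?_ (mul_le_mul_right (lintegral_log_le_countingN hr hrR hμ) K)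
  rw [← lintegral_const_mul' _ _ hKt]
  exact setLIntegral_mono' Metric.isClosed_closedBall.measurableSet fun w hw =>
    hK ‖w‖ ⟨norm_nonneg w, by simpa using hw⟩

theorem lt_sub_iff_exists_rat {c x y : EReal} (hx : x ≠ ⊤) (hy : y ≠ ⊤) :
    c < x - y ↔ ∃ q : ℚ, (((q : ℝ) : EReal) ≤ x) ∧ y < ((q : ℝ) : EReal) - c := by
  induction x with
  | top => exact absurd rfl hx
  | bot => simp
  | coe x =>
    induction y with
    | top => exact absurd rfl hy
    | bot =>
      induction c with
      | top => simp
      | bot =>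
        simp only [EReal.coe_sub_bot, bot_lt_top, and_true, true_iff, EReal.coe_le_coe_iff]
        obtain ⟨q, hq⟩ := exists_rat_lt x
        exact ⟨q, hq.le⟩
      | coe c =>
        simp only [EReal.coe_sub_bot, EReal.coe_lt_top, true_iff, EReal.coe_le_coe_iff,
          ← EReal.coe_sub, EReal.bot_lt_coe, and_true]
        obtain ⟨q, hq⟩ := exists_rat_lt x
        exact ⟨q, hq.le⟩
    | coe y =>
      induction c with
      | top => simp
      | bot =>
        simp only [← EReal.coe_sub, EReal.bot_lt_coe, EReal.coe_sub_bot, EReal.coe_lt_top,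
          and_true, true_iff, EReal.coe_le_coe_iff]
        obtain ⟨q, hq⟩ := exists_rat_lt x
        exact ⟨q, hq.le⟩
      | coe c =>
        simp only [← EReal.coe_sub, EReal.coe_lt_coe_iff, EReal.coe_le_coe_iff]
        constructor
        · intro h
          obtain ⟨q, hq1, hq2⟩ := exists_rat_btwn (show c + y < x by linarith)
          exact ⟨q, hq2.le, by linarith⟩
        · rintro ⟨q, hq1, hq2⟩
          linarith

theorem measurableSet_image_norm_inter {K O : Set ℂ} (hK : IsCompact K) (hO : IsOpen O) :
    MeasurableSet (norm '' (K ∩ O)) := by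
  obtain ⟨F, hF, -, hFO, -⟩ := hO.exists_iUnion_isClosed
  rw [← hFO, inter_iUnion, image_iUnion]
  exact MeasurableSet.iUnion fun n =>
    ((hK.inter_right (hF n)).image continuous_norm).isClosed.measurableSet

theorem isOpen_setOf_lt {v : ℂ → EReal} {Ω : Set ℂ} (hΩ : IsOpen Ω)
    (hv : UpperSemicontinuousOn v Ω) (y : EReal) : IsOpen {z | z ∈ Ω ∧ v z < y} := by
  rw [isOpen_iff_mem_nhds]
  rintro z ⟨hz, hzy⟩
  have h1 := hv z hz y hzy
  rw [hΩ.nhdsWithin_eq hz] at h1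
  filter_upwards [hΩ.mem_nhds hz, h1] with w hw hw' using ⟨hw, hw'⟩

theorem isCompact_setOf_le {u : ℂ → EReal} {Ω K : Set ℂ} (hΩ : IsOpen Ω)
    (hu : UpperSemicontinuousOn u Ω) (hK : IsCompact K) (hKΩ : K ⊆ Ω) (y : EReal) :
    IsCompact {z | z ∈ K ∧ y ≤ u z} := by
  have h1 : {z | z ∈ K ∧ y ≤ u z} = K \ {z | z ∈ Ω ∧ u z < y} := by
    ext z
    simp only [mem_ofPred_eq, mem_sdiff, not_and, not_lt]
    exact ⟨fun h => ⟨h.1, fun _ => h.2⟩, fun h => ⟨h.1, h.2 (hKΩ h.1)⟩⟩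
  rw [h1]
  exact hK.diff (isOpen_setOf_lt hΩ hu y)

/-- The supremum of a difference of upper semicontinuous functions over the circles in a disc. -/
theorem measurable_iSup_circle_sub {u v : ℂ → EReal} {Ω : Set ℂ} (hΩ : IsOpen Ω)
    (hu : UpperSemicontinuousOn u Ω) (hv : UpperSemicontinuousOn v Ω)
    (hut : ∀ z ∈ Ω, u z < ⊤) (hvt : ∀ z ∈ Ω, v z < ⊤) {r : ℝ}
    (hr : Metric.closedBall 0 r ⊆ Ω) :
    Measurable fun t : ℝ => ⨆ z ∈ {z : ℂ | z ∈ Metric.closedBall 0 r ∧ ‖z‖ = t}, (u z - v z) := by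
  refine measurable_of_Ioi fun c => ?_
  have h1 : (fun t : ℝ => ⨆ z ∈ {z : ℂ | z ∈ Metric.closedBall 0 r ∧ ‖z‖ = t}, (u z - v z)) ⁻¹'
      Ioi c = ⋃ q : ℚ, norm '' ({z | z ∈ Metric.closedBall 0 r ∧ ((q : ℝ) : EReal) ≤ u z} ∩
        {z | z ∈ Ω ∧ v z < ((q : ℝ) : EReal) - c}) := by
    ext t
    simp only [mem_preimage, mem_Ioi, lt_iSup_iff, mem_iUnion, mem_image, mem_inter_iff,
      mem_ofPred_eq, exists_prop]
    constructor
    · rintro ⟨z, ⟨hz, rfl⟩, hc⟩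
      obtain ⟨q, hq1, hq2⟩ := (lt_sub_iff_exists_rat (hut z (hr hz)).ne (hvt z (hr hz)).ne).1 hc
      exact ⟨q, z, ⟨⟨hz, hq1⟩, hr hz, hq2⟩, rfl⟩
    · rintro ⟨q, z, ⟨⟨hz, hq1⟩, -, hq2⟩, rfl⟩
      exact ⟨z, ⟨hz, rfl⟩, (lt_sub_iff_exists_rat (hut z (hr hz)).ne (hvt z (hr hz)).ne).2
        ⟨q, hq1, hq2⟩⟩
  rw [h1]
  exact MeasurableSet.iUnion fun q => measurableSet_image_norm_inter
    (isCompact_setOf_le hΩ hu (isCompact_closedBall 0 r) hr _) (isOpen_setOf_lt hΩ hv _)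

theorem maxChar_eq_iSup (U : ℂ → EReal) {t : ℝ} (ht : 0 ≤ t) :
    maxChar U t = ⨆ z ∈ {z : ℂ | ‖z‖ = t}, U z := by
  refine le_antisymm (iSup₂_le fun θ hθ => ?_) (iSup₂_le fun z hz => ?_)
  · refine le_iSup₂_of_le (circleMap 0 t θ) ?_ le_rfl
    simp [abs_of_nonneg ht]
  · have h1 : z ∈ range (circleMap 0 t) := by
      rw [range_circleMap, abs_of_nonneg ht]
      simpa using hz
    obtain ⟨θ, rfl⟩ := h1
    obtain ⟨θ', hθ', h2⟩ := (periodic_circleMap 0 t).exists_mem_Ico₀ Real.two_pi_pos θ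
    rw [h2]
    exact le_iSup₂_of_le θ' hθ' le_rfl

end

end DeltaSubharmonic

namespace DeltaSubharmonic

noncomputable section

/-! ### Integrals of the maximum characteristic -/

section Main

variable {U u v : ℂ → EReal} {Ω : Set ℂ} {R : ℝ}

theorem IsDeltaSubharmonicOn.exists_radius (h : IsDeltaSubharmonicOn U u v Ω) (hR : 0 < R)
    (hΩ : Metric.closedBall 0 R ⊆ Ω) :
    ∃ R₁ C : ℝ, R < R₁ ∧ 0 ≤ C ∧ Metric.closedBall 0 R₁ ⊆ Ω ∧
      (∀ z ∈ Metric.ball 0 R₁, u z ≤ C) ∧ ∀ z ∈ Metric.ball 0 R₁, v z ≤ C := by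
  obtain ⟨δ, hδ, hδΩ⟩ := (isCompact_closedBall (0 : ℂ) R).exists_cthickening_subset_open
    h.isOpen hΩ
  rw [cthickening_closedBall hδ.le hR.le] at hδΩ
  obtain ⟨C, hC, huC⟩ := h.subharmonic_left.exists_le (isCompact_closedBall 0 (δ + R)) hδΩ
  obtain ⟨C', hC', hvC⟩ := h.subharmonic_right.exists_le (isCompact_closedBall 0 (δ + R)) hδΩ
  refine ⟨δ + R, max C C', by linarith, hC.trans (le_max_left _ _), hδΩ, fun z hz => ?_,
    fun z hz => ?_⟩
  · exact (huC z (Metric.ball_subset_closedBall hz)).trans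
      (EReal.coe_le_coe_iff.2 (le_max_left _ _))
  · exact (hvC z (Metric.ball_subset_closedBall hz)).trans
      (EReal.coe_le_coe_iff.2 (le_max_right _ _))

theorem IsSubharmonicOn.lintegral_circle_deficit_lt_top {μ : Measure ℂ}
    (hu : IsSubharmonicOn u Ω) (hΩ : IsOpen Ω) (hconn : IsPreconnected Ω)
    (hne : ∃ z ∈ Ω, u z ≠ ⊥) (hμ : IsRieszMeasure u Ω μ) {R₁ C : ℝ} (hR : 0 < R) (hR₁ : R < R₁)
    (hΩR : Metric.closedBall 0 R₁ ⊆ Ω) (hC : 0 ≤ C) (huC : ∀ z ∈ Metric.ball 0 R₁, u z ≤ C) :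
    ∫⁻ θ in Ioc 0 (2 * Real.pi), deficit u (Metric.ball 0 R₁) C (circleMap 0 R θ) < ⊤ := by
  have hball : Metric.ball (0 : ℂ) R₁ ⊆ Metric.closedBall 0 R₁ := Metric.ball_subset_closedBall
  have hm := (hu.isSuperMean_deficit Metric.isOpen_ball (hball.trans hΩR) hC huC).measurable
  have hfi := (hu.lintegral_deficit_lt_top hΩ hconn hne (isCompact_closedBall 0 R₁) hΩR
    Metric.isOpen_ball.measurableSet hball C).ne
  obtain ⟨z, hz, hzt⟩ : ∃ z ∈ Metric.ball (0 : ℂ) R, deficit u (Metric.ball 0 R₁) C z < ⊤ := by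
    by_contra! hcon
    have h0 : volume (Metric.ball (0 : ℂ) R) = 0 :=
      measure_mono_null (fun z hz => not_lt.2 (hcon z hz)) (ae_iff.1 (ae_lt_top hm hfi))
    exact (Metric.measure_ball_pos volume (0 : ℂ) hR).ne' h0
  have hz' : ‖z‖ < R := by simpa using hz
  have h1 := hu.poisson_jensen hΩ hconn hne hμ hR₁ hΩR hC huC hz'
  have h2 := (lintegral_circle_le_mul hz' hm).trans ((le_self_add.trans_eq h1.symm))
  have hpos : 0 < ENNReal.ofReal ((R - ‖z‖) / (R + ‖z‖) / (2 * Real.pi)) := by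
    refine ENNReal.ofReal_pos.2 (div_pos (div_pos (by linarith) ?_) (by positivity))
    linarith [norm_nonneg z]
  by_contra hcon
  rw [not_lt_top_iff.1 hcon, ENNReal.mul_top hpos.ne'] at h2
  exact (h2.trans_lt hzt).ne rfl

theorem IsSubharmonicOn.ne_bot_of_lintegral_greenKernel {μ : Measure ℂ}
    (hu : IsSubharmonicOn u Ω) (hΩ : IsOpen Ω) (hconn : IsPreconnected Ω)
    (hne : ∃ z ∈ Ω, u z ≠ ⊥) (hμ : IsRieszMeasure u Ω μ) {R₁ C : ℝ} (hR : 0 < R) (hR₁ : R < R₁)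
    (hΩR : Metric.closedBall 0 R₁ ⊆ Ω) (hC : 0 ≤ C) (huC : ∀ z ∈ Metric.ball 0 R₁, u z ≤ C)
    {z : ℂ} (hz : ‖z‖ < R)
    (hfin : ∫⁻ w in Metric.closedBall 0 R, greenKernel R ‖z‖ ‖w‖ ∂μ < ⊤) : u z ≠ ⊥ := by
  refine ne_bot_of_deficit_ne_top (D := Metric.ball 0 R₁) (C := C) (by simpa using hz.trans hR₁) ?_
  rw [hu.poisson_jensen hΩ hconn hne hμ hR₁ hΩR hC huC hz]
  refine ENNReal.add_ne_top.2 ⟨ne_top_of_le_ne_top ?_ (lintegral_poissonMeasure_le_mul le_rfl hz _),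
    ne_top_of_le_ne_top hfin.ne (setLIntegral_mono' Metric.isClosed_closedBall.measurableSet
      fun w hw => green_le_greenKernel hR hz (by simpa using hw))⟩
  exact ENNReal.mul_ne_top ENNReal.ofReal_ne_top (ENNReal.div_ne_top
    (hu.lintegral_circle_deficit_lt_top hΩ hconn hne hμ hR hR₁ hΩR hC huC).ne
    ofReal_two_pi_ne_zero)

theorem IsDeltaSubharmonicOn.deficit_le {R₁ C : ℝ} (h : IsDeltaSubharmonicOn U u v Ω)
    (hR₁ : R < R₁) (hΩR : Metric.closedBall 0 R₁ ⊆ Ω) (hC : 0 ≤ C)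
    (huC : ∀ z ∈ Metric.ball 0 R₁, u z ≤ C) (hvC : ∀ z ∈ Metric.ball 0 R₁, v z ≤ C)
    {z : ℂ} {r : ℝ} (hz : ‖z‖ ≤ r) (hrR : r < R) :
    deficit v (Metric.ball 0 R₁) C z ≤ deficit u (Metric.ball 0 R₁) C z +
      (ENNReal.ofReal ((R + r) / (R - r)) * circleMeanPos U 0 R +
        ∫⁻ w in Metric.closedBall 0 R, greenKernel R ‖z‖ ‖w‖ ∂rieszLowerVariation u v Ω) := by
  have hzR : ‖z‖ < R := hz.trans_lt hrR
  have hR : 0 < R := (norm_nonneg z).trans_lt hzR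
  have hcb : MeasurableSet (Metric.closedBall (0 : ℂ) R) := Metric.isClosed_closedBall.measurableSet
  have hball : Metric.ball (0 : ℂ) R₁ ⊆ Metric.closedBall 0 R₁ := Metric.ball_subset_closedBall
  have hΩ' : Metric.closedBall 0 R ⊆ Ω := (Metric.closedBall_subset_closedBall hR₁.le).trans hΩR
  have hμu := h.subharmonic_left.isRieszMeasure_rieszMeasure h.isOpen h.isPreconnected h.left_ne_bot
  have hμv :=
    h.subharmonic_right.isRieszMeasure_rieszMeasure h.isOpen h.isPreconnected h.right_ne_bot
  have hum := (h.subharmonic_left.isSuperMean_deficit Metric.isOpen_ball (hball.trans hΩR)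
    hC huC).measurable
  rw [h.subharmonic_right.poisson_jensen h.isOpen h.isPreconnected h.right_ne_bot hμv hR₁ hΩR hC
    hvC hzR, h.subharmonic_left.poisson_jensen h.isOpen h.isPreconnected h.left_ne_bot hμu hR₁ hΩR
    hC huC hzR]
  have h1 : ∫⁻ ζ, deficit v (Metric.ball 0 R₁) C ζ ∂poissonMeasure R z ≤
      ∫⁻ ζ, deficit u (Metric.ball 0 R₁) C ζ ∂poissonMeasure R z +
        ENNReal.ofReal ((R + r) / (R - r)) * circleMeanPos U 0 R := by
    calc _ ≤ ∫⁻ ζ, (deficit u (Metric.ball 0 R₁) C ζ + (U ζ).toENNReal) ∂poissonMeasure R z :=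
          lintegral_mono_ae ((ae_poissonMeasure hR).mono fun ζ hζ =>
            h.deficit_le_add (hball.trans hΩR)
              (by simpa [(by simpa using hζ : ‖ζ‖ = R)] using hR₁) C)
      _ ≤ _ := by
          rw [lintegral_add_left hum]
          gcongr
          exact lintegral_poissonMeasure_le_mul hz hrR _
  have h2 : ∫⁻ w in Metric.closedBall 0 R, green R z w ∂rieszMeasure v Ω ≤
      ∫⁻ w in Metric.closedBall 0 R, green R z w ∂rieszMeasure u Ω +
        ∫⁻ w in Metric.closedBall 0 R, greenKernel R ‖z‖ ‖w‖ ∂rieszLowerVariation u v Ω := by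
    calc _ ≤ ∫⁻ w, green R z w ∂((rieszMeasure u Ω).restrict (Metric.closedBall 0 R) +
          (rieszLowerVariation u v Ω).restrict (Metric.closedBall 0 R)) :=
          lintegral_mono' (restrict_le_add_restrict_sup_sub hcb
            (hμu.finite_on_compacts _ hΩ' (isCompact_closedBall 0 R))) le_rfl
      _ ≤ _ := by
          rw [lintegral_add_measure]
          exact add_le_add le_rfl (setLIntegral_mono' hcb fun w hw =>
            green_le_greenKernel hR hzR (by simpa using hw))
  calc _ ≤ _ := add_le_add h1 h2
    _ = _ := by ring

theorem IsDeltaSubharmonicOn.circleMeanPos_lt_top {R₁ C : ℝ} (h : IsDeltaSubharmonicOn U u v Ω)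
    (hR : 0 < R) (hR₁ : R < R₁) (hΩR : Metric.closedBall 0 R₁ ⊆ Ω) (hC : 0 ≤ C)
    (huC : ∀ z ∈ Metric.ball 0 R₁, u z ≤ C) (hvC : ∀ z ∈ Metric.ball 0 R₁, v z ≤ C) :
    circleMeanPos U 0 R < ⊤ := by
  have hball : Metric.ball (0 : ℂ) R₁ ⊆ Metric.closedBall 0 R₁ := Metric.ball_subset_closedBall
  have hμv :=
    h.subharmonic_right.isRieszMeasure_rieszMeasure h.isOpen h.isPreconnected h.right_ne_bot
  have hvm := (h.subharmonic_right.isSuperMean_deficit Metric.isOpen_ball (hball.trans hΩR)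
    hC hvC).measurable
  have hfin := h.subharmonic_right.lintegral_circle_deficit_lt_top h.isOpen h.isPreconnected
    h.right_ne_bot hμv hR hR₁ hΩR hC hvC
  have hmem : ∀ θ, circleMap 0 R θ ∈ Metric.ball (0 : ℂ) R₁ := fun θ => by
    simpa [abs_of_pos hR] using hR₁
  refine ENNReal.div_lt_top (ne_top_of_le_ne_top hfin.ne (lintegral_mono_ae ?_))
    ofReal_two_pi_ne_zero
  filter_upwards [ae_lt_top (hvm.comp (continuous_circleMap 0 R).measurable) hfin.ne] with θ hθ
  exact h.toENNReal_le_deficit (hball.trans hΩR) (hmem θ) (huC _ (hmem θ))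
    (ne_bot_of_deficit_ne_top (hmem θ) hθ.ne)

theorem IsDeltaSubharmonicOn.lintegral_maxChar_le (h : IsDeltaSubharmonicOn U u v Ω)
    {ν : Measure ℝ} [IsFiniteMeasure ν] {r : ℝ} {K : ℝ≥0∞} (hr : 0 < r) (hrR : r < R)
    (hΩ : Metric.closedBall 0 R ⊆ Ω) (hKt : K ≠ ⊤) (hsupp : ∀ᵐ t ∂ν, t ∈ Icc 0 r)
    (hK : ∀ s ∈ Icc 0 R,
      ∫⁻ t, greenKernel R t s ∂ν ≤ K * ENNReal.ofReal (Real.log (R / max s r)))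
    (hν : ENNReal.ofReal ((R + r) / (R - r)) * ν univ ≤ K) :
    AEMeasurable (fun t => (maxChar U t).toENNReal) ν ∧
    ∫⁻ t, (maxChar U t).toENNReal ∂ν < ⊤ ∧
    ∀ r₀ ∈ Icc 0 r, ∫⁻ t, (maxChar U t).toENNReal ∂ν ≤ K * nevanlinnaT U u v Ω r₀ R := by
  have hR : 0 < R := hr.trans hrR
  obtain ⟨R₁, C, hR₁, hC, hΩR, huC, hvC⟩ := h.exists_radius hR hΩ
  have hball : Metric.ball (0 : ℂ) R₁ ⊆ Metric.closedBall 0 R₁ := Metric.ball_subset_closedBall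
  have hμu := h.subharmonic_left.isRieszMeasure_rieszMeasure h.isOpen h.isPreconnected h.left_ne_bot
  have hμv :=
    h.subharmonic_right.isRieszMeasure_rieszMeasure h.isOpen h.isPreconnected h.right_ne_bot
  have hufin := hμu.finite_on_compacts _ hΩ (isCompact_closedBall 0 R)
  have hvfin := hμv.finite_on_compacts _ hΩ (isCompact_closedBall 0 R)
  have hΔfin : rieszLowerVariation u v Ω (Metric.closedBall 0 R) < ⊤ :=
    sup_sub_apply_lt_top hvfin hufin
  have hmeas : ∀ μ : Measure ℂ, μ (Metric.closedBall 0 R) < ⊤ → Measurable fun t : ℝ =>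
      ∫⁻ w in Metric.closedBall 0 R, greenKernel R t ‖w‖ ∂μ := fun μ hμ => by
    have : IsFiniteMeasure (μ.restrict (Metric.closedBall 0 R)) := ⟨by simpa using hμ⟩
    exact Measurable.lintegral_prod_right' (f := fun p : ℝ × ℂ => greenKernel R p.1 ‖p.2‖)
      ((measurable_greenKernel R).comp (measurable_fst.prodMk measurable_snd.norm))
  have hgood : ∀ᵐ t ∂ν, t ∈ Icc 0 r ∧ ∀ z : ℂ, ‖z‖ = t → v z ≠ ⊥ := by
    have h1 : ∫⁻ t, ∫⁻ w in Metric.closedBall 0 R, greenKernel R t ‖w‖ ∂rieszMeasure v Ω ∂ν ≠ ⊤ :=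
      ne_top_of_le_ne_top (ENNReal.mul_ne_top hKt (countingN_lt_top hr hvfin).ne)
        (lintegral_lintegral_greenKernel_le hr hrR hKt hK hvfin)
    filter_upwards [hsupp, ae_lt_top (hmeas _ hvfin) h1] with t ht htfin
    refine ⟨ht, ?_⟩
    rintro z rfl
    exact h.subharmonic_right.ne_bot_of_lintegral_greenKernel h.isOpen h.isPreconnected
      h.right_ne_bot hμv hR hR₁ hΩR hC hvC (ht.2.trans_lt hrR) htfin
  have hbound : ∀ᵐ t ∂ν, (maxChar U t).toENNReal ≤
      ENNReal.ofReal ((R + r) / (R - r)) * circleMeanPos U 0 R +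
        ∫⁻ w in Metric.closedBall 0 R, greenKernel R t ‖w‖ ∂rieszLowerVariation u v Ω := by
    filter_upwards [hgood] with t ht
    rw [maxChar_eq_iSup U ht.1.1]
    refine (EReal.toENNReal_le_toENNReal (iSup₂_le fun z hz => ?_)).trans_eq
      (EReal.toENNReal_coe)
    obtain rfl : ‖z‖ = t := hz
    have hzD : z ∈ Metric.ball (0 : ℂ) R₁ := by
      simpa using (ht.1.2.trans_lt hrR).trans hR₁
    have h1 := h.toENNReal_le_of_deficit_le (hball.trans hΩR) hzD (huC z hzD) (ht.2 z rfl)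
      (h.deficit_le hR₁ hΩR hC huC hvC ht.1.2 hrR)
    exact ((le_max_right 0 _).trans_eq EReal.coe_toENNReal_eq_max.symm).trans (EReal.coe_ennreal_le_coe_ennreal_iff.2 h1)
  have hle : ∫⁻ t, (maxChar U t).toENNReal ∂ν ≤ K * nevanlinnaT U u v Ω r R := by
    refine (lintegral_mono_ae hbound).trans ?_
    rw [lintegral_add_left measurable_const, lintegral_const, nevanlinnaT, mul_add]
    refine add_le_add ?_ (lintegral_lintegral_greenKernel_le hr hrR hKt hK hΔfin)
    rw [mul_right_comm]
    gcongr
  refine ⟨?_, hle.trans_lt (ENNReal.mul_lt_top hKt.lt_top (ENNReal.add_lt_top.2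
    ⟨h.circleMeanPos_lt_top hR hR₁ hΩR hC huC hvC, countingN_lt_top hr hΔfin⟩)),
    fun r₀ hr₀ => hle.trans ?_⟩
  · have hm := measurable_iSup_circle_sub h.isOpen h.subharmonic_left.usc h.subharmonic_right.usc
      h.subharmonic_left.lt_top h.subharmonic_right.lt_top
      ((Metric.closedBall_subset_closedBall hrR.le).trans hΩ)
    refine ⟨_, hm.ereal_toENNReal, ?_⟩
    filter_upwards [hgood] with t ht
    rw [maxChar_eq_iSup U ht.1.1]
    congr 1
    have hset : {z : ℂ | z ∈ Metric.closedBall 0 r ∧ ‖z‖ = t} = {z : ℂ | ‖z‖ = t} := by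
      ext z
      simp only [mem_ofPred_eq, mem_closedBall_zero_iff]
      exact ⟨fun hz => hz.2, fun hz => ⟨hz ▸ ht.1.2, hz⟩⟩
    change _ = ⨆ z ∈ {z : ℂ | z ∈ Metric.closedBall 0 r ∧ ‖z‖ = t}, (u z - v z)
    rw [hset]
    refine iSup_congr fun z => iSup_congr fun hz => ?_
    obtain rfl : ‖z‖ = t := hz
    exact h.eq_sub z (hΩ (by simpa using ht.1.2.trans hrR.le)) (Or.inr (ht.2 z rfl))
  · rw [nevanlinnaT, nevanlinnaT]
    gcongr
    exact countingN_anti hr₀.2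

end Main

end

end DeltaSubharmonic
theorem theorem1 (r : ℝ) (hr : 0 < r) (h : ℝ → ℝ)
    (h_nonneg : ∀ t ∈ Icc 0 r, 0 ≤ h t)
    (h_cont : ContinuousOn h (Icc 0 r))
    (h_zero : h 0 = 0)
    (h_diff : DifferentiableOn ℝ h (Ioo 0 r))
    -- the quotients `h(t) / (t h'(t))` are defined and their supremum is finite
    (h_deriv : ∀ t ∈ Ioo 0 r, deriv h t ≠ 0)
    (h_bdd : BddAbove ((fun t => h t / (t * deriv h t)) '' Ioo 0 r)) :
    StrictMonoOn h (Icc 0 r) ∧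
    ∀ (m : ℝ → ℝ) (hm : MonotoneOn m (Icc 0 r)),
      (∀ t ∈ Icc 0 r, DeltaSubharmonic.modulus m r t ≤ h t) →
      ∃ a ∈ Icc 0 r, h a = m r - m 0 ∧ (∀ b ∈ Icc 0 r, h b = m r - m 0 → b = a) ∧
        ∀ (R : ℝ), r < R → ∀ (U u v : ℂ → EReal) (Ω : Set ℂ), Metric.closedBall 0 R ⊆ Ω →
          DeltaSubharmonic.IsDeltaSubharmonicOn U u v Ω →
          AEMeasurable (fun t => (DeltaSubharmonic.maxChar U t).toENNReal)
            (DeltaSubharmonic.stieltjesMeasure m hr.le hm) ∧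
          ∫⁻ t, (DeltaSubharmonic.maxChar U t).toENNReal
            ∂(DeltaSubharmonic.stieltjesMeasure m hr.le hm) < ⊤ ∧
          ∀ r₀ ∈ Icc 0 r,
            ∫⁻ t, (DeltaSubharmonic.maxChar U t).toENNReal
                ∂(DeltaSubharmonic.stieltjesMeasure m hr.le hm) ≤
              ENNReal.ofReal (6 * R / (R - r)) * DeltaSubharmonic.nevanlinnaT U u v Ω r₀ R *
                ENNReal.ofReal ((m r - m 0) *
                  Real.log (4 * Real.exp (DeltaSubharmonic.sConst h r) * R / a)) := by
  have hpos := DeltaSubharmonic.deriv_pos_of_deriv_ne_zero hr h_nonneg h_cont h_zero h_diff h_deriv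
  have hmono := DeltaSubharmonic.strictMonoOn_of_deriv_ne_zero hr h_nonneg h_cont h_zero h_diff
    h_deriv
  have hS := DeltaSubharmonic.sConst_nonneg hr h_nonneg hpos h_bdd
  refine ⟨hmono, fun m hm hmod => ?_⟩
  obtain ⟨a, ha, hma⟩ := DeltaSubharmonic.exists_majorant_eq hr h_cont h_zero hm hmod
  refine ⟨a, ha, hma, fun b hb hmb => hmono.injOn hb ha (hmb.trans hma.symm), ?_⟩
  intro R hrR U u v Ω hΩ hU
  have huniv := DeltaSubharmonic.stieltjesMeasure_univ hr.le hm h_cont h_zero hmod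
  rcases ha.1.eq_or_lt with rfl | ha0
  · have hzero : DeltaSubharmonic.stieltjesMeasure m hr.le hm = 0 := by
      rw [← Measure.measure_univ_eq_zero, huniv, ← hma, h_zero, ENNReal.ofReal_zero]
    rw [hzero]
    simp
  have hM : 0 ≤ m r - m 0 := hma ▸ h_nonneg a ha
  have hfin : IsFiniteMeasure (DeltaSubharmonic.stieltjesMeasure m hr.le hm) :=
    ⟨by rw [huniv]; exact ENNReal.ofReal_lt_top⟩
  have hsupp : ∀ᵐ t ∂(DeltaSubharmonic.stieltjesMeasure m hr.le hm), t ∈ Icc 0 r :=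
    ae_restrict_mem measurableSet_Icc
  have hR : 0 < R := hr.trans hrR
  have hlog : 1 ≤ Real.log (4 * Real.exp (DeltaSubharmonic.sConst h r) * R / a) := by
    rw [Real.le_log_iff_exp_le (by positivity)]
    have h1 := Real.one_le_exp hS
    have h2 := Real.exp_one_lt_d9
    rw [le_div_iff₀ ha0]
    have h3 : a ≤ R := ha.2.trans hrR.le
    have h4 : a ≤ Real.exp (DeltaSubharmonic.sConst h r) * R := by nlinarith
    nlinarith
  obtain ⟨h1, h2, h3⟩ := hU.lintegral_maxChar_le hr hrR hΩ
    (K := ENNReal.ofReal (6 * R / (R - r)) * ENNReal.ofReal ((m r - m 0) *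
      Real.log (4 * Real.exp (DeltaSubharmonic.sConst h r) * R / a)))
    (ENNReal.mul_ne_top ENNReal.ofReal_ne_top ENNReal.ofReal_ne_top) hsupp
    (fun s hs => DeltaSubharmonic.lintegral_greenKernel_le ha0 ha.2 hrR hM hS
      (fun c d hcd hd => DeltaSubharmonic.stieltjesMeasure_Icc_le hr.le hm h_cont h_zero hmod
        hmono.monotoneOn hcd (hd.trans ha.2)) huniv.le hsupp
      (hma ▸ DeltaSubharmonic.lintegral_div_le h_cont h_zero h_diff hpos hS h_bdd ha) hs) (by
    rw [huniv]
    refine mul_le_mul' (ENNReal.ofReal_le_ofReal ?_) (ENNReal.ofReal_le_ofReal ?_)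
    · exact div_le_div_of_nonneg_right (by linarith) (by linarith)
    · nlinarith)
  exact ⟨h1, h2, fun r₀ hr₀ => (h3 r₀ hr₀).trans_eq (mul_right_comm _ _ _)⟩
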